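/- **Setting.** Let $\ell,\mu,L_2>0$, $n\ge 0$, $n'\ge 1$, $\kappa_y=\ell/\mu$. Let $f:\mathbb R^n\times\mathbb R^{n'}\to\mathbb R$ be differentiable with $\nabla f$ $\ell$-Lipschitz jointly in $(x,y)$ (Euclidean norm), let $f(x,\cdot)$ be $\mu$-strongly concave for every $x$, let $\Phi(x)=\max_y f(x,y)$ be bounded below with $\Phi^*=\inf\Phi$, and let $\nabla^2\Phi$ exist everywhere and be $L_2$-Lipschitz. A first-order oracle call at $(x,y)$ returns $f(x,y)$ and $\nabla f(x,y)$. A first-order program is a deterministic procedure that has access to $f$ only through oracle calls; its cost is the number of calls. **Algorithm IAPUN.** Parameters: $\alpha,\gamma,\eta,\delta_x,\delta_y,\Delta_y,\epsilon>0$; $L_1=(1+\kappa_y)\ell$, $\kappa_x=\gamma/\alpha$, $\omega=\frac{2\sqrt{\kappa_x}-1}{2\sqrt{\kappa_x}+1}$, $\chi=6\sqrt{\kappa_x}\Big(11\kappa_x\delta_x+(2\ell+L_1+\alpha)\sqrt{\tfrac{2\delta_x}{\gamma+2\alpha}}\,\tfrac{\alpha}{L_2}\Big)$. It calls first-order programs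 of three kinds: one returns for a point $x$ a pair $(\phi_x,g_x)$ with $|\phi_x-\Phi(x)|\le\delta_y$, $\|g_x-\nabla\Phi(x)\|\le\Delta_y$; the other two return for points $p,c$ a $\delta_x$-minimizer (in function value) of $x\mapsto\Phi(x)+\alpha\|x-p\|^2+\gamma\|x-c\|^2$, respectively over $\mathbb R^n$ ("$\mathrm{prox}(p,c)$") and over the closed ball of radius $\frac{\alpha}{4L_2}$ about $p$ ("$\mathrm{prox}_B(p,c)$"). Epoch $k=1,2,\dots$ starts from $p=p_{k-1}$; write $\hat\phi(x)=\phi_x+\alpha\|x-p\|^2$, $\hat g(x)=g_x+2\alpha(x-p)$, and set $\tilde x_0=x_0=p$. For $t=1,2,\dots$ put $x_t=\mathrm{prox}(p,\tilde x_{t-1})$, $\tilde x_t=x_t+\omega(x_t-x_{t-1})$, and check progress: * If $\hat\phi(x_t)>\hat\phi(x_0)+\chi+2\delta_y$, the epoch ends: if $\phi_{x_s}\le\phi_{x_0}-\frac{\alpha^3}{32L_2^2}$ for some $1\le s\le t-1$, with Flag 1 and no $w$; else if $\|x_t-x_0\|\le\frac{\alpha}{4L_2}$, with Flag 2 and $w=x_0$;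 else $x_t$ is replaced by $\mathrm{prox}_B(p,\tilde x_{t-1})$, and the epoch ends with Flag 2, $w=x_0$ if still $\hat\phi(x_t)>\hat\phi(x_0)+\chi+2\delta_y$, and with Flag 3, $w=x_t$ otherwise. * Otherwise let $w=\mathrm{prox}(p,x_t)$ and $E=\hat\phi(x_0)-\hat\phi(w)+\frac\alpha4\|w-x_0\|^2$. If $\gamma\|w-x_t\|^2>\big(1-\frac1{6\sqrt{\kappa_x}}\big)^tE+\chi+\delta_x+2\delta_y$, the epoch ends with Flag 4; else if $\gamma\|w-x_t\|\le\epsilon/40$, it ends with Flag 5; else it continues with $t+1$. Let the epoch end at $t=T$. For Flags 3, 5 put $p_k=w$. For Flags 1, 2, 4 let $z$ minimize $\phi$ over $\{x_0,\dots,x_T\}$ and $w$ (if there is one). If $\phi_z\le\phi_{x_0}-\frac{\alpha^3}{32L_2^2}$, put $p_k=z$. Otherwise go through the pairs $(u,v)=(x_{t-1},x_t),(w,x_t)$, $t=1,\dots,T$, in this order, take the first one with $\hat\phi(u)-\hat\phi(v)-\hat g(v)^\top(u-v)-\frac\alpha2\|u-v\|^2<-2\delta_y-\Delta_y\|u-v\|$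 (the method stops without output if there is none), and let $p_k$ be the one of $u\pm\eta\frac{u-v}{\|u-v\|}$ with smaller $\phi$. If $\|g_{p_k}\|\le\frac{3\epsilon}4$, return $p_k$; otherwise start the next epoch. **Statement.** There are universal constants $C>0$ and $q\in\mathbb N$ such that the following holds for all $\ell,\mu,L_2>0$ and $0<\epsilon\le\ell^2/L_2$. Put $\alpha=\sqrt{L_2\epsilon}$, $\gamma=\ell$, $\eta=\alpha/L_2$. There are tolerances $\delta_x,\delta_y,\Delta_y>0$, depending only on $\ell,\mu,L_2,\epsilon$, such that for all $n$, all $n'\ge1$ and every $y_0\in\mathbb R^{n'}$ there are first-order programs which, for every $f$ as above, have the three accuracy properties required by IAPUN, and with which, for every $p_0\in\mathbb R^n$, IAPUN started at $p_0$ stops and returns a point $p$ with $\|\nabla\Phi(p)\|\le\epsilon$ after a total number $N$ of first-order oracle calls of $f$ satisfying $$N\le C\cdot\frac{\sqrt{\kappa_y}\;\max\{\Phi(p_0)-\Phi^*,\ \epsilon^{3/2}L_2^{-1/2}\}\;\ell^{1/2}L_2^{1/4}}{\epsilon^{7/4}}\cdot\log^q\Big(2+\kappa_y+\frac{\ell^2}{L_2\epsilon}+\frac{L_2^{1/2}(\Phi(p_0)-\Phi^*)}{\epsilon^{3/2}}+\frac{\ell\,(\Phi(p_0)-f(p_0,y_0))}{\epsilon^2}\Big).$$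 In particular, once $\epsilon^{3/2}\le L_2^{1/2}(\Phi(p_0)-\Phi^*)$, $N=\tilde O\big(\sqrt{\kappa_y}\,(\Phi(p_0)-\Phi^*)\,\ell^{1/2}L_2^{1/4}\epsilon^{-7/4}\big)$. -/

import Mathlib

namespace Minimax

noncomputable section

/-- `ℝⁿ` with the Euclidean norm. -/
abbrev Vec (n : ℕ) : Type := EuclideanSpace ℝ (Fin n)

/-- `ℝⁿ × ℝᵐ` with the Euclidean norm of `ℝⁿ⁺ᵐ`. -/
abbrev Pair (n m : ℕ) : Type := WithLp 2 (Vec n × Vec m)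

/-- The point `(x, y)` of `ℝⁿ × ℝᵐ`. -/
def pair {n m : ℕ} (x : Vec n) (y : Vec m) : Pair n m := WithLp.toLp 2 (x, y)

/-- The primal function `Φ(x) = max_y f(x, y)`. -/
def primal {n m : ℕ} (f : Pair n m → ℝ) (x : Vec n) : ℝ := ⨆ y : Vec m, f (pair x y)

/-- Nonconvex-strongly-concave problems with second-order smoothness: `f(x, ·)` is `μ`-strongly
concave, `Φ` is bounded below, `∇f` is `ℓ`-Lipschitz jointly in `(x, y)`, and the Hessian of `Φ`
exists everywhere and is `L₂`-Lipschitz (in operator norm). -/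
structure IsNCSC {n m : ℕ} (f : Pair n m → ℝ) (ℓ μ L₂ : ℝ) : Prop where
  strongConcave : ∀ x : Vec n, StrongConcaveOn Set.univ μ (fun y : Vec m => f (pair x y))
  bddBelow : BddBelow (Set.range (primal f))
  differentiable : Differentiable ℝ f
  gradient_lipschitz : ∀ z z' : Pair n m, ‖gradient f z - gradient f z'‖ ≤ ℓ * ‖z - z'‖
  primal_differentiable : Differentiable ℝ (primal f)
  primal_gradient_differentiable : Differentiable ℝ (gradient (primal f))
  primal_hessian_lipschitz : ∀ x x' : Vec n,
    ‖fderiv ℝ (gradient (primal f)) x - fderiv ℝ (gradient (primal f)) x'‖ ≤ L₂ * ‖x - x'‖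

/-! ### First-order oracle programs -/

/-- A deterministic program that interacts with an unknown function `f` only through a first-order
oracle: it either stops with a result, or queries a point `z = (x, y)`, receives
`(f z, ∇f z)` and continues. Computations between queries are free. -/
inductive Prog (n m : ℕ) (R : Type) : Type
  | ret (r : R) : Prog n m R
  | query (z : Pair n m) (k : ℝ × Pair n m → Prog n m R) : Prog n m R

/-- Sequential composition. -/
def Prog.bind {n m : ℕ} {R T : Type} : Prog n m R → (R → Prog n m T) → Prog n m T
  | .ret r, g => g r
  | .query z k, g => .query z (fun a => (k a).bind g)

instance (n m : ℕ) : Monad (Prog n m) where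
  pure := Prog.ret
  bind := Prog.bind

/-- The result of running a program on the oracle of `f`, and the number of oracle calls. -/
def Prog.run {n m : ℕ} {R : Type} (f : Pair n m → ℝ) : Prog n m R → R × ℕ
  | .ret r => (r, 0)
  | .query z k => (((k (f z, gradient f z)).run f).1, ((k (f z, gradient f z)).run f).2 + 1)

/-! ### Parameters and subroutines of IAPUN -/

/-- Input parameters of IAPUN. -/
structure Params where
  ℓ : ℝ
  μ : ℝ
  L₂ : ℝ
  ε : ℝ
  α : ℝ
  γ : ℝ
  η : ℝ
  δx : ℝ
  δy : ℝ
  Δy : ℝ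

namespace Params

variable (P : Params)

/-- `κ_y = ℓ / μ`. -/
def κy : ℝ := P.ℓ / P.μ

/-- `L₁ = (1 + κ_y) ℓ`. -/
def L₁ : ℝ := (1 + P.κy) * P.ℓ

/-- `κ_x = γ / α`. -/
def κx : ℝ := P.γ / P.α

/-- The momentum coefficient `ω = (2 √κ_x - 1) / (2 √κ_x + 1)`. -/
def ω : ℝ := (2 * √P.κx - 1) / (2 * √P.κx + 1)

/-- `d = α / L₂`. -/
def d : ℝ := P.α / P.L₂

/-- `χ = 6 √κ_x (11 κ_x δ_x + (2ℓ + L₁ + α) √(2 δ_x / (γ + 2α)) d)`. -/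
def χ : ℝ := 6 * √P.κx *
  (11 * P.κx * P.δx + (2 * P.ℓ + P.L₁ + P.α) * √(2 * P.δx / (P.γ + 2 * P.α)) * P.d)

/-- The decrease `α³ / (32 L₂²)` of function values that the method tests for. -/
def decrease : ℝ := P.α ^ 3 / (32 * P.L₂ ^ 2)

/-- The radius `α / (4 L₂)` of the balls `𝒳_k`. -/
def radius : ℝ := P.α / (4 * P.L₂)

end Params

/-- The first-order programs that IAPUN calls:
`estimate x` returns approximations `(φ_x, g_x)` of `(Φ(x), ∇Φ(x))`;
`prox p c` approximately minimizes `Φ(x) + α‖x - p‖² + γ‖x - c‖²` over `ℝⁿ`;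
`proxBall p c` approximately minimizes it over the ball `B(p, α / (4 L₂))`. -/
structure Subroutines (n m : ℕ) where
  estimate : Vec n → Prog n m (ℝ × Vec n)
  prox : Vec n → Vec n → Prog n m (Vec n)
  proxBall : Vec n → Vec n → Prog n m (Vec n)

/-- The objective `Φ(x) + α‖x - p‖² + γ‖x - c‖²` of the proximal point subproblems. -/
def proxObjective {n m : ℕ} (P : Params) (f : Pair n m → ℝ) (p c x : Vec n) : ℝ :=
  primal f x + P.α * ‖x - p‖ ^ 2 + P.γ * ‖x - c‖ ^ 2

/-- The accuracy required of the subroutines when they run on the oracle of `f`. -/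
structure Subroutines.Accurate {n m : ℕ} (S : Subroutines n m) (P : Params)
    (f : Pair n m → ℝ) : Prop where
  value : ∀ x : Vec n, |((S.estimate x).run f).1.1 - primal f x| ≤ P.δy
  grad : ∀ x : Vec n, ‖((S.estimate x).run f).1.2 - gradient (primal f) x‖ ≤ P.Δy
  prox : ∀ p c x : Vec n,
    proxObjective P f p c ((S.prox p c).run f).1 ≤ proxObjective P f p c x + P.δx
  proxBall_mem : ∀ p c : Vec n, ((S.proxBall p c).run f).1 ∈ Metric.closedBall p P.radius
  proxBall : ∀ p c : Vec n, ∀ x ∈ Metric.closedBall p P.radius,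
    proxObjective P f p c ((S.proxBall p c).run f).1 ≤ proxObjective P f p c x + P.δx

/-! ### The algorithm

In epoch `k` below, `p` is the current point `p_{k-1} = x_{k,0}`. -/

/-- The non-null flags that `certify` can return. -/
inductive Flag
  | one
  | two
  | three
  | four
  | five

/-- The outcome of a `certify` call that ends an epoch: the flag, the point `w_k` (possibly null),
and the last iterate `x_{k,T_k}`, which `certify` may have recomputed. -/
structure Certificate (n : ℕ) where
  flag : Flag
  w : Option (Vec n)
  last : Vec n

section Algorithm

variable {n m : ℕ} (P : Params) (S : Subroutines n m)

/-- Approximate function values at all points of a list, each paired with its point. -/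
def estimateAll : List (Vec n) → Prog n m (List (Vec n × ℝ))
  | [] => pure []
  | x :: xs => do
      let r ← S.estimate x
      let rs ← estimateAll xs
      pure ((x, r.1) :: rs)

/-- A pair with smallest second component among `a` and the members of a list. -/
def argminVal (a : Vec n × ℝ) : List (Vec n × ℝ) → Vec n × ℝ
  | [] => a
  | b :: bs => argminVal (if b.2 < a.2 then b else a) bs

/-- Progress check after the `t`-th iterate `xt` of the epoch has been computed from the
extrapolated point `xtil = x̃_{k,t-1}`; the list `earlier` is `[x_{k,1}, …, x_{k,t-1}]`.
The result `none` is the null flag. -/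
def certify (p : Vec n) (earlier : List (Vec n)) (xt xtil : Vec n) :
    Prog n m (Option (Certificate n)) := do
  let rt ← S.estimate xt
  let r0 ← S.estimate p
  if rt.1 + P.α * ‖xt - p‖ ^ 2 > r0.1 + P.χ + 2 * P.δy then do
    let rs ← estimateAll S earlier
    if ∃ r ∈ rs, r.2 ≤ r0.1 - P.decrease then
      pure (some ⟨Flag.one, none, xt⟩)
    else if ‖p - xt‖ ≤ P.radius then
      pure (some ⟨Flag.two, some p, xt⟩)
    else do
      let xt' ← S.proxBall p xtil
      let rt' ← S.estimate xt'
      if rt'.1 + P.α * ‖xt' - p‖ ^ 2 > r0.1 + P.χ + 2 * P.δy then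
        pure (some ⟨Flag.two, some p, xt'⟩)
      else
        pure (some ⟨Flag.three, some xt', xt'⟩)
  else do
    let w ← S.prox p xt
    let rw' ← S.estimate w
    let E : ℝ := r0.1 - (rw'.1 + P.α * ‖w - p‖ ^ 2) + P.α / 4 * ‖w - p‖ ^ 2
    if P.γ * ‖w - xt‖ ^ 2 >
        (1 - 1 / (6 * √P.κx)) ^ (earlier.length + 1) * E + P.χ + P.δx + 2 * P.δy then
      pure (some ⟨Flag.four, some w, xt⟩)
    else if P.γ * ‖w - xt‖ ≤ P.ε / 40 then
      pure (some ⟨Flag.five, some w, xt⟩)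
    else
      pure none

/-- The inexact accelerated proximal point iterations of one epoch, at most `T` of them. The
result is the certificate and the trajectory `[x_{k,1}, …, x_{k,T_k}]`, or `none` if the budget `T`
is exhausted. -/
def innerLoop (p : Vec n) : (T : ℕ) → (earlier : List (Vec n)) → (xprev xtil : Vec n) →
    Prog n m (Option (Certificate n × List (Vec n)))
  | 0, _, _, _ => pure none
  | T + 1, earlier, xprev, xtil => do
      let xt ← S.prox p xtil
      let c ← certify P S p earlier xt xtil
      match c with
      | some c => pure (some (c, earlier ++ [c.last]))
      | none => innerLoop p T (earlier ++ [xt]) xt (xt + P.ω • (xt - xprev))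

/-- The pairs `(x_{k,t-1}, x_{k,t})`, `(w_k, x_{k,t})` for `t = 1, 2, …`, in this order. -/
def candidatePairs (w : Option (Vec n)) : Vec n → List (Vec n) → List (Vec n × Vec n)
  | _, [] => []
  | x, x' :: xs => (x, x') :: (w.toList.map (fun v => (v, x')) ++ candidatePairs w x' xs)

/-- The first pair `(u, v)` of a list with `ζ(u, v) < -2 δ_y - Δ_y ‖u - v‖`. -/
def findPair (p : Vec n) : List (Vec n × Vec n) → Prog n m (Option (Vec n × Vec n))
  | [] => pure none
  | (u, v) :: rest => do
      let ru ← S.estimate u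
      let rv ← S.estimate v
      let ζ : ℝ := (ru.1 + P.α * ‖u - p‖ ^ 2) - (rv.1 + P.α * ‖v - p‖ ^ 2)
        - inner ℝ (rv.2 + (2 * P.α) • (v - p)) (u - v) - P.α / 2 * ‖u - v‖ ^ 2
      if ζ < -2 * P.δy - P.Δy * ‖u - v‖ then
        pure (some (u, v))
      else
        findPair p rest

/-- The negative curvature step; `none` if no pair `(u, v)` is found. -/
def exploitNcvx (p : Vec n) (w : Option (Vec n)) (traj : List (Vec n)) :
    Prog n m (Option (Vec n)) := do
  let uv ← findPair P S p (candidatePairs w p traj)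
  match uv with
  | none => pure none
  | some (u, v) => do
      let x₁ : Vec n := u + (P.η / ‖u - v‖) • (u - v)
      let x₂ : Vec n := u - (P.η / ‖u - v‖) • (u - v)
      let r₁ ← S.estimate x₁
      let r₂ ← S.estimate x₂
      pure (some (argminVal (x₁, r₁.1) [(x₂, r₂.1)]).1)

/-- The choice of `p_k` at the end of an epoch. -/
def nextPoint (p : Vec n) (c : Certificate n) (traj : List (Vec n)) :
    Prog n m (Option (Vec n)) :=
  match c.flag with
  | Flag.three | Flag.five => pure c.w
  | Flag.one | Flag.two | Flag.four => do
      let r0 ← S.estimate p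
      let rs ← estimateAll S (traj ++ c.w.toList)
      let z := argminVal (p, r0.1) rs
      if z.2 ≤ r0.1 - P.decrease then
        pure (some z.1)
      else
        exploitNcvx P S p c.w traj

/-- At most `K` epochs of at most `T` inner iterations each, from the point `p`. -/
def outerLoop (T : ℕ) : (K : ℕ) → (p : Vec n) → Prog n m (Option (Vec n))
  | 0, _ => pure none
  | K + 1, p => do
      let e ← innerLoop P S p T [] p p
      match e with
      | none => pure none
      | some (c, traj) => do
          let q ← nextPoint P S p c traj
          match q with
          | none => pure none
          | some q => do
              let r ← S.estimate q
              if ‖r.2‖ ≤ 3 * P.ε / 4 then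
                pure (some q)
              else
                outerLoop T K q

/-- On the oracle of `f`, IAPUN started at `p₀` halts and returns `p` after exactly `N` oracle
calls in total. (The budget `B` only bounds the lengths of the loops: a run that returns a point
has not exhausted it.) -/
def IAPUNReturns (f : Pair n m → ℝ) (p₀ p : Vec n) (N : ℕ) : Prop :=
  ∃ B : ℕ, (outerLoop P S B B p₀).run f = (some p, N)

end Algorithm

end

end Minimax

namespace Minimax

open scoped InnerProductSpace

/-! ### Descent, projection, acceleration and negative curvature in Hilbert spaces -/

section Analysis

variable {E : Type*} [NormedAddCommGroup E] [InnerProductSpace ℝ E]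

/-! Put d = α/L₂ and U = αd² = ε^{3/2}L₂^{-1/2}, so that αd = ε. The heart of the proof is that an
epoch ends either at a point with estimated gradient at most 3ε/4 or with Φ lowered by U/40
(`Regular.epoch_progress`). Hence about (Φ(p₀) - Φ*)/U epochs suffice. An epoch has O(√κ_x log)
iterations and O(1) subroutine calls per iteration on average, and a call costs O(√κ_y log²) oracle
calls.

Progress. An epoch runs an inexact accelerated proximal point method on Φ + α‖· - p‖² as if this
function were α-strongly convex. The convergence proof uses convexity only at the pairs (x_{t-1},
x_t) and (w, x_t), which are exactly the pairs that the algorithm tests. If all of them pass, the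
linear rate of `Regular.convergence` contradicts the event that raised Flag 2 or Flag 4. So after
these flags either some computed value has dropped by U/32, or all points lie within d/4 of p and
some pair (u, v) fails. A failing pair forces second derivative at most L₂‖u - v‖ - α ≤ -α/2 of Φ at
u along u - v, and since the Hessian is L₂-Lipschitz, a step of length d in one of the two
directions lowers Φ (`negative_curvature`). For Flag 1 the drop has already been observed. For Flag
3 the new point is near the boundary of the ball, so Φ must have paid for the term α‖x - p‖². For
Flag 5 the point w is nearly stationary for the augmented function, so either the estimated gradient
is small or w is at distance at least 0.34 d from p, and Φ has paid again. As long as no flag is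
raised, the residual γ‖w - x_t‖ exceeds ε/40 while its square is controlled by a geometrically
decaying energy; this bounds the length of an epoch (`Regular.running_energy`).

Subroutines. All three solve min over x ∈ X of max over y for a regularized saddle function, with X
a point, the whole space or a ball. This function has condition number 5 in x. The solver runs
Nesterov's method on the dual function y ↦ -min_x, with inner minimizations by linearly convergent
projected gradient steps; `solve_gap` and `solve_cost` give its accuracy and its price.

Locality. The price of a call depends logarithmically on the gradients at its starting point, and
these are not bounded uniformly in f. Therefore every visited point is confined to a ball about p₀
whose radius is polynomial in the argument A of the logarithm (`Regular.epoch_region`,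
`Regular.outerLoop_run`, `IsNCSC.data_bound`). The tolerances are inverse polynomials in ℓ²/(L₂ε)
and 1 + κ_y, so the required precision also costs only logarithms. -/

theorem apply_le_apply_zero_of_hasDerivAt_nonpos {f f' : ℝ → ℝ} (hf : ∀ s, HasDerivAt f (f' s) s)
    {r : ℝ} (hr : 0 ≤ r) (hle : ∀ s, 0 < s → s < r → f' s ≤ 0) : f r ≤ f 0 := by
  have h := antitoneOn_of_deriv_nonpos (convex_Icc (0 : ℝ) r)
    (fun s _ => (hf s).continuousAt.continuousWithinAt)
    (fun s _ => (hf s).differentiableAt.differentiableWithinAt)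
    (fun s hs => by
      rw [interior_Icc] at hs
      rw [(hf s).deriv]
      exact hle s hs.1 hs.2)
  exact h ⟨le_rfl, hr⟩ ⟨hr, le_rfl⟩ hr

theorem hasDerivAt_comp_line [CompleteSpace E] {F : E → ℝ} {G : E → E}
    (hF : ∀ z, HasGradientAt F (G z) z) (z v : E) (s : ℝ) :
    HasDerivAt (fun s : ℝ => F (z + s • v)) ⟪G (z + s • v), v⟫_ℝ s := by
  have h1 : HasDerivAt (fun s : ℝ => z + s • v) v s := by
    simpa using ((hasDerivAt_id s).smul_const v).const_add z
  have h2 := (hF (z + s • v)).hasFDerivAt.comp_hasDerivAt s h1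
  simpa using! h2

/-- The descent lemma. -/
theorem le_add_sq_of_lipschitz_gradient [CompleteSpace E] {F : E → ℝ} {G : E → E} {L : ℝ}
    (hF : ∀ z, HasGradientAt F (G z) z) (hG : ∀ z z', ‖G z - G z'‖ ≤ L * ‖z - z'‖) (z z' : E) :
    F z' ≤ F z + ⟪G z, z' - z⟫_ℝ + L / 2 * ‖z' - z‖ ^ 2 := by
  set v := z' - z with hv
  have h : ∀ s : ℝ, HasDerivAt
      (fun s : ℝ => F (z + s • v) - s * ⟪G z, v⟫_ℝ - L / 2 * ‖v‖ ^ 2 * s ^ 2)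
      (⟪G (z + s • v), v⟫_ℝ - ⟪G z, v⟫_ℝ - L * ‖v‖ ^ 2 * s) s := by
    intro s
    have h1 := ((hasDerivAt_comp_line hF z v s).sub
      ((hasDerivAt_id s).mul_const ⟪G z, v⟫_ℝ)).sub
      (((hasDerivAt_id s).pow 2).const_mul (L / 2 * ‖v‖ ^ 2))
    convert! h1 using 1
    simp; ring
  have := apply_le_apply_zero_of_hasDerivAt_nonpos h zero_le_one (fun s hs _ => by
    rw [← inner_sub_left]
    have h1 := real_inner_le_norm (G (z + s • v) - G z) v
    have h2 := hG (z + s • v) z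
    rw [add_sub_cancel_left, norm_smul, Real.norm_of_nonneg hs.le] at h2
    nlinarith [mul_le_mul_of_nonneg_right h2 (norm_nonneg v)])
  have e : z + (1 : ℝ) • v = z' := by simp [hv]
  simp only [e, zero_smul, add_zero] at this
  linarith

theorem sub_sq_le_of_lipschitz_gradient [CompleteSpace E] {F : E → ℝ} {G : E → E} {L : ℝ}
    (hF : ∀ z, HasGradientAt F (G z) z) (hG : ∀ z z', ‖G z - G z'‖ ≤ L * ‖z - z'‖) (z z' : E) :
    F z + ⟪G z, z' - z⟫_ℝ - L / 2 * ‖z' - z‖ ^ 2 ≤ F z' := by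
  have := le_add_sq_of_lipschitz_gradient (F := fun z => -F z) (G := fun z => -G z) (L := L)
    (fun z => by
      have h := (hF z).hasFDerivAt.neg
      rw [hasGradientAt_iff_hasFDerivAt, map_neg]
      exact h)
    (fun z z' => by rw [neg_sub_neg, norm_sub_rev]; exact hG z z') z z'
  simp only [inner_neg_left] at this
  linarith

/-- The gradient inequality of a strongly concave function. -/
theorem strongConcaveOn_gradient_le [CompleteSpace E] {F : E → ℝ} {g : E} {μ : ℝ} {z : E}
    (hc : StrongConcaveOn Set.univ μ F) (hg : HasGradientAt F g z) (z' : E) :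
    F z' ≤ F z + ⟪g, z' - z⟫_ℝ - μ / 2 * ‖z' - z‖ ^ 2 := by
  set v := z' - z with hv
  have h1 : HasDerivAt (fun s : ℝ => F (z + s • v)) ⟪g, v⟫_ℝ 0 := by
    have h1 : HasDerivAt (fun s : ℝ => z + s • v) v 0 := by
      simpa using ((hasDerivAt_id (0 : ℝ)).smul_const v).const_add z
    have hg' : HasFDerivAt F (InnerProductSpace.toDual ℝ E g) (z + (0 : ℝ) • v) := by
      simpa using hg.hasFDerivAt
    simpa using! hg'.comp_hasDerivAt (0 : ℝ) h1
  -- The secant inequality at parameter t is divided by t and t tends to 0 from the right; the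
  -- summand with factor 0 is inert.
  have h2 : Filter.Tendsto (fun t : ℝ => t⁻¹ * (F (z + t • v) - F z) + μ / 2 * (1 - t) * 0)
      (nhdsWithin 0 (Set.Ioi 0)) (nhds (⟪g, v⟫_ℝ + μ / 2 * (1 - 0) * 0)) := by
    refine Filter.Tendsto.add ?_ (by simp)
    have := h1.tendsto_slope_zero_right
    simpa using this
  have h3 : Filter.Tendsto (fun t : ℝ => F z' - F z + (1 - t) * (μ / 2 * ‖v‖ ^ 2))
      (nhdsWithin 0 (Set.Ioi 0)) (nhds (F z' - F z + (1 - 0) * (μ / 2 * ‖v‖ ^ 2))) := by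
    have : Continuous (fun t : ℝ => F z' - F z + (1 - t) * (μ / 2 * ‖v‖ ^ 2)) := by fun_prop
    exact this.continuousAt.tendsto.mono_left nhdsWithin_le_nhds
  have h4 := le_of_tendsto_of_tendsto h3 h2 (by
    have : Set.Ioo (0 : ℝ) 1 ∈ nhdsWithin (0 : ℝ) (Set.Ioi 0) := Ioo_mem_nhdsGT one_pos
    filter_upwards [this] with t ht
    have := hc.2 (Set.mem_univ z) (Set.mem_univ z') (sub_nonneg.2 ht.2.le) ht.1.le (by ring)
    have e : (1 - t) • z + t • z' = z + t • v := by rw [hv]; module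
    rw [e, norm_sub_rev z z', ← hv] at this
    simp only [smul_eq_mul] at this
    rw [mul_zero, add_zero, inv_mul_eq_div, le_div_iff₀ ht.1]
    nlinarith)
  linarith

/-- `P` is the metric projection onto `X`. -/
def IsProjection (X : Set E) (P : E → E) : Prop :=
  ∀ x, P x ∈ X ∧ ∀ z ∈ X, ⟪x - P x, z - P x⟫_ℝ ≤ 0

theorem exists_isProjection {X : Set E} (hne : X.Nonempty) (hX : IsComplete X)
    (hc : Convex ℝ X) : ∃ P : E → E, IsProjection X P := by
  have : ∀ x, ∃ v ∈ X, ∀ z ∈ X, ⟪x - v, z - v⟫_ℝ ≤ 0 := fun x => by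
    obtain ⟨v, hv, h⟩ := exists_norm_eq_iInf_of_complete_convex hne hX hc x
    exact ⟨v, hv, (norm_eq_iInf_iff_real_inner_le_zero hc hv).1 h⟩
  choose P h1 h2 using this
  exact ⟨P, fun x => ⟨h1 x, h2 x⟩⟩

theorem IsProjection.norm_sub_le {X : Set E} {P : E → E} (hP : IsProjection X P) (x y : E) :
    ‖P x - P y‖ ≤ ‖x - y‖ := by
  have h1 := (hP x).2 _ (hP y).1
  have h2 := (hP y).2 _ (hP x).1
  have h3 : ‖P x - P y‖ ^ 2 ≤ ⟪x - y, P x - P y⟫_ℝ := by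
    have e : ⟪x - y, P x - P y⟫_ℝ - ‖P x - P y‖ ^ 2
        = -⟪x - P x, P y - P x⟫_ℝ - ⟪y - P y, P x - P y⟫_ℝ := by
      rw [← real_inner_self_eq_norm_sq]
      simp only [inner_sub_left, inner_sub_right, real_inner_comm]
      ring
    linarith
  have h4 := real_inner_le_norm (x - y) (P x - P y)
  by_contra! h
  nlinarith [norm_nonneg (x - y), norm_nonneg (P x - P y)]

/-- A projected gradient step contracts if the operator is strongly monotone and Lipschitz. -/
theorem IsProjection.gradient_step_norm_sq_le {X : Set E} {P : E → E} (hP : IsProjection X P)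
    {G : E → E} {m L : ℝ} (hm : 0 < m) (hL : 0 < L)
    (hmono : ∀ x y, m * ‖x - y‖ ^ 2 ≤ ⟪G x - G y, x - y⟫_ℝ)
    (hlip : ∀ x y, ‖G x - G y‖ ≤ L * ‖x - y‖) (x y : E) :
    ‖P (x - (m / L ^ 2) • G x) - P (y - (m / L ^ 2) • G y)‖ ^ 2
      ≤ (1 - m ^ 2 / L ^ 2) * ‖x - y‖ ^ 2 := by
  have h1 := hP.norm_sub_le (x - (m / L ^ 2) • G x) (y - (m / L ^ 2) • G y)
  have e : x - (m / L ^ 2) • G x - (y - (m / L ^ 2) • G y)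
      = (x - y) - (m / L ^ 2) • (G x - G y) := by module
  rw [e] at h1
  have h2 : ‖(x - y) - (m / L ^ 2) • (G x - G y)‖ ^ 2
      = ‖x - y‖ ^ 2 - 2 * (m / L ^ 2) * ⟪G x - G y, x - y⟫_ℝ
        + (m / L ^ 2) ^ 2 * ‖G x - G y‖ ^ 2 := by
    rw [norm_sub_sq_real, inner_smul_right, norm_smul, mul_pow, Real.norm_eq_abs, sq_abs,
      real_inner_comm]
    ring
  have h3 : ‖G x - G y‖ ^ 2 ≤ L ^ 2 * ‖x - y‖ ^ 2 := by
    rw [← mul_pow]; exact pow_le_pow_left₀ (norm_nonneg _) (hlip x y) 2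
  have h4 := hmono x y
  calc _ ≤ ‖(x - y) - (m / L ^ 2) • (G x - G y)‖ ^ 2 :=
        pow_le_pow_left₀ (norm_nonneg _) h1 2
    _ ≤ ‖x - y‖ ^ 2 - 2 * (m / L ^ 2) * (m * ‖x - y‖ ^ 2)
        + (m / L ^ 2) ^ 2 * (L ^ 2 * ‖x - y‖ ^ 2) := by rw [h2]; gcongr
    _ = _ := by field_simp; ring

/-- Strongly monotone variational inequalities have solutions. -/
theorem IsProjection.exists_variational [CompleteSpace E] {X : Set E} {P : E → E}
    (hP : IsProjection X P) {G : E → E} {m L : ℝ} (hm : 0 < m) (hmL : m ≤ L)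
    (hmono : ∀ x y, m * ‖x - y‖ ^ 2 ≤ ⟪G x - G y, x - y⟫_ℝ)
    (hlip : ∀ x y, ‖G x - G y‖ ≤ L * ‖x - y‖) :
    ∃ x, P (x - (m / L ^ 2) • G x) = x ∧ x ∈ X ∧ ∀ z ∈ X, 0 ≤ ⟪G x, z - x⟫_ℝ := by
  have hL : 0 < L := hm.trans_le hmL
  have hq : 0 < m ^ 2 / L ^ 2 := by positivity
  have hq' : m ^ 2 / L ^ 2 ≤ 1 := by
    rw [div_le_one (by positivity)]; exact pow_le_pow_left₀ hm.le hmL 2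
  -- The solution is the Banach fixed point of the projected gradient step.
  have hK : ContractingWith (Real.toNNReal √(1 - m ^ 2 / L ^ 2))
      (fun x => P (x - (m / L ^ 2) • G x)) := by
    refine ⟨?_, LipschitzWith.of_dist_le_mul fun x y => ?_⟩
    · rw [Real.toNNReal_lt_one, Real.sqrt_lt' one_pos]; linarith
    · rw [Real.coe_toNNReal _ (Real.sqrt_nonneg _), dist_eq_norm, dist_eq_norm]
      refine le_of_sq_le_sq ?_ (by positivity)
      rw [mul_pow, Real.sq_sqrt (by linarith)]
      exact hP.gradient_step_norm_sq_le hm hL hmono hlip x y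
  have hfix : P (_ - _) = _ := hK.fixedPoint_isFixedPt
  set x := ContractingWith.fixedPoint _ hK with hx
  refine ⟨x, hfix, hfix ▸ (hP _).1, fun z hz => ?_⟩
  have h := (hP (x - (m / L ^ 2) • G x)).2 z hz
  rw [hfix, sub_sub_cancel_left, inner_neg_left, inner_smul_left] at h
  have : 0 < m / L ^ 2 := by positivity
  simp only [conj_trivial] at h
  nlinarith

/-- One step of Nesterov's accelerated scheme with inexact inequalities. -/
theorem nesterov_step {q L err Fx Fx' Fw : ℝ} (hq : 0 < q) (hq1 : q ≤ 1)
    {x z xt x' w : E} (hL : 0 < L) (hxt : (1 + q) • xt = x + q • z)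
    (hx : Fx' + ⟪L • (xt - x'), x - xt⟫_ℝ + L / 2 * ‖xt - x'‖ ^ 2 ≤ Fx + err)
    (hw : Fx' + ⟪L • (xt - x'), w - xt⟫_ℝ + L / 2 * ‖xt - x'‖ ^ 2
      + q ^ 2 * L / 2 * ‖w - xt‖ ^ 2 ≤ Fw + err) :
    Fx' - Fw + q ^ 2 * L / 2 * ‖x + q⁻¹ • (x' - x) - w‖ ^ 2
      ≤ (1 - q) * (Fx - Fw + q ^ 2 * L / 2 * ‖z - w‖ ^ 2) + err := by
  have hz : z = q⁻¹ • ((1 + q) • xt - x) := by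
    rw [hxt, add_sub_cancel_left, smul_smul, inv_mul_cancel₀ hq.ne', one_smul]
  obtain ⟨d, rfl⟩ : ∃ d, x' = xt - d := ⟨xt - x', by abel⟩
  obtain ⟨a, rfl⟩ : ∃ a, w = xt + a := ⟨w - xt, by abel⟩
  obtain ⟨b, rfl⟩ : ∃ b, x = xt + b := ⟨x - xt, by abel⟩
  have e1 : xt + b + q⁻¹ • (xt - d - (xt + b)) - (xt + a) = b - q⁻¹ • d - q⁻¹ • b - a := by module
  have e2 : z - (xt + a) = - q⁻¹ • b - a := by
    rw [hz]
    have : q⁻¹ • ((1 + q) • xt - (xt + b)) = (q⁻¹ * q) • xt - q⁻¹ • b := by module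
    rw [this, inv_mul_cancel₀ hq.ne']; module
  rw [e1, e2]
  simp only [sub_sub_cancel, add_sub_cancel_left, inner_smul_left, conj_trivial] at hx hw
  have n1 : ‖b - q⁻¹ • d - q⁻¹ • b - a‖ ^ 2 = (1 - q⁻¹) ^ 2 * ‖b‖ ^ 2 + q⁻¹ ^ 2 * ‖d‖ ^ 2 + ‖a‖ ^ 2
      - 2 * (1 - q⁻¹) * q⁻¹ * ⟪d, b⟫_ℝ - 2 * (1 - q⁻¹) * ⟪b, a⟫_ℝ + 2 * q⁻¹ * ⟪d, a⟫_ℝ := by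
    simp only [← real_inner_self_eq_norm_sq, inner_sub_left, inner_sub_right, inner_smul_left,
      inner_smul_right, conj_trivial, real_inner_comm b d, real_inner_comm a d, real_inner_comm a b]
    ring
  have n2 : ‖-q⁻¹ • b - a‖ ^ 2 = q⁻¹ ^ 2 * ‖b‖ ^ 2 + ‖a‖ ^ 2 + 2 * q⁻¹ * ⟪b, a⟫_ℝ := by
    simp only [← real_inner_self_eq_norm_sq, inner_sub_left, inner_sub_right, inner_smul_left,
      inner_smul_right, conj_trivial, real_inner_comm a b]
    ring
  rw [n1, n2]
  -- The usual combination with weights 1 - q for the previous iterate and q for the reference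
  -- point. After expansion about `xt`, the only surplus is the nonnegative multiple of ‖b‖² in
  -- `h5`.
  have key := add_le_add (mul_le_mul_of_nonneg_left hx (sub_nonneg.2 hq1))
    (mul_le_mul_of_nonneg_left hw hq.le)
  have h5 : 0 ≤ q * (1 - q) * L / 2 * ‖b‖ ^ 2 := by
    have := sub_nonneg.2 hq1
    positivity
  have hqi : q * q⁻¹ = 1 := mul_inv_cancel₀ hq.ne'
  generalize q⁻¹ = p at *
  have hqp2 : q ^ 2 * p ^ 2 = 1 := by rw [← mul_pow, hqi, one_pow]
  have hqp : q ^ 2 * p = q := by rw [sq, mul_assoc, hqi, mul_one]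
  have l1 : q ^ 2 * L / 2 * ((1 - p) ^ 2 * ‖b‖ ^ 2 + p ^ 2 * ‖d‖ ^ 2 + ‖a‖ ^ 2
      - 2 * (1 - p) * p * ⟪d, b⟫_ℝ - 2 * (1 - p) * ⟪b, a⟫_ℝ + 2 * p * ⟪d, a⟫_ℝ)
      = L / 2 * ((q - 1) ^ 2 * ‖b‖ ^ 2 + ‖d‖ ^ 2 + q ^ 2 * ‖a‖ ^ 2 - 2 * (q - 1) * ⟪d, b⟫_ℝ
        - 2 * (q ^ 2 - q) * ⟪b, a⟫_ℝ + 2 * q * ⟪d, a⟫_ℝ) := by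
    linear_combination (L / 2 * ‖b‖ ^ 2 + L / 2 * ‖d‖ ^ 2 + L * ⟪d, b⟫_ℝ) * hqp2
      + (-L * ‖b‖ ^ 2 - L * ⟪d, b⟫_ℝ + L * ⟪b, a⟫_ℝ + L * ⟪d, a⟫_ℝ) * hqp
  have l2 : q ^ 2 * L / 2 * (p ^ 2 * ‖b‖ ^ 2 + ‖a‖ ^ 2 + 2 * p * ⟪b, a⟫_ℝ)
      = L / 2 * (‖b‖ ^ 2 + q ^ 2 * ‖a‖ ^ 2 + 2 * q * ⟪b, a⟫_ℝ) := by
    linear_combination (L / 2 * ‖b‖ ^ 2) * hqp2 + (L * ⟪b, a⟫_ℝ) * hqp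
  rw [l1, mul_add (1 - q), l2]
  nlinarith

/-- Translates between the two forms of the scheme: the momentum step produces the point that the
potential argument needs, a weighted mean of the new iterate and the new estimate-sequence centre.
-/
theorem extrapolation_eq {q : ℝ} (hq : 0 < q) (x x' : E) :
    (1 + q) • (x' + ((1 - q) / (1 + q)) • (x' - x)) = x' + q • (x + q⁻¹ • (x' - x)) := by
  rw [smul_add, smul_smul, mul_div_cancel₀ _ (by positivity), smul_add, smul_smul,
    mul_inv_cancel₀ hq.ne']
  module

/-- The accelerated scheme with reference point `w`. -/
theorem nesterov_sequence {q L err Fw : ℝ} (hq : 0 < q) (hq1 : q ≤ 1) (herr : 0 ≤ err)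
    {F : E → ℝ} {x xt : ℕ → E} {w : E} (hL : 0 < L) {T : ℕ} (h0 : xt 0 = x 0)
    (hxt : ∀ t, t + 1 < T → xt (t + 1) = x (t + 1) + ((1 - q) / (1 + q)) • (x (t + 1) - x t))
    (hx : ∀ t < T, F (x (t + 1)) + ⟪L • (xt t - x (t + 1)), x t - xt t⟫_ℝ
      + L / 2 * ‖xt t - x (t + 1)‖ ^ 2 ≤ F (x t) + err)
    (hw : ∀ t < T, F (x (t + 1)) + ⟪L • (xt t - x (t + 1)), w - xt t⟫_ℝ
      + L / 2 * ‖xt t - x (t + 1)‖ ^ 2 + q ^ 2 * L / 2 * ‖w - xt t‖ ^ 2 ≤ Fw + err) :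
    F (x T) - Fw ≤ (1 - q) ^ T * (F (x 0) - Fw + q ^ 2 * L / 2 * ‖x 0 - w‖ ^ 2) + err / q := by
  -- Centres of the estimate sequence, never computed by the method.
  let z : ℕ → E := fun t => Nat.casesOn t (x 0) (fun s => x s + q⁻¹ • (x (s + 1) - x s))
  have hz : ∀ t < T, (1 + q) • xt t = x t + q • z t := by
    intro t ht
    cases t with
    | zero => change (1 + q) • xt 0 = x 0 + q • x 0; rw [h0]; module
    | succ s =>
      change _ = x (s + 1) + q • (x s + q⁻¹ • (x (s + 1) - x s))
      rw [hxt s ht, extrapolation_eq hq]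
  have main : ∀ t ≤ T, F (x t) - Fw + q ^ 2 * L / 2 * ‖z t - w‖ ^ 2
      ≤ (1 - q) ^ t * (F (x 0) - Fw + q ^ 2 * L / 2 * ‖x 0 - w‖ ^ 2) + err / q := by
    intro t
    induction t with
    | zero =>
      intro _
      have : 0 ≤ err / q := by positivity
      change F (x 0) - Fw + q ^ 2 * L / 2 * ‖x 0 - w‖ ^ 2 ≤ _
      linarith
    | succ t ih =>
      intro ht
      have h1 := nesterov_step hq hq1 hL (hz t ht) (hx t ht) (hw t ht)
      have h2 := mul_le_mul_of_nonneg_left (ih (Nat.le_of_succ_le ht)) (sub_nonneg.2 hq1)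
      -- `err / q` is the fixed point of v ↦ (1 - q) v + err, hence the accumulated error.
      have h3 : (1 - q) * (err / q) + err = err / q := by field_simp; ring
      change F (x (t + 1)) - Fw + q ^ 2 * L / 2 * ‖x t + q⁻¹ • (x (t + 1) - x t) - w‖ ^ 2 ≤ _
      rw [pow_succ (1 - q) t]
      linarith
  have := main T le_rfl
  have h : 0 ≤ q ^ 2 * L / 2 * ‖z T - w‖ ^ 2 := by positivity
  linarith

/-- A `δ`-minimizer over a convex set is nearly stationary. -/
theorem inner_ge_of_approx_min {Ψ : E → ℝ} {g x u : E} {L δ : ℝ} {X : Set E} (hX : Convex ℝ X)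
    (hL : 0 < L) (hδ : 0 < δ) (hx : x ∈ X) (hu : u ∈ X)
    (hsmooth : ∀ z, Ψ z ≤ Ψ x + ⟪g, z - x⟫_ℝ + L / 2 * ‖z - x‖ ^ 2)
    (hmin : ∀ z ∈ X, Ψ x ≤ Ψ z + δ) :
    -(√(2 * L * δ) * ‖u - x‖) - 2 * δ ≤ ⟪g, u - x⟫_ℝ := by
  have hS : √(2 * L * δ) ^ 2 = 2 * L * δ := Real.sq_sqrt (by positivity)
  have hS0 : 0 < √(2 * L * δ) := Real.sqrt_pos.2 (by positivity)
  set S := √(2 * L * δ)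
  -- Moving from x towards u cannot gain more than δ. The best fraction is s = √(2Lδ)/(L‖u - x‖), or
  -- s = 1 if this exceeds 1.
  have key : ∀ s, 0 ≤ s → s ≤ 1 → -δ ≤ s * ⟪g, u - x⟫_ℝ + L / 2 * s ^ 2 * ‖u - x‖ ^ 2 := by
    intro s hs hs1
    have hz : x + s • (u - x) ∈ X := hX.add_smul_sub_mem hx hu ⟨hs, hs1⟩
    have h1 := hmin _ hz
    have h2 := hsmooth (x + s • (u - x))
    rw [add_sub_cancel_left, inner_smul_right, norm_smul, Real.norm_of_nonneg hs, mul_pow] at h2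
    linarith
  have hr := norm_nonneg (u - x)
  by_cases h : L * ‖u - x‖ ≤ S
  · have := key 1 zero_le_one le_rfl
    nlinarith [mul_nonneg hL.le hr, mul_nonneg hS0.le hr]
  · push Not at h
    have hr' : 0 < ‖u - x‖ := by
      by_contra h0
      have : ‖u - x‖ = 0 := le_antisymm (not_lt.1 h0) hr
      rw [this] at h; linarith
    have h1 := key (S / (L * ‖u - x‖)) (by positivity) ((div_le_one (by positivity)).2 h.le)
    have h2 := mul_le_mul_of_nonneg_right h1 (show 0 ≤ L * ‖u - x‖ / S by positivity)
    have e : (S / (L * ‖u - x‖) * ⟪g, u - x⟫_ℝ + L / 2 * (S / (L * ‖u - x‖)) ^ 2 * ‖u - x‖ ^ 2)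
        * (L * ‖u - x‖ / S) = ⟪g, u - x⟫_ℝ + S * ‖u - x‖ / 2 := by
      field_simp
    have e2 : -δ * (L * ‖u - x‖ / S) = - (S * ‖u - x‖ / 2) := by
      field_simp; linear_combination hS
    rw [e, e2] at h2
    linarith

/-- Negative curvature: if strong convexity fails between two close points, then stepping in
both directions along their difference decreases the sum of the function values. -/
theorem negative_curvature_line {ψ ψ' ψ'' : ℝ → ℝ} {L α r η : ℝ}
    (h1 : ∀ s, HasDerivAt ψ (ψ' s) s) (h2 : ∀ s, HasDerivAt ψ' (ψ'' s) s)
    (hL : ∀ s t, |ψ'' s - ψ'' t| ≤ L * |s - t|) (hL0 : 0 ≤ L) (hr : 0 ≤ r) (hη : 0 ≤ η)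
    (hneg : ψ 0 - ψ (-r) - r * ψ' (-r) < -(α / 2 * r ^ 2)) :
    ψ η + ψ (-η) - 2 * ψ 0 ≤ η ^ 2 * (L * r - α) + L / 3 * η ^ 3 := by
  -- Otherwise ψ'' > -α on all of [-r, 0] by the Lipschitz bound, and integrating twice contradicts
  -- `hneg`.
  have hneg0 : ψ'' 0 ≤ L * r - α := by
    by_contra! hc
    have hd2 : ∀ s, HasDerivAt (fun s => -(ψ' (-r + s)) - α * s + ψ' (-r))
        (-(ψ'' (-r + s)) - α) s := by
      intro s
      have := ((((h2 (-r + s)).comp_const_add (-r) s).neg).sub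
        ((hasDerivAt_id s).const_mul α)).add_const (ψ' (-r))
      simpa using! this
    have hd1 : ∀ s, HasDerivAt (fun s => -(ψ (-r + s)) - α / 2 * s ^ 2 + s * ψ' (-r))
        (-(ψ' (-r + s)) - α * s + ψ' (-r)) s := by
      intro s
      have := ((((h1 (-r + s)).comp_const_add (-r) s).neg).sub
        (((hasDerivAt_id s).pow 2).const_mul (α / 2))).add
        ((hasDerivAt_id s).mul_const (ψ' (-r)))
      convert! this using 1
      simp; ring
    have := apply_le_apply_zero_of_hasDerivAt_nonpos hd1 hr (fun s hs hsr => by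
      have := apply_le_apply_zero_of_hasDerivAt_nonpos hd2 hs.le (fun t ht hts => by
        have h3 := (abs_le.1 (hL (-r + t) 0)).1
        rw [sub_zero, abs_of_nonpos (by linarith)] at h3
        nlinarith)
      simpa using this)
    simp at this
    linarith
  -- The symmetric second difference differs from η²ψ''(0) by at most (L/3)η³; again two
  -- integrations.
  have hd2 : ∀ s, HasDerivAt (fun s => ψ' s - ψ' (-s) - 2 * s * ψ'' 0 - L * s ^ 2)
      (ψ'' s + ψ'' (-s) - 2 * ψ'' 0 - 2 * L * s) s := by
    intro s
    have := (((h2 s).sub ((h2 (-s)).comp s (hasDerivAt_neg s))).sub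
      (((hasDerivAt_id s).const_mul 2).mul_const (ψ'' 0))).sub
      (((hasDerivAt_id s).pow 2).const_mul L)
    convert! this using 1
    simp; ring
  have hd1 : ∀ s, HasDerivAt (fun s => ψ s + ψ (-s) - s ^ 2 * ψ'' 0 - L / 3 * s ^ 3)
      (ψ' s - ψ' (-s) - 2 * s * ψ'' 0 - L * s ^ 2) s := by
    intro s
    have := (((h1 s).add ((h1 (-s)).comp s (hasDerivAt_neg s))).sub
      (((hasDerivAt_id s).pow 2).mul_const (ψ'' 0))).sub
      (((hasDerivAt_id s).pow 3).const_mul (L / 3))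
    convert! this using 1
    simp; ring
  have := apply_le_apply_zero_of_hasDerivAt_nonpos hd1 hη (fun s hs _ => by
    have := apply_le_apply_zero_of_hasDerivAt_nonpos hd2 hs.le (fun t ht _ => by
      have h3 := (abs_le.1 (hL t 0)).2
      have h4 := (abs_le.1 (hL (-t) 0)).2
      simp only [sub_zero, abs_neg, abs_of_pos ht] at h3 h4
      linarith)
    simpa using this)
  simp at this
  nlinarith [mul_le_mul_of_nonneg_left hneg0 (sq_nonneg η)]

/-- The one-dimensional statement on the line through u and v, with u at parameter 0 and v at -‖u -
v‖. The hypothesis itself forces u ≠ v. -/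
theorem negative_curvature [CompleteSpace E] {Φ : E → ℝ} {L α η : ℝ}
    (hΦ : Differentiable ℝ Φ) (hG : Differentiable ℝ (gradient Φ))
    (hH : ∀ x x', ‖fderiv ℝ (gradient Φ) x - fderiv ℝ (gradient Φ) x'‖ ≤ L * ‖x - x'‖)
    (hL0 : 0 ≤ L) (hη : 0 ≤ η) {u v : E}
    (hneg : Φ u - Φ v - ⟪gradient Φ v, u - v⟫_ℝ < -(α / 2 * ‖u - v‖ ^ 2)) :
    Φ (u + (η / ‖u - v‖) • (u - v)) + Φ (u - (η / ‖u - v‖) • (u - v)) - 2 * Φ u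
      ≤ η ^ 2 * (L * ‖u - v‖ - α) + L / 3 * η ^ 3 := by
  have huv : 0 < ‖u - v‖ := by
    rw [norm_pos_iff, sub_ne_zero]
    rintro rfl
    simp at hneg
  set r := ‖u - v‖ with hr
  set e : E := r⁻¹ • (u - v) with he
  have hen : ‖e‖ = 1 := by
    rw [he, norm_smul, norm_inv, Real.norm_of_nonneg huv.le, ← hr, inv_mul_cancel₀ huv.ne']
  have hre : r • e = u - v := by rw [he, smul_smul, mul_inv_cancel₀ huv.ne', one_smul]
  have h2 : ∀ s : ℝ, HasDerivAt (fun s : ℝ => ⟪gradient Φ (u + s • e), e⟫_ℝ)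
      ⟪fderiv ℝ (gradient Φ) (u + s • e) e, e⟫_ℝ s := by
    intro s
    have h1 : HasDerivAt (fun s : ℝ => u + s • e) e s := by
      simpa using ((hasDerivAt_id s).smul_const e).const_add u
    have h3 := (hG (u + s • e)).hasFDerivAt.comp_hasDerivAt s h1
    have := h3.inner ℝ (hasDerivAt_const s e)
    simpa using this
  have := negative_curvature_line (L := L) (α := α) (r := r) (η := η)
    (ψ := fun s => Φ (u + s • e))
    (hasDerivAt_comp_line (fun z => (hΦ z).hasGradientAt) u e) h2 (fun s t => by
      rw [← inner_sub_left, ← sub_apply]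
      calc _ ≤ ‖(fderiv ℝ (gradient Φ) (u + s • e) - fderiv ℝ (gradient Φ) (u + t • e)) e‖ * ‖e‖ :=
            abs_real_inner_le_norm _ _
        _ ≤ ‖fderiv ℝ (gradient Φ) (u + s • e) - fderiv ℝ (gradient Φ) (u + t • e)‖ * ‖e‖ * ‖e‖ := by
            gcongr; exact ContinuousLinearMap.le_opNorm _ _
        _ ≤ _ := by
            rw [hen, mul_one, mul_one]
            refine (hH _ _).trans_eq ?_
            rw [add_sub_add_left_eq_sub, ← sub_smul, norm_smul, hen, mul_one, Real.norm_eq_abs])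
      hL0 huv.le hη (by
        have e1 : u + (-r) • e = v := by rw [neg_smul, hre]; abel
        have e2 : ⟪gradient Φ v, u - v⟫_ℝ = r * ⟪gradient Φ v, e⟫_ℝ := by
          rw [← hre, inner_smul_right]
        rw [e1, zero_smul, add_zero, ← e2]
        exact hneg)
  have e3 : (η / r) • (u - v) = η • e := by rw [he, smul_smul, div_eq_mul_inv]
  rw [e3]
  simpa [sub_eq_add_neg] using this

end Analysis

end Minimax

namespace Minimax

open scoped InnerProductSpace

/-! ### Partial gradients of f, the primal function Φ, Danskin's formula -/

section Problem

variable {n m : ℕ}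

/-- The `x`-part of the gradient. -/
noncomputable def gradX (f : Pair n m → ℝ) (x : Vec n) (y : Vec m) : Vec n :=
  (gradient f (pair x y)).fst

/-- The `y`-part of the gradient. -/
noncomputable def gradY (f : Pair n m → ℝ) (x : Vec n) (y : Vec m) : Vec m :=
  (gradient f (pair x y)).snd

theorem hasGradientAt_fst {f : Pair n m → ℝ} (hf : Differentiable ℝ f) (x : Vec n) (y : Vec m) :
    HasGradientAt (fun x => f (pair x y)) (gradX f x y) x := by
  rw [hasGradientAt_iff_hasFDerivAt]
  have h1 : HasFDerivAt (fun x : Vec n => pair x y)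
      (((WithLp.prodContinuousLinearEquiv 2 ℝ (Vec n) (Vec m)).symm :
        (Vec n × Vec m) →L[ℝ] Pair n m).comp (ContinuousLinearMap.inl ℝ (Vec n) (Vec m))) x := by
    have := ((WithLp.prodContinuousLinearEquiv 2 ℝ (Vec n) (Vec m)).symm :
        (Vec n × Vec m) →L[ℝ] Pair n m).hasFDerivAt.comp x (hasFDerivAt_prodMk_left x y)
    exact this
  have h2 := (hf (pair x y)).hasGradientAt.hasFDerivAt.comp x h1
  convert! h2 using 1
  ext v
  simp only [gradX, ContinuousLinearMap.comp_apply, InnerProductSpace.toDual_apply_apply]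
  rw [WithLp.prod_inner_apply]
  simp

theorem hasGradientAt_snd {f : Pair n m → ℝ} (hf : Differentiable ℝ f) (x : Vec n) (y : Vec m) :
    HasGradientAt (fun y => f (pair x y)) (gradY f x y) y := by
  rw [hasGradientAt_iff_hasFDerivAt]
  have h1 : HasFDerivAt (fun y : Vec m => pair x y)
      (((WithLp.prodContinuousLinearEquiv 2 ℝ (Vec n) (Vec m)).symm :
        (Vec n × Vec m) →L[ℝ] Pair n m).comp (ContinuousLinearMap.inr ℝ (Vec n) (Vec m))) y := by
    have := ((WithLp.prodContinuousLinearEquiv 2 ℝ (Vec n) (Vec m)).symm :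
        (Vec n × Vec m) →L[ℝ] Pair n m).hasFDerivAt.comp y (hasFDerivAt_prodMk_right x y)
    exact this
  have h2 := (hf (pair x y)).hasGradientAt.hasFDerivAt.comp y h1
  convert! h2 using 1
  ext v
  simp only [gradY, ContinuousLinearMap.comp_apply, InnerProductSpace.toDual_apply_apply]
  rw [WithLp.prod_inner_apply]
  simp

theorem norm_fst_le (z : Pair n m) : ‖z.fst‖ ≤ ‖z‖ := by
  refine le_of_sq_le_sq ?_ (norm_nonneg _)
  rw [WithLp.prod_norm_sq_eq_of_L2]
  linarith [sq_nonneg ‖z.snd‖]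

theorem norm_snd_le (z : Pair n m) : ‖z.snd‖ ≤ ‖z‖ := by
  refine le_of_sq_le_sq ?_ (norm_nonneg _)
  rw [WithLp.prod_norm_sq_eq_of_L2]
  linarith [sq_nonneg ‖z.fst‖]

theorem norm_pair_sub_fst (x x' : Vec n) (y : Vec m) : ‖pair x y - pair x' y‖ = ‖x - x'‖ := by
  rw [← sq_eq_sq₀ (norm_nonneg _) (norm_nonneg _), WithLp.prod_norm_sq_eq_of_L2]
  simp [pair]

theorem norm_pair_sub_snd (x : Vec n) (y y' : Vec m) : ‖pair x y - pair x y'‖ = ‖y - y'‖ := by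
  rw [← sq_eq_sq₀ (norm_nonneg _) (norm_nonneg _), WithLp.prod_norm_sq_eq_of_L2]
  simp [pair]

namespace IsNCSC

variable {f : Pair n m → ℝ} {ℓ μ L₂ : ℝ}

theorem gradX_lipschitz_fst (hf : IsNCSC f ℓ μ L₂) (x x' : Vec n) (y : Vec m) :
    ‖gradX f x y - gradX f x' y‖ ≤ ℓ * ‖x - x'‖ := by
  rw [← norm_pair_sub_fst x x' y]
  exact (norm_fst_le (gradient f _ - gradient f _)).trans (hf.gradient_lipschitz _ _)

theorem gradX_lipschitz_snd (hf : IsNCSC f ℓ μ L₂) (x : Vec n) (y y' : Vec m) :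
    ‖gradX f x y - gradX f x y'‖ ≤ ℓ * ‖y - y'‖ := by
  rw [← norm_pair_sub_snd x y y']
  exact (norm_fst_le (gradient f _ - gradient f _)).trans (hf.gradient_lipschitz _ _)

theorem gradY_lipschitz_fst (hf : IsNCSC f ℓ μ L₂) (x x' : Vec n) (y : Vec m) :
    ‖gradY f x y - gradY f x' y‖ ≤ ℓ * ‖x - x'‖ := by
  rw [← norm_pair_sub_fst x x' y]
  exact (norm_snd_le (gradient f _ - gradient f _)).trans (hf.gradient_lipschitz _ _)

theorem gradY_lipschitz_snd (hf : IsNCSC f ℓ μ L₂) (x : Vec n) (y y' : Vec m) :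
    ‖gradY f x y - gradY f x y'‖ ≤ ℓ * ‖y - y'‖ := by
  rw [← norm_pair_sub_snd x y y']
  exact (norm_snd_le (gradient f _ - gradient f _)).trans (hf.gradient_lipschitz _ _)

theorem le_fst (hf : IsNCSC f ℓ μ L₂) (x x' : Vec n) (y : Vec m) :
    f (pair x' y) ≤ f (pair x y) + ⟪gradX f x y, x' - x⟫_ℝ + ℓ / 2 * ‖x' - x‖ ^ 2 :=
  le_add_sq_of_lipschitz_gradient (fun z => hasGradientAt_fst hf.differentiable z y)
    (fun z z' => hf.gradX_lipschitz_fst z z' y) x x'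

theorem ge_fst (hf : IsNCSC f ℓ μ L₂) (x x' : Vec n) (y : Vec m) :
    f (pair x y) + ⟪gradX f x y, x' - x⟫_ℝ - ℓ / 2 * ‖x' - x‖ ^ 2 ≤ f (pair x' y) :=
  sub_sq_le_of_lipschitz_gradient (fun z => hasGradientAt_fst hf.differentiable z y)
    (fun z z' => hf.gradX_lipschitz_fst z z' y) x x'

theorem ge_snd (hf : IsNCSC f ℓ μ L₂) (x : Vec n) (y y' : Vec m) :
    f (pair x y) + ⟪gradY f x y, y' - y⟫_ℝ - ℓ / 2 * ‖y' - y‖ ^ 2 ≤ f (pair x y') :=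
  sub_sq_le_of_lipschitz_gradient (fun z => hasGradientAt_snd hf.differentiable x z)
    (fun z z' => hf.gradY_lipschitz_snd x z z') y y'

theorem le_snd (hf : IsNCSC f ℓ μ L₂) (x : Vec n) (y y' : Vec m) :
    f (pair x y') ≤ f (pair x y) + ⟪gradY f x y, y' - y⟫_ℝ - μ / 2 * ‖y' - y‖ ^ 2 :=
  strongConcaveOn_gradient_le (hf.strongConcave x) (hasGradientAt_snd hf.differentiable x y) y'

theorem gradY_monotone (hf : IsNCSC f ℓ μ L₂) (x : Vec n) (y y' : Vec m) :
    μ * ‖y - y'‖ ^ 2 ≤ ⟪-gradY f x y - -gradY f x y', y - y'⟫_ℝ := by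
  have h1 := hf.le_snd x y y'
  have h2 := hf.le_snd x y' y
  rw [← neg_sub y y', inner_neg_right, norm_neg] at h1
  rw [inner_sub_left, inner_neg_left, inner_neg_left]
  linarith

/-- Compares the quadratic upper and lower bounds of f(0, ·) at a unit vector; this is what the
positive dimension of y is for. -/
theorem mu_le (hf : IsNCSC f ℓ μ L₂) (hm : 0 < m) : μ ≤ ℓ := by
  let v : Vec m := EuclideanSpace.single ⟨0, hm⟩ (1 : ℝ)
  have hv : ‖v‖ = 1 := by simp [v]
  have h1 := hf.le_snd 0 0 v
  have h2 := hf.ge_snd 0 0 v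
  rw [sub_zero, hv] at h1 h2
  linarith

/-- The maximizer solves the variational inequality for -∇_y f on the whole space, where the
projection is the identity. -/
theorem exists_argmax (hf : IsNCSC f ℓ μ L₂) (hμ : 0 < μ) (hμℓ : μ ≤ ℓ) (x : Vec n) :
    ∃ ys : Vec m, gradY f x ys = 0 ∧ ∀ y, f (pair x y) ≤ f (pair x ys) - μ / 2 * ‖y - ys‖ ^ 2 := by
  have hP : IsProjection (Set.univ : Set (Vec m)) id := fun x => by simp
  obtain ⟨ys, -, -, h⟩ := hP.exists_variational (G := fun y => -gradY f x y) hμ hμℓ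
    (hf.gradY_monotone x) (fun y y' => by
      rw [neg_sub_neg, norm_sub_rev]; exact hf.gradY_lipschitz_snd x y y')
  have h0 : gradY f x ys = 0 := by
    have := h (ys + gradY f x ys) trivial
    rw [add_sub_cancel_left, inner_neg_left, real_inner_self_eq_norm_sq] at this
    exact norm_eq_zero.1 (by nlinarith [norm_nonneg (gradY f x ys)])
  refine ⟨ys, h0, fun y => ?_⟩
  have := hf.le_snd x ys y
  rw [h0, inner_zero_left] at this
  linarith

theorem bddAbove (hf : IsNCSC f ℓ μ L₂) (hμ : 0 < μ) (hμℓ : μ ≤ ℓ) (x : Vec n) :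
    BddAbove (Set.range fun y : Vec m => f (pair x y)) := by
  obtain ⟨ys, -, h⟩ := hf.exists_argmax hμ hμℓ x
  refine ⟨f (pair x ys), ?_⟩
  rintro _ ⟨y, rfl⟩
  have := h y
  have : 0 ≤ μ / 2 * ‖y - ys‖ ^ 2 := by positivity
  linarith [h y]

theorem le_primal (hf : IsNCSC f ℓ μ L₂) (hμ : 0 < μ) (hμℓ : μ ≤ ℓ) (x : Vec n) (y : Vec m) :
    f (pair x y) ≤ primal f x :=
  le_ciSup (hf.bddAbove hμ hμℓ x) y

/-- The maximizer of `f(x, ·)` and Danskin's formula. -/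
theorem exists_primal (hf : IsNCSC f ℓ μ L₂) (hμ : 0 < μ) (hμℓ : μ ≤ ℓ) (x : Vec n) :
    ∃ ys : Vec m, primal f x = f (pair x ys) ∧ gradient (primal f) x = gradX f x ys ∧
      gradY f x ys = 0 ∧ ∀ y, f (pair x y) ≤ f (pair x ys) - μ / 2 * ‖y - ys‖ ^ 2 := by
  obtain ⟨ys, h0, h⟩ := hf.exists_argmax hμ hμℓ x
  have hval : primal f x = f (pair x ys) := by
    refine le_antisymm (ciSup_le fun y => ?_) (hf.le_primal hμ hμℓ x ys)
    have : 0 ≤ μ / 2 * ‖y - ys‖ ^ 2 := by positivity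
    linarith [h y]
  refine ⟨ys, hval, ?_, h0, h⟩
  have hg1 := (hf.primal_differentiable x).hasGradientAt.hasFDerivAt
  have hg2 := (hasGradientAt_fst hf.differentiable x ys).hasFDerivAt
  -- f(·, ys) touches Φ from below at x. Since Φ is differentiable by assumption, equality of the
  -- gradients is Fermat's rule.
  have hmin : IsLocalMin (fun x' => primal f x' - f (pair x' ys)) x := by
    refine Filter.Eventually.of_forall fun x' => ?_
    simp only
    rw [hval, sub_self]
    exact sub_nonneg.2 (hf.le_primal hμ hμℓ x' ys)
  have := hmin.hasFDerivAt_eq_zero (hg1.sub hg2)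
  exact (InnerProductSpace.toDual ℝ (Vec n)).injective (sub_eq_zero.1 this)

/-- The minorant f(·, ys) that touches Φ at x gives weak convexity with constant ℓ, not L₁. This is
why γ = ℓ suffices for strongly convex proximal problems. -/
theorem primal_ge (hf : IsNCSC f ℓ μ L₂) (hμ : 0 < μ) (hμℓ : μ ≤ ℓ) (x x' : Vec n) :
    primal f x + ⟪gradient (primal f) x, x' - x⟫_ℝ - ℓ / 2 * ‖x' - x‖ ^ 2 ≤ primal f x' := by
  obtain ⟨ys, h1, h2, -, -⟩ := hf.exists_primal hμ hμℓ x
  rw [h1, h2]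
  exact (hf.ge_fst x x' ys).trans (hf.le_primal hμ hμℓ x' ys)

/-- For a competitor y, the gradient in x is off by ℓ‖y - ys‖, and Young's inequality pays for this
with the strong concavity loss (μ/2)‖y - ys‖². The price is the factor 1 + ℓ/μ. -/
theorem primal_le (hf : IsNCSC f ℓ μ L₂) (hμ : 0 < μ) (hμℓ : μ ≤ ℓ) (x x' : Vec n) :
    primal f x' ≤ primal f x + ⟪gradient (primal f) x, x' - x⟫_ℝ
      + (1 + ℓ / μ) * ℓ / 2 * ‖x' - x‖ ^ 2 := by
  obtain ⟨ys, h1, h2, -, h4⟩ := hf.exists_primal hμ hμℓ x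
  rw [h1, h2]
  refine ciSup_le fun y => ?_
  have a1 := hf.le_fst x x' y
  have a2 := h4 y
  have a3 : ⟪gradX f x y, x' - x⟫_ℝ ≤ ⟪gradX f x ys, x' - x⟫_ℝ + ℓ * ‖y - ys‖ * ‖x' - x‖ := by
    rw [← sub_le_iff_le_add', ← inner_sub_left]
    exact (real_inner_le_norm _ _).trans
      (mul_le_mul_of_nonneg_right (hf.gradX_lipschitz_snd x y ys) (norm_nonneg _))
  have a4 : ℓ * ‖y - ys‖ * ‖x' - x‖ ≤ μ / 2 * ‖y - ys‖ ^ 2 + ℓ / μ * ℓ / 2 * ‖x' - x‖ ^ 2 := by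
    have : 0 ≤ (μ * ‖y - ys‖ - ℓ * ‖x' - x‖) ^ 2 / (2 * μ) := by positivity
    have e : (μ * ‖y - ys‖ - ℓ * ‖x' - x‖) ^ 2 / (2 * μ) = μ / 2 * ‖y - ys‖ ^ 2
        + ℓ / μ * ℓ / 2 * ‖x' - x‖ ^ 2 - ℓ * ‖y - ys‖ * ‖x' - x‖ := by field_simp; ring
    linarith
  nlinarith

theorem iInf_le_primal (hf : IsNCSC f ℓ μ L₂) (x : Vec n) : ⨅ x, primal f x ≤ primal f x :=
  ciInf_le hf.bddBelow x

end IsNCSC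

end Problem

end Minimax

namespace Minimax

open scoped InnerProductSpace

/-! ### Semantics of composed oracle programs -/

section Run

variable {n m : ℕ} {R T : Type} (f : Pair n m → ℝ)

theorem Prog.run_bind (a : Prog n m R) (g : R → Prog n m T) :
    (a.bind g).run f = (((g (a.run f).1).run f).1, (a.run f).2 + ((g (a.run f).1).run f).2) := by
  induction a with
  | ret r => simp [Prog.bind, Prog.run]
  | query z k ih => simp only [Prog.bind, Prog.run, ih]; ext <;> simp; omega

theorem Prog.run_bind_fst (a : Prog n m R) (g : R → Prog n m T) :
    ((a >>= g).run f).1 = ((g (a.run f).1).run f).1 := by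
  rw [show a >>= g = a.bind g from rfl, Prog.run_bind]

theorem Prog.run_bind_snd (a : Prog n m R) (g : R → Prog n m T) :
    ((a >>= g).run f).2 = (a.run f).2 + ((g (a.run f).1).run f).2 := by
  rw [show a >>= g = a.bind g from rfl, Prog.run_bind]

theorem Prog.run_pure (r : R) : ((pure r : Prog n m R).run f) = (r, 0) := rfl

end Run

/-! ### Regularized saddle functions and inexact dual gradient steps -/

section Saddle

variable {n m : ℕ}

/-- Function values and partial gradients of a saddle function that is `ℓ`-strongly convex and
`5ℓ`-smooth in `x`, and `μ`-strongly concave and `ℓ`-smooth in `y`. -/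
structure IsSaddle (h : Vec n → Vec m → ℝ) (hx : Vec n → Vec m → Vec n)
    (hy : Vec n → Vec m → Vec m) (ℓ μ : ℝ) : Prop where
  x_ge : ∀ x x' y, h x y + ⟪hx x y, x' - x⟫_ℝ + ℓ / 2 * ‖x' - x‖ ^ 2 ≤ h x' y
  x_le : ∀ x x' y, h x' y ≤ h x y + ⟪hx x y, x' - x⟫_ℝ + 5 * ℓ / 2 * ‖x' - x‖ ^ 2
  x_lip : ∀ x x' y, ‖hx x y - hx x' y‖ ≤ 5 * ℓ * ‖x - x'‖
  xy_lip : ∀ x y y', ‖hx x y - hx x y'‖ ≤ ℓ * ‖y - y'‖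
  y_le : ∀ x y y', h x y' ≤ h x y + ⟪hy x y, y' - y⟫_ℝ - μ / 2 * ‖y' - y‖ ^ 2
  y_ge : ∀ x y y', h x y + ⟪hy x y, y' - y⟫_ℝ - ℓ / 2 * ‖y' - y‖ ^ 2 ≤ h x y'
  yx_lip : ∀ x x' y, ‖hy x y - hy x' y‖ ≤ ℓ * ‖x - x'‖

/-- The gradient of the proximal terms `α‖x - p‖² + ℓ‖x - c‖²`. -/
def proxShift (α ℓ : ℝ) (p c x : Vec n) : Vec n := (2 * α) • (x - p) + (2 * ℓ) • (x - c)

theorem proxShift_sub (α ℓ : ℝ) (p c x x' : Vec n) :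
    proxShift α ℓ p c x - proxShift α ℓ p c x' = (2 * α + 2 * ℓ) • (x - x') := by
  simp only [proxShift]; module

theorem norm_sub_sq_expand {E : Type*} [NormedAddCommGroup E] [InnerProductSpace ℝ E]
    (x x' p : E) : ‖x' - p‖ ^ 2 = ‖x - p‖ ^ 2 + 2 * ⟪x - p, x' - x⟫_ℝ + ‖x' - x‖ ^ 2 := by
  have : x' - p = (x - p) + (x' - x) := by abel
  rw [this, norm_add_sq_real]

/-- In x, the term ℓ‖x - c‖² adds 2ℓ of convexity against at most ℓ of concavity, and the smoothness
is ℓ + 2α + 2ℓ ≤ 5ℓ. Concavity and smoothness in y are unaffected. -/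
theorem IsNCSC.isSaddle {f : Pair n m → ℝ} {ℓ μ L₂ α : ℝ} (hf : IsNCSC f ℓ μ L₂)
    (hα : 0 ≤ α) (hαℓ : α ≤ ℓ) (p c : Vec n) :
    IsSaddle (fun x y => f (pair x y) + α * ‖x - p‖ ^ 2 + ℓ * ‖x - c‖ ^ 2)
      (fun x y => gradX f x y + proxShift α ℓ p c x) (gradY f) ℓ μ where
  x_ge x x' y := by
    have h1 := hf.ge_fst x x' y
    have h2 := norm_sub_sq_expand x x' p
    have h3 := norm_sub_sq_expand x x' c
    simp only [proxShift, inner_add_left, inner_smul_left, conj_trivial]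
    nlinarith [mul_nonneg hα (sq_nonneg ‖x' - x‖)]
  x_le x x' y := by
    have h1 := hf.le_fst x x' y
    have h2 := norm_sub_sq_expand x x' p
    have h3 := norm_sub_sq_expand x x' c
    simp only [proxShift, inner_add_left, inner_smul_left, conj_trivial]
    nlinarith [mul_nonneg (sub_nonneg.2 hαℓ) (sq_nonneg ‖x' - x‖)]
  x_lip x x' y := by
    rw [add_sub_add_comm, proxShift_sub]
    refine (norm_add_le _ _).trans ?_
    rw [norm_smul, Real.norm_of_nonneg (by linarith)]
    have h1 := hf.gradX_lipschitz_fst x x' y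
    nlinarith [mul_nonneg (sub_nonneg.2 hαℓ) (norm_nonneg (x - x'))]
  xy_lip x y y' := by
    rw [add_sub_add_right_eq_sub]; exact hf.gradX_lipschitz_snd x y y'
  y_le x y y' := by linarith [hf.le_snd x y y']
  y_ge x y y' := by linarith [hf.ge_snd x y y']
  yx_lip x x' y := hf.gradY_lipschitz_fst x x' y

namespace IsSaddle

variable {h : Vec n → Vec m → ℝ} {hx : Vec n → Vec m → Vec n} {hy : Vec n → Vec m → Vec m}
  {ℓ μ : ℝ} {X : Set (Vec n)} {Pr : Vec n → Vec n}

theorem x_mono (H : IsSaddle h hx hy ℓ μ) (x x' : Vec n) (y : Vec m) :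
    ℓ * ‖x - x'‖ ^ 2 ≤ ⟪hx x y - hx x' y, x - x'⟫_ℝ := by
  have h1 := H.x_ge x x' y
  have h2 := H.x_ge x' x y
  rw [← neg_sub x x', inner_neg_right, norm_neg] at h1
  rw [inner_sub_left]
  linarith

/-- The projected gradient step. -/
noncomputable def _root_.Minimax.projStep (Pr : Vec n → Vec n) (ℓ : ℝ) (g : Vec n → Vec n)
    (x : Vec n) : Vec n := Pr (x - (ℓ / (5 * ℓ) ^ 2) • g x)

theorem projStep_contract (H : IsSaddle h hx hy ℓ μ) (hℓ : 0 < ℓ) (hP : IsProjection X Pr)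
    (y : Vec m) (x x' : Vec n) :
    ‖projStep Pr ℓ (hx · y) x - projStep Pr ℓ (hx · y) x'‖ ≤ 49 / 50 * ‖x - x'‖ := by
  have := hP.gradient_step_norm_sq_le (G := (hx · y)) hℓ (show 0 < 5 * ℓ by positivity)
    (fun x x' => H.x_mono x x' y) (fun x x' => H.x_lip x x' y) x x'
  refine le_of_sq_le_sq (this.trans ?_) (by positivity)
  -- The factor 49/50 comes from 1 - 1/25 ≤ (49/50)².
  have e : ℓ ^ 2 / (5 * ℓ) ^ 2 = 1 / 25 := by field_simp; norm_num
  rw [e, mul_pow]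
  have := sq_nonneg ‖x - x'‖
  nlinarith

/-- The minimizers of `h(·, y)` over `X`. -/
theorem exists_argmin (H : IsSaddle h hx hy ℓ μ) (hℓ : 0 < ℓ) (hP : IsProjection X Pr) :
    ∃ xs : Vec m → Vec n, ∀ y, projStep Pr ℓ (hx · y) (xs y) = xs y ∧ xs y ∈ X ∧
      (∀ z ∈ X, h (xs y) y + ℓ / 2 * ‖z - xs y‖ ^ 2 ≤ h z y) ∧
      ∀ z ∈ X, ℓ * ‖z - xs y‖ ≤ ‖hx z y‖ := by
  have : ∀ y, ∃ x, projStep Pr ℓ (hx · y) x = x ∧ x ∈ X ∧ ∀ z ∈ X, 0 ≤ ⟪hx x y, z - x⟫_ℝ :=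
    fun y => hP.exists_variational (G := (hx · y)) hℓ (show ℓ ≤ 5 * ℓ by linarith)
      (fun x x' => H.x_mono x x' y) (fun x x' => H.x_lip x x' y)
  choose xs h1 h2 h3 using this
  refine ⟨xs, fun y => ⟨h1 y, h2 y, fun z hz => ?_, fun z hz => ?_⟩⟩
  · linarith [H.x_ge (xs y) z y, h3 y z hz]
  -- This computable error bound lets the program choose its number of steps from a single gradient.
  · have a1 := H.x_mono z (xs y) y
    have a2 := h3 y z hz
    have a3 := real_inner_le_norm (hx z y) (z - xs y)
    rw [inner_sub_left] at a1
    by_contra! hc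
    have : 0 < ‖z - xs y‖ := by
      by_contra h0
      have h0' : ‖z - xs y‖ = 0 := le_antisymm (not_lt.1 h0) (norm_nonneg _)
      rw [h0', mul_zero] at hc
      exact absurd hc (not_lt.2 (norm_nonneg _))
    nlinarith

/-- One further projected step turns closeness in distance into closeness in value. This is needed
because at a constrained minimizer the gradient need not vanish, so distance alone would control the
value only to first order. -/
theorem projStep_value_le (H : IsSaddle h hx hy ℓ μ) (hℓ : 0 < ℓ) (hP : IsProjection X Pr)
    (y : Vec m) (x : Vec n) {z : Vec n} (hz : z ∈ X) :
    h (projStep Pr ℓ (hx · y) x) y ≤ h z y + 25 / 2 * ℓ * ‖x - z‖ ^ 2 := by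
  have h1 := (hP (x - (ℓ / (5 * ℓ) ^ 2) • hx x y)).2 z hz
  have h2 := H.x_le x (projStep Pr ℓ (hx · y) x) y
  have h3 := H.x_ge x z y
  change ⟪_ - projStep Pr ℓ (hx · y) x, z - projStep Pr ℓ (hx · y) x⟫_ℝ ≤ 0 at h1
  generalize projStep Pr ℓ (hx · y) x = x' at *
  have e1 : x - (ℓ / (5 * ℓ) ^ 2) • hx x y - x' = (x - x') - (ℓ / (5 * ℓ) ^ 2) • hx x y := by abel
  rw [e1, inner_sub_left, inner_smul_left, conj_trivial] at h1
  have e2 : ⟪hx x y, z - x'⟫_ℝ = ⟪hx x y, z - x⟫_ℝ - ⟪hx x y, x' - x⟫_ℝ := by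
    rw [← inner_sub_right]; congr 1; abel
  have e3 := norm_sub_sq_expand x' z x
  have e4 : ⟪x' - x, z - x'⟫_ℝ = -⟪x - x', z - x'⟫_ℝ := by
    rw [← inner_neg_left, neg_sub]
  have e5 : ℓ / (5 * ℓ) ^ 2 = 1 / (25 * ℓ) := by field_simp; norm_num
  rw [e5, e2] at h1
  have h4 : 25 * ℓ * ⟪x - x', z - x'⟫_ℝ ≤ ⟪hx x y, z - x⟫_ℝ - ⟪hx x y, x' - x⟫_ℝ := by
    have := mul_le_mul_of_nonneg_left h1 (show 0 ≤ 25 * ℓ by positivity)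
    rw [mul_sub, ← mul_assoc, mul_one_div_cancel (by positivity)] at this
    linarith
  rw [norm_sub_rev x z]
  nlinarith [sq_nonneg ‖z - x'‖, sq_nonneg ‖x' - x‖, sq_nonneg ‖z - x‖]

/-- An inexact gradient step for the dual function `F(y) = -min_x h(x, y)`. -/
theorem dual_step (H : IsSaddle h hx hy ℓ μ) (hℓ : 0 < ℓ) {xs : Vec m → Vec n}
    (hxs : ∀ y, xs y ∈ X ∧ ∀ z ∈ X, h (xs y) y + ℓ / 2 * ‖z - xs y‖ ^ 2 ≤ h z y)
    {tol : ℝ} {xh : Vec n} {yt : Vec m} (hX : xh ∈ X) (htol : ‖xh - xs yt‖ ≤ tol)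
    (hval : h xh yt ≤ h (xs yt) yt + 25 / 2 * ℓ * tol ^ 2) {y' : Vec m}
    (hy' : y' = yt + (1 / (3 * ℓ)) • hy xh yt) (u : Vec m) :
    -h (xs y') y' + ⟪(3 * ℓ) • (yt - y'), u - yt⟫_ℝ + 3 * ℓ / 2 * ‖yt - y'‖ ^ 2
      + μ / 2 * ‖u - yt‖ ^ 2 ≤ -h (xs u) u + 13 * ℓ * tol ^ 2 := by
  have hg : hy xh yt = (3 * ℓ) • (y' - yt) := by
    rw [hy', add_sub_cancel_left, smul_smul, mul_one_div_cancel (by positivity), one_smul]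
  have a1 := H.y_le xh yt u
  have a2 := (hxs u).2 xh hX
  have a3 := H.y_ge (xs y') yt y'
  have a4 := (hxs yt).2 (xs y') (hxs y').1
  have a5 : ⟪hy xh yt, y' - yt⟫_ℝ - ℓ * ‖xs y' - xh‖ * ‖y' - yt‖
      ≤ ⟪hy (xs y') yt, y' - yt⟫_ℝ := by
    have b1 := neg_le_of_abs_le (abs_real_inner_le_norm (hy (xs y') yt - hy xh yt) (y' - yt))
    rw [inner_sub_left] at b1
    have b2 := mul_le_mul_of_nonneg_right (H.yx_lip (xs y') xh yt) (norm_nonneg (y' - yt))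
    linarith
  have a6 : ‖xs y' - xh‖ ≤ ‖xs y' - xs yt‖ + tol := by
    have := norm_sub_le_norm_sub_add_norm_sub (xs y') (xs yt) xh
    rw [norm_sub_rev (xs yt) xh] at this
    linarith
  rw [hg, inner_smul_left, conj_trivial] at a1
  rw [hg, inner_smul_left, conj_trivial, real_inner_self_eq_norm_sq] at a5
  rw [← neg_sub y' yt, smul_neg, inner_neg_left, norm_neg, inner_smul_left, conj_trivial]
  have a8 : 0 ≤ ℓ / 2 * ‖xh - xs u‖ ^ 2 := by positivity
  have a9 := mul_le_mul_of_nonneg_right (mul_le_mul_of_nonneg_left a6 hℓ.le)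
    (norm_nonneg (y' - yt))
  -- The two squares are Young's inequality for the cross term. The shift of the minimizer is
  -- absorbed by strong convexity in x, the step terms add up to ℓ/2 + ℓ/2 + ℓ/2, which explains the
  -- dual smoothness 3ℓ, and 13 = 25/2 + 1/2.
  nlinarith [mul_nonneg hℓ.le (sq_nonneg (‖xs y' - xs yt‖ - ‖y' - yt‖)),
    mul_nonneg hℓ.le (sq_nonneg (tol - ‖y' - yt‖))]

end IsSaddle

end Saddle

end Minimax

namespace Minimax

open scoped InnerProductSpace

noncomputable section

/-! ### Accelerated dual ascent for the subproblems: accuracy and cost -/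

section Solver

variable {n m : ℕ}

/-- Parameters of the first-order method for `min_{x ∈ X} max_y f(x, y) + α‖x - p‖² + ℓ‖x - c‖²`:
the projection onto `X`, the starting point, and the tolerances `tol` of the inner minimizations
and `τ` of the accelerated method. -/
structure SolverInput (n m : ℕ) where
  Pr : Vec n → Vec n
  α : ℝ
  ℓ : ℝ
  μ : ℝ
  tol : ℝ
  τ : ℝ
  p : Vec n
  c : Vec n
  x₀ : Vec n
  y₀ : Vec m

namespace SolverInput

variable (I : SolverInput n m)

/-- `√(μ / 3ℓ)`. -/
def q : ℝ := √(I.μ / (3 * I.ℓ))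

/-- The number of projected gradient steps that reduce an error by the factor `r`. -/
def innerSteps (r : ℝ) : ℕ := ⌈50 * Real.log (max 1 r)⌉₊

/-- The number of accelerated steps, given the norm of the initial dual gradient. -/
def outerSteps (G : ℝ) : ℕ :=
  ⌈1 / I.q * Real.log (max 1 (2 * (13 * I.ℓ * I.tol ^ 2 + G ^ 2 / I.μ) / I.τ))⌉₊

/-- Projected gradient descent in `x`. -/
def descend (y : Vec m) : ℕ → Vec n → Prog n m (Vec n)
  | 0, x => .ret x
  | k + 1, x => .query (pair x y) fun a =>
      descend y k (projStep I.Pr I.ℓ (fun x => a.2.fst + proxShift I.α I.ℓ I.p I.c x) x)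

/-- The approximate minimizer of the objective in `x` for given `y`. -/
def innerSolve (y : Vec m) : Prog n m (Vec n) :=
  .query (pair I.x₀ y) fun a =>
    I.descend y (innerSteps (‖a.2.fst + proxShift I.α I.ℓ I.p I.c I.x₀‖ / (I.ℓ * I.tol)) + 1) I.x₀

/-- Accelerated ascent in `y`. -/
def ascend : ℕ → Vec m → Vec m → Prog n m (Vec m)
  | 0, y, _ => .ret y
  | k + 1, y, yt => (I.innerSolve yt).bind fun x => .query (pair x yt) fun a =>
      ascend k (yt + (1 / (3 * I.ℓ)) • a.2.snd)
        (yt + (1 / (3 * I.ℓ)) • a.2.snd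
          + ((1 - I.q) / (1 + I.q)) • (yt + (1 / (3 * I.ℓ)) • a.2.snd - y))

/-- The complete method. -/
def solve : Prog n m (Vec n × Vec m) :=
  (I.innerSolve I.y₀).bind fun x => .query (pair x I.y₀) fun a =>
    (I.ascend (I.outerSteps ‖a.2.snd‖) I.y₀ I.y₀).bind fun y =>
      (I.innerSolve y).bind fun x' => .ret (x', y)

/-- The regularized objective. -/
def obj (f : Pair n m → ℝ) (x : Vec n) (y : Vec m) : ℝ :=
  f (pair x y) + I.α * ‖x - I.p‖ ^ 2 + I.ℓ * ‖x - I.c‖ ^ 2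

/-- Its partial gradient in `x`. -/
def objX (f : Pair n m → ℝ) (x : Vec n) (y : Vec m) : Vec n :=
  gradX f x y + proxShift I.α I.ℓ I.p I.c x

variable (f : Pair n m → ℝ)

theorem descend_run (y : Vec m) (k : ℕ) (x : Vec n) :
    (I.descend y k x).run f = ((projStep I.Pr I.ℓ (I.objX f · y))^[k] x, k) := by
  induction k generalizing x with
  | zero => rfl
  | succ k ih =>
    simp only [descend, Prog.run, ih, Function.iterate_succ, Function.comp_apply]
    rfl

theorem innerSolve_run (y : Vec m) :
    (I.innerSolve y).run f
      = ((projStep I.Pr I.ℓ (I.objX f · y))^[innerSteps (‖I.objX f I.x₀ y‖ / (I.ℓ * I.tol)) + 1] I.x₀,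
        innerSteps (‖I.objX f I.x₀ y‖ / (I.ℓ * I.tol)) + 2) := by
  simp only [innerSolve, Prog.run, descend_run]
  rfl

theorem innerSteps_mono {r r' : ℝ} (h : r ≤ r') : innerSteps r ≤ innerSteps r' := by
  refine Nat.ceil_mono (mul_le_mul_of_nonneg_left ?_ (by norm_num))
  exact Real.log_le_log (by positivity) (max_le_max le_rfl h)

/-- Uses 49/50 ≤ exp(-1/50), which is where the 50 in the step count comes from. -/
theorem mul_pow_innerSteps_le (r : ℝ) : r * (49 / 50 : ℝ) ^ innerSteps r ≤ 1 := by
  have h1 : (49 / 50 : ℝ) ^ innerSteps r ≤ Real.exp (-Real.log (max 1 r)) := by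
    have a : (49 / 50 : ℝ) ≤ Real.exp (-(1 / 50)) := by
      have := Real.add_one_le_exp (-(1 / 50) : ℝ); linarith
    calc (49 / 50 : ℝ) ^ innerSteps r ≤ Real.exp (-(1 / 50)) ^ innerSteps r :=
          pow_le_pow_left₀ (by norm_num) a _
      _ = Real.exp (innerSteps r * (-(1 / 50))) := (Real.exp_nat_mul _ _).symm
      _ ≤ _ := by
          apply Real.exp_le_exp.2
          have := Nat.le_ceil (50 * Real.log (max 1 r))
          change _ ≤ (innerSteps r : ℝ) at this
          linarith
  rw [Real.exp_neg, Real.exp_log (by positivity)] at h1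
  calc r * (49 / 50 : ℝ) ^ innerSteps r ≤ max 1 r * (max 1 r)⁻¹ :=
        mul_le_mul (le_max_right _ _) h1 (by positivity) (by positivity)
    _ = 1 := mul_inv_cancel₀ (by positivity)

/-- `xs y` minimizes the objective over `X` for fixed `y`. -/
def IsArgmin (X : Set (Vec n))
    (xs : Vec m → Vec n) : Prop :=
  ∀ y, projStep I.Pr I.ℓ (I.objX f · y) (xs y) = xs y ∧ xs y ∈ X ∧
      (∀ z ∈ X, I.obj f (xs y) y + I.ℓ / 2 * ‖z - xs y‖ ^ 2 ≤ I.obj f z y) ∧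
      ∀ z ∈ X, I.ℓ * ‖z - xs y‖ ≤ ‖I.objX f z y‖

/-- The standing assumptions under which the solver is analysed. -/
structure Admissible (X : Set (Vec n)) (L₂ : ℝ) : Prop where
  ncsc : IsNCSC f I.ℓ I.μ L₂
  proj : IsProjection X I.Pr
  start : I.x₀ ∈ X
  α_nonneg : 0 ≤ I.α
  α_le : I.α ≤ I.ℓ
  μ_pos : 0 < I.μ
  μ_le : I.μ ≤ I.ℓ
  tol_pos : 0 < I.tol
  τ_pos : 0 < I.τ

namespace Admissible

variable {I f} {X : Set (Vec n)} {L₂ : ℝ}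

theorem ℓ_pos (A : I.Admissible f X L₂) : 0 < I.ℓ := A.μ_pos.trans_le A.μ_le

theorem q_pos (A : I.Admissible f X L₂) : 0 < I.q :=
  Real.sqrt_pos.2 (div_pos A.μ_pos (by linarith [A.ℓ_pos]))

theorem q_sq (A : I.Admissible f X L₂) : I.q ^ 2 * (3 * I.ℓ) = I.μ := by
  have := A.ℓ_pos
  rw [q, Real.sq_sqrt (div_nonneg A.μ_pos.le (by linarith)), div_mul_cancel₀ _ (by positivity)]

theorem q_le_one (A : I.Admissible f X L₂) : I.q ≤ 1 := by
  have h := A.q_sq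
  have := A.ℓ_pos
  have := A.μ_le
  by_contra! hc
  have : 1 < I.q ^ 2 := by nlinarith
  nlinarith

theorem saddle (A : I.Admissible f X L₂) :
    IsSaddle (I.obj f) (I.objX f) (gradY f) I.ℓ I.μ :=
  A.ncsc.isSaddle A.α_nonneg A.α_le I.p I.c

/-- The result of `innerSolve`. -/
theorem innerSolve_spec (A : I.Admissible f X L₂) {xs : Vec m → Vec n}
    (hxs : I.IsArgmin f X xs) (y : Vec m) :
    ((I.innerSolve y).run f).1 ∈ X ∧ ‖((I.innerSolve y).run f).1 - xs y‖ ≤ I.tol ∧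
      I.obj f ((I.innerSolve y).run f).1 y ≤ I.obj f (xs y) y + 25 / 2 * I.ℓ * I.tol ^ 2 := by
  have hℓ := A.ℓ_pos
  have htol := A.tol_pos
  obtain ⟨h1, h2, h3, h4⟩ := hxs y
  rw [innerSolve_run]
  simp only [Function.iterate_succ_apply']
  set S := projStep I.Pr I.ℓ (I.objX f · y) with hS
  set J := innerSteps (‖I.objX f I.x₀ y‖ / (I.ℓ * I.tol))
  have hk : ∀ k, ‖S^[k] I.x₀ - xs y‖ ≤ (49 / 50) ^ k * ‖I.x₀ - xs y‖ := by
    intro k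
    induction k with
    | zero => simp
    | succ k ih =>
      rw [Function.iterate_succ_apply', pow_succ']
      have := A.saddle.projStep_contract hℓ A.proj y (S^[k] I.x₀) (xs y)
      rw [← hS, h1] at this
      linarith
  -- J steps already reach the distance tolerance; the additional one serves the value bound.
  have hJ : ‖S^[J] I.x₀ - xs y‖ ≤ I.tol := by
    refine (hk J).trans ?_
    have a1 := h4 _ A.start
    have a2 := mul_pow_innerSteps_le (‖I.objX f I.x₀ y‖ / (I.ℓ * I.tol))
    change _ * _ ^ J ≤ 1 at a2
    rw [div_mul_eq_mul_div, div_le_one (by positivity)] at a2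
    have a3 := mul_le_mul_of_nonneg_right a1 (show (0 : ℝ) ≤ (49 / 50) ^ J by positivity)
    have : I.ℓ * ((49 / 50) ^ J * ‖I.x₀ - xs y‖) ≤ I.ℓ * I.tol := by linarith
    exact le_of_mul_le_mul_left this hℓ
  refine ⟨(A.proj _).1, ?_, ?_⟩
  · have := A.saddle.projStep_contract hℓ A.proj y (S^[J] I.x₀) (xs y)
    rw [← hS, h1] at this
    linarith [norm_nonneg (S^[J] I.x₀ - xs y)]
  · have := A.saddle.projStep_value_le hℓ A.proj y (S^[J] I.x₀) h2
    refine this.trans ?_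
    gcongr

/-- The error of one accelerated step. -/
def _root_.Minimax.SolverInput.err (I : SolverInput n m) : ℝ := 13 * I.ℓ * I.tol ^ 2

theorem err_pos (A : I.Admissible f X L₂) : 0 < I.err := by
  have := A.ℓ_pos
  have := A.tol_pos
  unfold err
  positivity

theorem dual_step (A : I.Admissible f X L₂) {xs : Vec m → Vec n} (hxs : I.IsArgmin f X xs)
    {yt y' : Vec m}
    (hy' : y' = yt + (1 / (3 * I.ℓ)) • gradY f ((I.innerSolve yt).run f).1 yt) (u : Vec m) :
    -I.obj f (xs y') y' + ⟪(3 * I.ℓ) • (yt - y'), u - yt⟫_ℝ + 3 * I.ℓ / 2 * ‖yt - y'‖ ^ 2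
      + I.μ / 2 * ‖u - yt‖ ^ 2 ≤ -I.obj f (xs u) u + I.err := by
  obtain ⟨h1, h2, h3⟩ := A.innerSolve_spec hxs yt
  exact A.saddle.dual_step A.ℓ_pos (fun y => ⟨(hxs y).2.1, (hxs y).2.2.1⟩) h1 h2 h3 hy' u

theorem ascend_succ_run (k : ℕ) (y yt y' : Vec m)
    (hy' : y' = yt + (1 / (3 * I.ℓ)) • gradY f ((I.innerSolve yt).run f).1 yt) :
    (I.ascend (k + 1) y yt).run f
      = (((I.ascend k y' (y' + ((1 - I.q) / (1 + I.q)) • (y' - y))).run f).1,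
        ((I.innerSolve yt).run f).2 + 1
          + ((I.ascend k y' (y' + ((1 - I.q) / (1 + I.q)) • (y' - y))).run f).2) := by
  subst hy'
  simp only [ascend, Prog.run_bind, Prog.run]
  ext
  · rfl
  · simp only [gradY]
    omega

/-- Nesterov's step for the dual function with smoothness 3ℓ, where q²·3ℓ = μ. The reference point w
is arbitrary: the optimality proof and the locality proof use different ones. -/
theorem potential_step (A : I.Admissible f X L₂) {xs : Vec m → Vec n} (hxs : I.IsArgmin f X xs)
    {y yt z y' : Vec m} (hz : (1 + I.q) • yt = y + I.q • z)
    (hy' : y' = yt + (1 / (3 * I.ℓ)) • gradY f ((I.innerSolve yt).run f).1 yt) (w : Vec m) :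
    -I.obj f (xs y') y' - -I.obj f (xs w) w + I.μ / 2 * ‖y + I.q⁻¹ • (y' - y) - w‖ ^ 2
      ≤ (1 - I.q) * (-I.obj f (xs y) y - -I.obj f (xs w) w + I.μ / 2 * ‖z - w‖ ^ 2) + I.err := by
  have hℓ := A.ℓ_pos
  have h := nesterov_step (w := w) (Fx := -I.obj f (xs y) y) (Fx' := -I.obj f (xs y') y')
    (Fw := -I.obj f (xs w) w) (err := I.err) A.q_pos A.q_le_one
    (show 0 < 3 * I.ℓ by positivity) hz (x' := y')
    (by
      have := A.dual_step hxs hy' y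
      have : 0 ≤ I.μ / 2 * ‖y - yt‖ ^ 2 := by have := A.μ_pos; positivity
      linarith)
    (by
      rw [A.q_sq]
      exact A.dual_step hxs hy' w)
  rwa [A.q_sq] at h

/-- Subtracting err/q makes the potential contract exactly. The state (y, yt, z) is general, so that
the induction follows the recursion of the program. -/
theorem ascend_value (A : I.Admissible f X L₂) {xs : Vec m → Vec n} (hxs : I.IsArgmin f X xs)
    (w : Vec m) (k : ℕ) : ∀ y yt z : Vec m, (1 + I.q) • yt = y + I.q • z →
    -I.obj f (xs ((I.ascend k y yt).run f).1) ((I.ascend k y yt).run f).1 - -I.obj f (xs w) w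
      - I.err / I.q
      ≤ (1 - I.q) ^ k * (-I.obj f (xs y) y - -I.obj f (xs w) w + I.μ / 2 * ‖z - w‖ ^ 2
        - I.err / I.q) := by
  have hq := A.q_pos
  induction k with
  | zero =>
    intro y yt z _
    have : 0 ≤ I.μ / 2 * ‖z - w‖ ^ 2 := by have := A.μ_pos; positivity
    simp only [ascend, Prog.run, pow_zero, one_mul]
    linarith
  | succ k ih =>
    intro y yt z hz
    rw [ascend_succ_run k y yt _ rfl]
    set y' := yt + (1 / (3 * I.ℓ)) • gradY f ((I.innerSolve yt).run f).1 yt with hy'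
    have h1 := ih y' _ _ (extrapolation_eq hq y y')
    have h2 := A.potential_step hxs hz hy' w
    refine h1.trans ?_
    rw [pow_succ (1 - I.q) k, mul_assoc]
    refine mul_le_mul_of_nonneg_left ?_ (pow_nonneg (sub_nonneg.2 A.q_le_one) k)
    have h3 : (1 - I.q) * (I.err / I.q) + I.err = I.err / I.q := by field_simp; ring
    linarith

/-- An inner minimization is cheap only near y₀. With reference point y₀ the potential starts at 0
and never exceeds err/q; by `hD` this confines y and z, hence also their weighted mean yt. -/
theorem ascend_cost (A : I.Admissible f X L₂) {xs : Vec m → Vec n} (hxs : I.IsArgmin f X xs)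
    {D : ℝ} (hD : ∀ y z, -I.obj f (xs y) y - -I.obj f (xs I.y₀) I.y₀ + I.μ / 2 * ‖z - I.y₀‖ ^ 2
      ≤ I.err / I.q → ‖y - I.y₀‖ ≤ D ∧ ‖z - I.y₀‖ ≤ D)
    {M : ℕ} (hM : ∀ y, ‖y - I.y₀‖ ≤ D → ((I.innerSolve y).run f).2 ≤ M) (k : ℕ) :
    ∀ y yt z : Vec m, (1 + I.q) • yt = y + I.q • z →
    -I.obj f (xs y) y - -I.obj f (xs I.y₀) I.y₀ + I.μ / 2 * ‖z - I.y₀‖ ^ 2 ≤ I.err / I.q →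
    ((I.ascend k y yt).run f).2 ≤ k * (M + 1) := by
  have hq := A.q_pos
  induction k with
  | zero => intro y yt z _ _; simp [ascend, Prog.run]
  | succ k ih =>
    intro y yt z hz hV
    rw [ascend_succ_run k y yt _ rfl]
    set y' := yt + (1 / (3 * I.ℓ)) • gradY f ((I.innerSolve yt).run f).1 yt with hy'
    have h2 := A.potential_step hxs hz hy' I.y₀
    have h3 : (1 - I.q) * (I.err / I.q) + I.err = I.err / I.q := by field_simp; ring
    have h4 := mul_le_mul_of_nonneg_left hV (sub_nonneg.2 A.q_le_one)
    have h1 := ih y' _ _ (extrapolation_eq hq y y') (by linarith)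
    have h5 : ‖yt - I.y₀‖ ≤ D := by
      obtain ⟨b1, b2⟩ := hD y z hV
      have e : (1 + I.q) • (yt - I.y₀) = (y - I.y₀) + I.q • (z - I.y₀) := by
        rw [smul_sub, hz]; module
      have h6 := congrArg norm e
      rw [norm_smul, Real.norm_of_nonneg (by linarith)] at h6
      have h7 := norm_add_le (y - I.y₀) (I.q • (z - I.y₀))
      rw [norm_smul, Real.norm_of_nonneg hq.le] at h7
      have h8 := mul_le_mul_of_nonneg_left b2 hq.le
      have : (1 + I.q) * ‖yt - I.y₀‖ ≤ (1 + I.q) * D := by linarith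
      exact le_of_mul_le_mul_left this (by linarith)
    have h6 := hM yt h5
    simp only
    linarith

/-- The dual function grows quadratically away from `y₀`. -/
theorem dual_growth (A : I.Admissible f X L₂) {xs : Vec m → Vec n} (hxs : I.IsArgmin f X xs)
    {G : ℝ} (hG : ‖gradY f ((I.innerSolve I.y₀).run f).1 I.y₀‖ ≤ G) (w : Vec m) :
    -I.obj f (xs I.y₀) I.y₀ - -I.obj f (xs w) w + I.μ / 2 * ‖w - I.y₀‖ ^ 2
      ≤ I.err + G * ‖w - I.y₀‖ := by
  obtain ⟨h1, h2, h3⟩ := A.innerSolve_spec hxs I.y₀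
  have a1 := (hxs w).2.2.1 _ h1
  have a2 := A.saddle.y_le ((I.innerSolve I.y₀).run f).1 I.y₀ w
  have hℓ := A.ℓ_pos
  have a3 := real_inner_le_norm (gradY f ((I.innerSolve I.y₀).run f).1 I.y₀) (w - I.y₀)
  have a4 := mul_le_mul_of_nonneg_right hG (norm_nonneg (w - I.y₀))
  have a5 : 0 ≤ I.ℓ / 2 * ‖((I.innerSolve I.y₀).run f).1 - xs w‖ ^ 2 := by positivity
  have a6 : 25 / 2 * I.ℓ * I.tol ^ 2 ≤ I.err := by
    unfold err; nlinarith [mul_nonneg hℓ.le (sq_nonneg I.tol)]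
  linarith

/-- The quadratic growth of the dual function beats its linear term G‖y - y₀‖, so a small potential
confines both y and z. -/
theorem dual_radius (A : I.Admissible f X L₂) {xs : Vec m → Vec n} (hxs : I.IsArgmin f X xs)
    {G D : ℝ} (hG : ‖gradY f ((I.innerSolve I.y₀).run f).1 I.y₀‖ ≤ G) (hD : 0 ≤ D)
    (hGD : 2 * I.err / I.q + G ^ 2 / I.μ ≤ I.μ / 4 * D ^ 2) (y z : Vec m)
    (hV : -I.obj f (xs y) y - -I.obj f (xs I.y₀) I.y₀ + I.μ / 2 * ‖z - I.y₀‖ ^ 2 ≤ I.err / I.q) :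
    ‖y - I.y₀‖ ≤ D ∧ ‖z - I.y₀‖ ≤ D := by
  have hμ := A.μ_pos
  have h1 := A.dual_growth hxs hG y
  have h2 : I.err ≤ I.err / I.q := by
    rw [le_div_iff₀ A.q_pos]
    have := A.q_le_one
    have := A.err_pos
    nlinarith
  have h3 : G * ‖y - I.y₀‖ ≤ G ^ 2 / I.μ + I.μ / 4 * ‖y - I.y₀‖ ^ 2 := by
    have : 0 ≤ (2 * G - I.μ * ‖y - I.y₀‖) ^ 2 / (4 * I.μ) := by positivity
    have e : (2 * G - I.μ * ‖y - I.y₀‖) ^ 2 / (4 * I.μ)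
        = G ^ 2 / I.μ + I.μ / 4 * ‖y - I.y₀‖ ^ 2 - G * ‖y - I.y₀‖ := by field_simp; ring
    linarith
  have e : 2 * I.err / I.q = I.err / I.q + I.err / I.q := by ring
  rw [e] at hGD
  constructor
  · have h4 : 0 ≤ I.μ / 2 * ‖z - I.y₀‖ ^ 2 := by positivity
    have : I.μ / 4 * ‖y - I.y₀‖ ^ 2 ≤ I.μ / 4 * D ^ 2 := by linarith
    exact le_of_sq_le_sq (le_of_mul_le_mul_left this (by positivity)) hD
  · have h4 : 0 ≤ I.μ / 4 * ‖z - I.y₀‖ ^ 2 := by positivity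
    have h5 : 0 ≤ I.μ / 4 * ‖y - I.y₀‖ ^ 2 := by positivity
    have : I.μ / 4 * ‖z - I.y₀‖ ^ 2 ≤ I.μ / 4 * D ^ 2 := by linarith
    exact le_of_sq_le_sq (le_of_mul_le_mul_left this (by positivity)) hD

theorem pow_outerSteps_le (A : I.Admissible f X L₂) (G : ℝ) :
    (1 - I.q) ^ I.outerSteps G * (2 * (I.err + G ^ 2 / I.μ)) ≤ I.τ := by
  set r := 2 * (I.err + G ^ 2 / I.μ) / I.τ with hr
  have hq := A.q_pos
  have hτ := A.τ_pos
  have h1 : (1 - I.q) ^ I.outerSteps G ≤ Real.exp (-Real.log (max 1 r)) := by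
    have a : 1 - I.q ≤ Real.exp (-I.q) := by have := Real.add_one_le_exp (-I.q); linarith
    calc (1 - I.q) ^ I.outerSteps G ≤ Real.exp (-I.q) ^ I.outerSteps G :=
          pow_le_pow_left₀ (sub_nonneg.2 A.q_le_one) a _
      _ = Real.exp (I.outerSteps G * (-I.q)) := (Real.exp_nat_mul _ _).symm
      _ ≤ _ := by
          apply Real.exp_le_exp.2
          have := Nat.le_ceil (1 / I.q * Real.log (max 1 r))
          change _ ≤ (I.outerSteps G : ℝ) at this
          rw [div_mul_eq_mul_div, one_mul, div_le_iff₀ hq] at this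
          linarith
  rw [Real.exp_neg, Real.exp_log (by positivity)] at h1
  have e : 2 * (I.err + G ^ 2 / I.μ) = r * I.τ := by rw [hr]; field_simp
  rw [e]
  calc (1 - I.q) ^ I.outerSteps G * (r * I.τ) ≤ (max 1 r)⁻¹ * (max 1 r * I.τ) := by
        gcongr
        · have := A.err_pos
          have := A.μ_pos
          positivity
        · exact le_max_right _ _
    _ = I.τ := by rw [← mul_assoc, inv_mul_cancel₀ (by positivity), one_mul]

theorem solve_run : (I.solve).run f =
    ((((I.innerSolve ((I.ascend (I.outerSteps ‖gradY f ((I.innerSolve I.y₀).run f).1 I.y₀‖)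
        I.y₀ I.y₀).run f).1).run f).1,
      ((I.ascend (I.outerSteps ‖gradY f ((I.innerSolve I.y₀).run f).1 I.y₀‖) I.y₀ I.y₀).run f).1),
      ((I.innerSolve I.y₀).run f).2 + 1
        + ((I.ascend (I.outerSteps ‖gradY f ((I.innerSolve I.y₀).run f).1 I.y₀‖)
          I.y₀ I.y₀).run f).2
        + ((I.innerSolve ((I.ascend (I.outerSteps ‖gradY f ((I.innerSolve I.y₀).run f).1 I.y₀‖)
          I.y₀ I.y₀).run f).1).run f).2) := by
  simp only [solve, Prog.run_bind, Prog.run]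
  ext
  · rfl
  · rfl
  · simp only [gradY]
    omega

/-- The result of the solver has a small duality gap. -/
theorem solve_gap (A : I.Admissible f X L₂) :
    ((I.solve).run f).1.1 ∈ X ∧ ∀ x ∈ X, ∀ y, I.obj f ((I.solve).run f).1.1 y
      ≤ I.obj f x ((I.solve).run f).1.2
        + (3 * I.ℓ / I.μ * (I.τ + I.err / I.q + I.err) + I.err) := by
  have hℓ := A.ℓ_pos
  have hμ := A.μ_pos
  have hq := A.q_pos
  obtain ⟨xs, hxs⟩ := A.saddle.exists_argmin A.ℓ_pos A.proj
  rw [solve_run]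
  simp only
  set G := ‖gradY f ((I.innerSolve I.y₀).run f).1 I.y₀‖ with hG
  set yh := ((I.ascend (I.outerSteps G) I.y₀ I.y₀).run f).1 with hyh
  obtain ⟨h1, h2, h3⟩ := A.innerSolve_spec hxs yh
  have hval : ∀ w, -I.obj f (xs yh) yh - -I.obj f (xs w) w ≤ I.τ + I.err / I.q := by
    have hz : (1 + I.q) • I.y₀ = I.y₀ + I.q • I.y₀ := by module
    have herr : 0 < I.err / I.q := div_pos A.err_pos hq
    have hpow := pow_nonneg (sub_nonneg.2 A.q_le_one) (I.outerSteps G)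
    have hτ := A.τ_pos
    intro w
    -- If y₀ is already as good as w, reference point y₀ is enough. Otherwise the initial dual gap
    -- is positive, and `dual_growth` bounds the initial potential relative to w.
    by_cases hw : -I.obj f (xs I.y₀) I.y₀ ≤ -I.obj f (xs w) w
    · have := A.ascend_value hxs I.y₀ (I.outerSteps G) I.y₀ I.y₀ I.y₀ hz
      rw [← hyh, sub_self, sub_self, norm_zero] at this
      nlinarith
    · have a1 := A.ascend_value hxs w (I.outerSteps G) I.y₀ I.y₀ I.y₀ hz
      rw [← hyh, norm_sub_rev I.y₀ w] at a1
      have a2 := A.dual_growth hxs hG.ge w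
      have a3 : G * ‖w - I.y₀‖ ≤ G ^ 2 / I.μ + I.μ / 4 * ‖w - I.y₀‖ ^ 2 := by
        have : 0 ≤ (2 * G - I.μ * ‖w - I.y₀‖) ^ 2 / (4 * I.μ) := by positivity
        have e : (2 * G - I.μ * ‖w - I.y₀‖) ^ 2 / (4 * I.μ)
            = G ^ 2 / I.μ + I.μ / 4 * ‖w - I.y₀‖ ^ 2 - G * ‖w - I.y₀‖ := by field_simp; ring
        linarith
      have a4 : -I.obj f (xs I.y₀) I.y₀ - -I.obj f (xs w) w + I.μ / 2 * ‖w - I.y₀‖ ^ 2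
          - I.err / I.q ≤ 2 * (I.err + G ^ 2 / I.μ) := by linarith
      have a5 := mul_le_mul_of_nonneg_left a4 hpow
      have a6 := A.pow_outerSteps_le G
      linarith
  set xh := ((I.innerSolve yh).run f).1 with hxh
  refine ⟨h1, fun x hx y => ?_⟩
  -- A fictitious further ascent step from the output: it cannot gain much because yh is nearly
  -- optimal, and this bounds the gradient in y at (xh, yh). Strong concavity in y then bounds the
  -- maximum over y of the objective at xh.
  have b1 := A.dual_step hxs (yt := yh) rfl yh
  rw [← hxh] at b1
  have b2 := hval (yh + (1 / (3 * I.ℓ)) • gradY f xh yh)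
  rw [sub_self, inner_zero_right, norm_zero, sub_add_cancel_left, norm_neg, norm_smul,
    Real.norm_of_nonneg (by positivity)] at b1
  have b3 : ‖gradY f xh yh‖ ^ 2 ≤ 6 * I.ℓ * (I.τ + I.err / I.q + I.err) := by
    have e : 3 * I.ℓ / 2 * (1 / (3 * I.ℓ) * ‖gradY f xh yh‖) ^ 2
        = ‖gradY f xh yh‖ ^ 2 / (6 * I.ℓ) := by field_simp; ring
    rw [e] at b1
    have : ‖gradY f xh yh‖ ^ 2 / (6 * I.ℓ) ≤ I.τ + I.err / I.q + I.err := by linarith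
    rw [div_le_iff₀ (by positivity)] at this
    linarith
  have b4 := A.saddle.y_le xh yh y
  have b5 := real_inner_le_norm (gradY f xh yh) (y - yh)
  have b6 : ‖gradY f xh yh‖ * ‖y - yh‖ - I.μ / 2 * ‖y - yh‖ ^ 2
      ≤ 3 * I.ℓ / I.μ * (I.τ + I.err / I.q + I.err) := by
    have c1 : 0 ≤ (‖gradY f xh yh‖ - I.μ * ‖y - yh‖) ^ 2 / (2 * I.μ) := by positivity
    have e : (‖gradY f xh yh‖ - I.μ * ‖y - yh‖) ^ 2 / (2 * I.μ) = ‖gradY f xh yh‖ ^ 2 / (2 * I.μ)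
        + I.μ / 2 * ‖y - yh‖ ^ 2 - ‖gradY f xh yh‖ * ‖y - yh‖ := by field_simp; ring
    have c2 : ‖gradY f xh yh‖ ^ 2 / (2 * I.μ)
        ≤ 6 * I.ℓ * (I.τ + I.err / I.q + I.err) / (2 * I.μ) := by gcongr
    have c3 : 6 * I.ℓ * (I.τ + I.err / I.q + I.err) / (2 * I.μ)
        = 3 * I.ℓ / I.μ * (I.τ + I.err / I.q + I.err) := by field_simp; ring
    linarith
  have b7 := (hxs yh).2.2.1 x hx
  have b8 : 0 ≤ I.ℓ / 2 * ‖x - xs yh‖ ^ 2 := by positivity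
  have b9 : 25 / 2 * I.ℓ * I.tol ^ 2 ≤ I.err := by
    unfold err; nlinarith [mul_nonneg hℓ.le (sq_nonneg I.tol)]
  linarith

/-- The cost of the solver. -/
theorem solve_cost (A : I.Admissible f X L₂) {Γ D : ℝ} (hD : 0 ≤ D)
    (hx : ‖I.objX f I.x₀ I.y₀‖ ≤ Γ) (hy : ‖gradY f I.x₀ I.y₀‖ ≤ Γ)
    (hGD : 2 * I.err / I.q + (2 * Γ + I.ℓ * I.tol) ^ 2 / I.μ ≤ I.μ / 4 * D ^ 2) :
    ((I.solve).run f).2 ≤ (innerSteps ((Γ + I.ℓ * D) / (I.ℓ * I.tol)) + 3)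
      * (I.outerSteps (2 * Γ + I.ℓ * I.tol) + 2) := by
  have hℓ := A.ℓ_pos
  have hμ := A.μ_pos
  have hq := A.q_pos
  have htol := A.tol_pos
  have hτ := A.τ_pos
  have hΓ : 0 ≤ Γ := (norm_nonneg _).trans hx
  obtain ⟨xs, hxs⟩ := A.saddle.exists_argmin A.ℓ_pos A.proj
  have hG : ‖gradY f ((I.innerSolve I.y₀).run f).1 I.y₀‖ ≤ 2 * Γ + I.ℓ * I.tol := by
    have a1 := A.saddle.yx_lip ((I.innerSolve I.y₀).run f).1 I.x₀ I.y₀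
    have a2 := (A.innerSolve_spec hxs I.y₀).2.1
    have a3 := (hxs I.y₀).2.2.2 _ A.start
    have a4 := norm_sub_le_norm_sub_add_norm_sub ((I.innerSolve I.y₀).run f).1 (xs I.y₀) I.x₀
    rw [norm_sub_rev (xs I.y₀) I.x₀] at a4
    have a5 := norm_le_norm_add_norm_sub' (gradY f ((I.innerSolve I.y₀).run f).1 I.y₀)
      (gradY f I.x₀ I.y₀)
    have a6 := mul_le_mul_of_nonneg_left (a4.trans (add_le_add a2 le_rfl)) hℓ.le
    linarith
  have hR := A.dual_radius hxs hG hD hGD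
  set M := innerSteps ((Γ + I.ℓ * D) / (I.ℓ * I.tol)) + 2 with hM
  have hcost : ∀ y, ‖y - I.y₀‖ ≤ D → ((I.innerSolve y).run f).2 ≤ M := by
    intro y hy
    rw [innerSolve_run, hM]
    refine Nat.add_le_add_right (innerSteps_mono ?_) 2
    have a1 := A.saddle.xy_lip I.x₀ y I.y₀
    have a2 := norm_le_norm_add_norm_sub' (I.objX f I.x₀ y) (I.objX f I.x₀ I.y₀)
    have a3 := mul_le_mul_of_nonneg_left hy hℓ.le
    gcongr
    linarith
  have hz : (1 + I.q) • I.y₀ = I.y₀ + I.q • I.y₀ := by module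
  have herr : 0 < I.err / I.q := div_pos A.err_pos hq
  rw [solve_run]
  simp only
  set G := ‖gradY f ((I.innerSolve I.y₀).run f).1 I.y₀‖
  have hN : I.outerSteps G ≤ I.outerSteps (2 * Γ + I.ℓ * I.tol) := by
    unfold outerSteps
    gcongr
  have c1 := A.ascend_cost hxs hR hcost (I.outerSteps G) I.y₀ I.y₀ I.y₀ hz
    (by simpa using herr.le)
  have c2 := hcost I.y₀ (by simpa using hD)
  have c3 := hcost ((I.ascend (I.outerSteps G) I.y₀ I.y₀).run f).1 (hR _ I.y₀ (by
    have := A.ascend_value hxs I.y₀ (I.outerSteps G) I.y₀ I.y₀ I.y₀ hz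
    have hpow := pow_nonneg (sub_nonneg.2 A.q_le_one) (I.outerSteps G)
    simp only [sub_self, norm_zero] at this ⊢
    nlinarith)).1
  have c4 : I.outerSteps G * (M + 1) ≤ I.outerSteps (2 * Γ + I.ℓ * I.tol) * (M + 1) :=
    Nat.mul_le_mul_right _ hN
  calc _ ≤ M + 1 + I.outerSteps (2 * Γ + I.ℓ * I.tol) * (M + 1) + M := by omega
    _ ≤ (M + 1) * (I.outerSteps (2 * Γ + I.ℓ * I.tol) + 2) := by ring_nf; omega

end Admissible

end SolverInput

end Solver

end

end Minimax

namespace Minimax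

open scoped InnerProductSpace

noncomputable section

/-! ### What the routines of IAPUN return, and how many oracle calls they make -/

section Semantics

variable {n m : ℕ} (P : Params) (S : Subroutines n m) (f : Pair n m → ℝ)

namespace Subroutines

/-- The estimate of `Φ(x)`. -/
def val (x : Vec n) : ℝ := ((S.estimate x).run f).1.1

/-- The estimate of `∇Φ(x)`. -/
def grd (x : Vec n) : Vec n := ((S.estimate x).run f).1.2

/-- The approximate proximal point. -/
def prx (p c : Vec n) : Vec n := ((S.prox p c).run f).1

/-- The approximate proximal point in the ball. -/
def prxBall (p c : Vec n) : Vec n := ((S.proxBall p c).run f).1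

end Subroutines

/-- The progress test of `certify`. -/
def Exceeds (p x : Vec n) : Prop :=
  S.val f x + P.α * ‖x - p‖ ^ 2 > S.val f p + P.χ + 2 * P.δy

/-- The quantity `E` in `certify`. -/
def energy (p w : Vec n) : ℝ :=
  S.val f p - (S.val f w + P.α * ‖w - p‖ ^ 2) + P.α / 4 * ‖w - p‖ ^ 2

theorem Prog.run_ite {R : Type} (c : Prop) [Decidable c] (a b : Prog n m R) :
    (if c then a else b).run f = if c then a.run f else b.run f := by
  split_ifs <;> rfl

theorem estimateAll_fst (l : List (Vec n)) :
    ((estimateAll S l).run f).1 = l.map fun x => (x, S.val f x) := by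
  induction l with
  | nil => rfl
  | cons x l ih =>
    simp only [estimateAll, Prog.run_bind_fst, ih, Prog.run_pure, List.map_cons]
    rfl

theorem certify_eq_none {p : Vec n} {earlier : List (Vec n)} {xt xtil : Vec n}
    (h : ((certify P S p earlier xt xtil).run f).1 = none) :
    ¬ Exceeds P S f p xt ∧
      P.γ * ‖S.prx f p xt - xt‖ ^ 2 ≤ (1 - 1 / (6 * √P.κx)) ^ (earlier.length + 1)
        * energy P S f p (S.prx f p xt) + P.χ + P.δx + 2 * P.δy ∧
      P.ε / 40 < P.γ * ‖S.prx f p xt - xt‖ := by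
  simp only [certify, Prog.run_bind_fst, Prog.run_ite, Prog.run_pure,
    apply_ite Prod.fst] at h
  split_ifs at h with h1 h2 h3 h4 h5 h6
  exact ⟨h1, not_lt.1 h5, not_le.1 h6⟩

theorem certify_eq_some {p : Vec n} {earlier : List (Vec n)} {xt xtil : Vec n}
    {c : Certificate n} (h : ((certify P S p earlier xt xtil).run f).1 = some c) :
    (c = ⟨Flag.one, none, xt⟩ ∧ ∃ x ∈ earlier, S.val f x ≤ S.val f p - P.decrease) ∨
    (∃ x, c = ⟨Flag.two, some p, x⟩ ∧ Exceeds P S f p x ∧ ‖p - x‖ ≤ P.radius ∧ x = xt) ∨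
    (∃ x, c = ⟨Flag.two, some p, x⟩ ∧ Exceeds P S f p x ∧ x = S.prxBall f p xtil) ∨
    (∃ x, c = ⟨Flag.three, some x, x⟩ ∧ ¬ Exceeds P S f p x ∧ P.radius < ‖p - xt‖ ∧
      x = S.prxBall f p xtil) ∨
    (∃ w, c = ⟨Flag.four, some w, xt⟩ ∧ ¬ Exceeds P S f p xt ∧ w = S.prx f p xt ∧
      (1 - 1 / (6 * √P.κx)) ^ (earlier.length + 1) * energy P S f p w + P.χ + P.δx + 2 * P.δy
        < P.γ * ‖w - xt‖ ^ 2) ∨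
    (∃ w, c = ⟨Flag.five, some w, xt⟩ ∧ ¬ Exceeds P S f p xt ∧ w = S.prx f p xt ∧
      P.γ * ‖w - xt‖ ≤ P.ε / 40) := by
  simp only [certify, Prog.run_bind_fst, Prog.run_ite, Prog.run_pure,
    apply_ite Prod.fst, estimateAll_fst] at h
  split_ifs at h with h1 h2 h3 h4 h5 h6
  · left
    simp only [List.mem_map, exists_exists_and_eq_and] at h2
    exact ⟨(Option.some.inj h).symm, h2⟩
  · exact Or.inr (Or.inl ⟨xt, (Option.some.inj h).symm, h1, h3, rfl⟩)
  · exact Or.inr (Or.inr (Or.inl ⟨_, (Option.some.inj h).symm, h4, rfl⟩))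
  · exact Or.inr (Or.inr (Or.inr (Or.inl ⟨_, (Option.some.inj h).symm, h4, not_le.1 h3, rfl⟩)))
  · exact Or.inr (Or.inr (Or.inr (Or.inr (Or.inl ⟨_, (Option.some.inj h).symm, h1, rfl, h5⟩))))
  · exact Or.inr (Or.inr (Or.inr (Or.inr (Or.inr ⟨_, (Option.some.inj h).symm, h1, rfl, h6⟩))))

/-- The pairs `(x_t, x̃_t)` of an epoch. -/
def iter (p : Vec n) : ℕ → Vec n × Vec n
  | 0 => (p, p)
  | t + 1 => (S.prx f p (iter p t).2,
      S.prx f p (iter p t).2 + P.ω • (S.prx f p (iter p t).2 - (iter p t).1))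

/-- The list `[x_1, …, x_t]`. -/
def iterates (p : Vec n) (t : ℕ) : List (Vec n) :=
  (List.range t).map fun i => (iter P S f p (i + 1)).1

theorem iterates_succ (p : Vec n) (t : ℕ) :
    iterates P S f p (t + 1) = iterates P S f p t ++ [(iter P S f p (t + 1)).1] := by
  simp [iterates, List.range_succ]

@[simp]
theorem length_iterates (p : Vec n) (t : ℕ) : (iterates P S f p t).length = t := by
  simp [iterates]

/-- The program `certify` after the iterate `x_{t+1}` has been computed. -/
def certifyAt (p : Vec n) (t : ℕ) : Prog n m (Option (Certificate n)) :=
  certify P S p (iterates P S f p t) (iter P S f p (t + 1)).1 (iter P S f p t).2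

/-- Until the first certificate, the state of the loop is the fixed sequence `iter`; the induction
is on the remaining budget, from a general time t. -/
theorem innerLoop_fst {p : Vec n} {T : ℕ} {c : Certificate n}
    (hc : ((certifyAt P S f p T).run f).1 = some c) (B : ℕ) : ∀ t, t ≤ T → T < t + B →
    (∀ s, t ≤ s → s < T → ((certifyAt P S f p s).run f).1 = none) →
    ((innerLoop P S p B (iterates P S f p t) (iter P S f p t).1 (iter P S f p t).2).run f).1
      = some (c, iterates P S f p T ++ [c.last]) := by
  induction B with
  | zero => intro t h1 h2; omega
  | succ B ih =>
    intro t h1 h2 h3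
    simp only [innerLoop, Prog.run_bind_fst]
    change ((match ((certifyAt P S f p t).run f).1 with
      | some c => (pure (some (c, iterates P S f p t ++ [c.last])) : Prog n m _)
      | none => innerLoop P S p B (iterates P S f p t ++ [(iter P S f p (t + 1)).1])
          (iter P S f p (t + 1)).1 (iter P S f p (t + 1)).2).run f).1 = _
    rcases h1.eq_or_lt with rfl | hlt
    · rw [hc]; rfl
    · rw [h3 t le_rfl hlt, ← iterates_succ]
      exact ih (t + 1) hlt (by omega) fun s hs => h3 s (by omega)

/-- Every continuing round costs at most 5M. Only the last check may re-estimate all earlier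
iterates, so the total is linear in T. -/
theorem innerLoop_snd {p : Vec n} {T : ℕ} {c : Certificate n} {M : ℕ}
    (hc : ((certifyAt P S f p T).run f).1 = some c)
    (hprox : ∀ t ≤ T, ((S.prox p (iter P S f p t).2).run f).2 ≤ M)
    (hcost : ((certifyAt P S f p T).run f).2 ≤ (T + 4) * M)
    (hcost' : ∀ t < T, ((certifyAt P S f p t).run f).2 ≤ 4 * M) (B : ℕ) :
    ∀ t, t ≤ T → T < t + B →
    (∀ s, t ≤ s → s < T → ((certifyAt P S f p s).run f).1 = none) →
    ((innerLoop P S p B (iterates P S f p t) (iter P S f p t).1 (iter P S f p t).2).run f).2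
      ≤ (T - t) * (5 * M) + (T + 5) * M := by
  induction B with
  | zero => intro t h1 h2; omega
  | succ B ih =>
    intro t h1 h2 h3
    simp only [innerLoop, Prog.run_bind_snd]
    change _ + (((certifyAt P S f p t).run f).2 + ((match ((certifyAt P S f p t).run f).1 with
      | some c => (pure (some (c, iterates P S f p t ++ [c.last])) : Prog n m _)
      | none => innerLoop P S p B (iterates P S f p t ++ [(iter P S f p (t + 1)).1])
          (iter P S f p (t + 1)).1 (iter P S f p (t + 1)).2).run f).2) ≤ _
    have hp := hprox t h1
    rcases h1.eq_or_lt with rfl | hlt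
    · rw [hc]
      simp only [Prog.run_pure]
      rw [Nat.sub_self]
      linarith
    · rw [h3 t le_rfl hlt, ← iterates_succ]
      have h4 := ih (t + 1) hlt (by omega) fun s hs => h3 s (by omega)
      have h5 := hcost' t hlt
      have h6 : T - t = (T - (t + 1)) + 1 := by omega
      rw [h6]
      simp only
      linarith

theorem argminVal_mem (l : List (Vec n × ℝ)) (a : Vec n × ℝ) :
    argminVal a l = a ∨ argminVal a l ∈ l := by
  induction l generalizing a with
  | nil => exact Or.inl rfl
  | cons b l ih =>
    simp only [argminVal]
    rcases ih (if b.2 < a.2 then b else a) with h | h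
    · rw [h]; split_ifs <;> simp
    · exact Or.inr (List.mem_cons_of_mem _ h)

theorem argminVal_le (l : List (Vec n × ℝ)) (a : Vec n × ℝ) :
    (argminVal a l).2 ≤ a.2 ∧ ∀ b ∈ l, (argminVal a l).2 ≤ b.2 := by
  induction l generalizing a with
  | nil => exact ⟨le_rfl, by simp⟩
  | cons b l ih =>
    obtain ⟨h1, h2⟩ := ih (if b.2 < a.2 then b else a)
    have h3 : (if b.2 < a.2 then b else a).2 ≤ a.2 := by split_ifs with h <;> [exact h.le; exact le_rfl]
    have h4 : (if b.2 < a.2 then b else a).2 ≤ b.2 := by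
      split_ifs with h <;> [exact le_rfl; exact not_lt.1 h]
    refine ⟨h1.trans h3, fun x hx => ?_⟩
    rcases List.mem_cons.1 hx with rfl | hx
    · exact h1.trans h4
    · exact h2 x hx

theorem mem_candidatePairs {w : Option (Vec n)} {uv : Vec n × Vec n} (T : ℕ) :
    ∀ X : ℕ → Vec n, uv ∈ candidatePairs w (X 0) ((List.range T).map fun i => X (i + 1)) ↔
      ∃ i < T, uv.2 = X (i + 1) ∧ (uv.1 = X i ∨ w = some uv.1) := by
  induction T with
  | zero => intro X; simp [candidatePairs]
  | succ T ih =>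
    intro X
    rw [List.range_succ_eq_map, List.map_cons, List.map_map]
    have := ih (fun i => X (i + 1))
    simp only [candidatePairs, List.mem_cons, List.mem_append, Function.comp_def] at this ⊢
    rw [this]
    obtain ⟨u, v⟩ := uv
    constructor
    · rintro (h | h | ⟨i, hi, h⟩)
      · rw [Prod.mk.injEq] at h
        exact ⟨0, by omega, h.2, Or.inl h.1⟩
      · cases w with
        | none => simp at h
        | some w =>
          simp only [Option.toList_some, List.map_cons, List.map_nil, List.mem_singleton,
            Prod.mk.injEq] at h
          exact ⟨0, by omega, h.2, Or.inr (by rw [h.1])⟩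
      · exact ⟨i + 1, by omega, h⟩
    · rintro ⟨i, hi, h1, h2⟩
      cases i with
      | zero =>
        rcases h2 with h2 | h2
        · exact Or.inl (by rw [Prod.mk.injEq]; exact ⟨h2, h1⟩)
        · exact Or.inr (Or.inl (by rw [h2]; simpa using h1))
      | succ i => exact Or.inr (Or.inr ⟨i, by omega, h1, h2⟩)

theorem length_candidatePairs_le (w : Option (Vec n)) (l : List (Vec n)) (x : Vec n) :
    (candidatePairs w x l).length ≤ 2 * l.length := by
  induction l generalizing x with
  | nil => simp [candidatePairs]
  | cons y l ih =>
    have := ih y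
    cases w <;> simp [candidatePairs] at * <;> omega

/-- The convexity test of `findPair`. -/
def zeta (p u v : Vec n) : ℝ :=
  (S.val f u + P.α * ‖u - p‖ ^ 2) - (S.val f v + P.α * ‖v - p‖ ^ 2)
    - ⟪S.grd f v + (2 * P.α) • (v - p), u - v⟫_ℝ - P.α / 2 * ‖u - v‖ ^ 2

theorem findPair_fst (p : Vec n) (l : List (Vec n × Vec n)) :
    (((findPair P S p l).run f).1 = none ∧
      ∀ uv ∈ l, -2 * P.δy - P.Δy * ‖uv.1 - uv.2‖ ≤ zeta P S f p uv.1 uv.2) ∨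
    ∃ uv ∈ l, ((findPair P S p l).run f).1 = some uv ∧
      zeta P S f p uv.1 uv.2 < -2 * P.δy - P.Δy * ‖uv.1 - uv.2‖ := by
  induction l with
  | nil => exact Or.inl ⟨rfl, by simp⟩
  | cons uv l ih =>
    obtain ⟨u, v⟩ := uv
    by_cases h : zeta P S f p u v < -2 * P.δy - P.Δy * ‖u - v‖
    · refine Or.inr ⟨(u, v), by simp, ?_, h⟩
      simp only [findPair, Prog.run_bind_fst, Prog.run_ite, apply_ite Prod.fst]
      exact if_pos h
    · have e : ((findPair P S p ((u, v) :: l)).run f).1 = ((findPair P S p l).run f).1 := by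
        simp only [findPair, Prog.run_bind_fst, Prog.run_ite, apply_ite Prod.fst]
        exact if_neg h
      rw [e]
      rcases ih with ⟨h1, h2⟩ | ⟨uv, h1, h2⟩
      · exact Or.inl ⟨h1, List.forall_mem_cons.2 ⟨not_lt.1 h, h2⟩⟩
      · exact Or.inr ⟨uv, by simp [h1], h2⟩

theorem exploitNcvx_fst (p : Vec n) (w : Option (Vec n)) (traj : List (Vec n)) :
    (((exploitNcvx P S p w traj).run f).1 = none ∧
      ∀ uv ∈ candidatePairs w p traj, -2 * P.δy - P.Δy * ‖uv.1 - uv.2‖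
        ≤ zeta P S f p uv.1 uv.2) ∨
    ∃ u v, (u, v) ∈ candidatePairs w p traj ∧
      zeta P S f p u v < -2 * P.δy - P.Δy * ‖u - v‖ ∧
      ∃ q, ((exploitNcvx P S p w traj).run f).1 = some q ∧
        (q = u + (P.η / ‖u - v‖) • (u - v) ∨ q = u - (P.η / ‖u - v‖) • (u - v)) ∧
        S.val f q ≤ S.val f (u + (P.η / ‖u - v‖) • (u - v)) ∧
        S.val f q ≤ S.val f (u - (P.η / ‖u - v‖) • (u - v)) := by
  rcases findPair_fst P S f p (candidatePairs w p traj) with ⟨h1, h2⟩ | ⟨⟨u, v⟩, h1, h2, h3⟩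
  · left
    refine ⟨?_, h2⟩
    simp only [exploitNcvx, Prog.run_bind_fst, h1]
    rfl
  · right
    refine ⟨u, v, h1, h3, ?_⟩
    set x₁ := u + (P.η / ‖u - v‖) • (u - v)
    set x₂ := u - (P.η / ‖u - v‖) • (u - v)
    refine ⟨(argminVal (x₁, S.val f x₁) [(x₂, S.val f x₂)]).1, ?_, ?_⟩
    · simp only [exploitNcvx, Prog.run_bind_fst, h2, Prog.run_pure]
      rfl
    · simp only [argminVal]
      split_ifs with h
      · exact ⟨Or.inr rfl, h.le, le_rfl⟩
      · exact ⟨Or.inl rfl, le_rfl, not_lt.1 h⟩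

/-- The choice of `p_k` after the flags 1, 2, 4. -/
def fallback (p : Vec n) (c : Certificate n) (traj : List (Vec n)) : Prog n m (Option (Vec n)) := do
  let r0 ← S.estimate p
  let rs ← estimateAll S (traj ++ c.w.toList)
  let z := argminVal (p, r0.1) rs
  if z.2 ≤ r0.1 - P.decrease then
    pure (some z.1)
  else
    exploitNcvx P S p c.w traj

theorem fallback_fst {p : Vec n} {c : Certificate n} {traj : List (Vec n)} (hdec : 0 < P.decrease) :
    (∃ z ∈ traj ++ c.w.toList, ((fallback P S p c traj).run f).1 = some z ∧
      S.val f z ≤ S.val f p - P.decrease) ∨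
    ((∀ z ∈ traj ++ c.w.toList, S.val f p - P.decrease < S.val f z) ∧
      ((fallback P S p c traj).run f).1 = ((exploitNcvx P S p c.w traj).run f).1) := by
  have h1 := argminVal_mem ((traj ++ c.w.toList).map fun x => (x, S.val f x)) (p, S.val f p)
  have h2 := argminVal_le ((traj ++ c.w.toList).map fun x => (x, S.val f x)) (p, S.val f p)
  set z := argminVal (p, S.val f p) ((traj ++ c.w.toList).map fun x => (x, S.val f x)) with hz
  have e : ((fallback P S p c traj).run f).1 = if z.2 ≤ S.val f p - P.decrease then some z.1
      else ((exploitNcvx P S p c.w traj).run f).1 := by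
    simp only [fallback, Prog.run_bind_fst, estimateAll_fst, Prog.run_ite, Prog.run_pure,
      apply_ite Prod.fst]
    rfl
  rw [e]
  by_cases h : z.2 ≤ S.val f p - P.decrease
  · left
    -- The minimizer cannot be p itself, because the decrease tested for is positive.
    rcases h1 with h1 | h1
    · rw [h1] at h
      simp only at h
      linarith
    · obtain ⟨x, hx, hxz⟩ := List.mem_map.1 h1
      refine ⟨x, hx, ?_, ?_⟩
      · rw [if_pos h, ← hxz]
      · rw [← hxz] at h; exact h
  · right
    refine ⟨fun x hx => (not_le.1 h).trans_le ?_, if_neg h⟩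
    exact h2.2 _ (List.mem_map.2 ⟨x, hx, rfl⟩)

section Cost

variable {P S f} {M : ℕ} {Ω : Set (Vec n)}

theorem estimateAll_snd (hM : ∀ x ∈ Ω, ((S.estimate x).run f).2 ≤ M) (l : List (Vec n))
    (hl : ∀ x ∈ l, x ∈ Ω) : ((estimateAll S l).run f).2 ≤ l.length * M := by
  induction l with
  | nil => simp [estimateAll, Prog.run_pure]
  | cons x l ih =>
    simp only [estimateAll, Prog.run_bind_snd, Prog.run_pure, List.length_cons]
    have h1 := hM x (hl x (by simp))
    have h2 := ih fun x hx => hl x (by simp [hx])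
    linarith

theorem certify_snd (hM : ∀ x ∈ Ω, ((S.estimate x).run f).2 ≤ M)
    {p : Vec n} {earlier : List (Vec n)} {xt xtil : Vec n} (hp : p ∈ Ω) (hxt : xt ∈ Ω)
    (hl : ∀ x ∈ earlier, x ∈ Ω) (h1 : S.prx f p xt ∈ Ω) (h2 : S.prxBall f p xtil ∈ Ω)
    (h3 : ((S.prox p xt).run f).2 ≤ M) (h4 : ((S.proxBall p xtil).run f).2 ≤ M) :
    ((certify P S p earlier xt xtil).run f).2 ≤ (earlier.length + 4) * M ∧
    (((certify P S p earlier xt xtil).run f).1 = none →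
      ((certify P S p earlier xt xtil).run f).2 ≤ 4 * M) := by
  have a1 := hM p hp
  have a2 := hM xt hxt
  have a3 := hM _ h1
  have a4 := hM _ h2
  have a5 := estimateAll_snd hM earlier hl
  unfold Subroutines.prx at a3
  unfold Subroutines.prxBall at a4
  constructor
  · simp only [certify, Prog.run_bind_snd, Prog.run_ite, Prog.run_pure, apply_ite Prod.snd]
    split_ifs <;> nlinarith
  · intro h
    simp only [certify, Prog.run_bind_fst, Prog.run_ite, Prog.run_pure,
      apply_ite Prod.fst] at h
    simp only [certify, Prog.run_bind_snd, Prog.run_ite, Prog.run_pure, apply_ite Prod.snd]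
    split_ifs at h ⊢
    linarith

theorem findPair_snd (hM : ∀ x ∈ Ω, ((S.estimate x).run f).2 ≤ M) (p : Vec n)
    (l : List (Vec n × Vec n)) (hl : ∀ uv ∈ l, uv.1 ∈ Ω ∧ uv.2 ∈ Ω) :
    ((findPair P S p l).run f).2 ≤ 2 * l.length * M := by
  induction l with
  | nil => simp [findPair, Prog.run_pure]
  | cons uv l ih =>
    obtain ⟨u, v⟩ := uv
    have h1 := hM u (hl (u, v) (by simp)).1
    have h2 := hM v (hl (u, v) (by simp)).2
    have h3 := ih fun x hx => hl x (by simp [hx])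
    simp only [findPair, Prog.run_bind_snd, Prog.run_ite, Prog.run_pure, List.length_cons,
      apply_ite Prod.snd]
    split_ifs <;> nlinarith

theorem exploitNcvx_snd (hM : ∀ x ∈ Ω, ((S.estimate x).run f).2 ≤ M) {p : Vec n}
    {w : Option (Vec n)} {traj : List (Vec n)}
    (hl : ∀ uv ∈ candidatePairs w p traj, uv.1 ∈ Ω ∧ uv.2 ∈ Ω ∧
      uv.1 + (P.η / ‖uv.1 - uv.2‖) • (uv.1 - uv.2) ∈ Ω ∧
      uv.1 - (P.η / ‖uv.1 - uv.2‖) • (uv.1 - uv.2) ∈ Ω) :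
    ((exploitNcvx P S p w traj).run f).2 ≤ (4 * traj.length + 2) * M := by
  have h1 := findPair_snd (P := P) hM p (candidatePairs w p traj)
    fun uv huv => ⟨(hl uv huv).1, (hl uv huv).2.1⟩
  have h2 := length_candidatePairs_le w traj p
  have h3 : 2 * (candidatePairs w p traj).length * M ≤ 4 * traj.length * M :=
    Nat.mul_le_mul_right _ (by omega)
  rcases findPair_fst P S f p (candidatePairs w p traj) with ⟨h4, -⟩ | ⟨⟨u, v⟩, h4, h5, -⟩
  · simp only [exploitNcvx, Prog.run_bind_snd, h4, Prog.run_pure]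
    linarith
  · simp only [exploitNcvx, Prog.run_bind_snd, h5, Prog.run_pure]
    have h6 := hM _ (hl _ h4).2.2.1
    have h7 := hM _ (hl _ h4).2.2.2
    simp only at h6 h7
    linarith

theorem nextPoint_snd (hM : ∀ x ∈ Ω, ((S.estimate x).run f).2 ≤ M) {p : Vec n}
    {c : Certificate n} {traj : List (Vec n)} (hp : p ∈ Ω)
    (hz : ∀ z ∈ traj ++ c.w.toList, z ∈ Ω)
    (hl : ∀ uv ∈ candidatePairs c.w p traj, uv.1 ∈ Ω ∧ uv.2 ∈ Ω ∧
      uv.1 + (P.η / ‖uv.1 - uv.2‖) • (uv.1 - uv.2) ∈ Ω ∧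
      uv.1 - (P.η / ‖uv.1 - uv.2‖) • (uv.1 - uv.2) ∈ Ω) :
    ((nextPoint P S p c traj).run f).2 ≤ (5 * traj.length + 4) * M := by
  have key : ((fallback P S p c traj).run f).2 ≤ (5 * traj.length + 4) * M := by
    have h1 := hM p hp
    have h2 := estimateAll_snd hM _ hz
    have h3 := exploitNcvx_snd hM hl
    have h4 : (traj ++ c.w.toList).length ≤ traj.length + 1 := by
      cases c.w <;> simp
    have h5 : (traj ++ c.w.toList).length * M ≤ (traj.length + 1) * M := Nat.mul_le_mul_right _ h4
    simp only [fallback, Prog.run_bind_snd, Prog.run_ite, Prog.run_pure, apply_ite Prod.snd]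
    split_ifs
    · nlinarith
    · linarith
  obtain ⟨flag, w, x⟩ := c
  cases flag <;> first | exact key | exact Nat.zero_le _

end Cost

end Semantics

end

end Minimax

namespace Minimax

open scoped InnerProductSpace

noncomputable section

/-! ### Scales of the parameters and the accelerated proximal inequality -/

section Epoch

variable {n m : ℕ}

/-- The relations between the parameters that the analysis of IAPUN uses. -/
structure Params.Tuned (P : Params) : Prop where
  ℓ_pos : 0 < P.ℓ
  μ_pos : 0 < P.μ
  μ_le : P.μ ≤ P.ℓ
  L₂_pos : 0 < P.L₂
  ε_pos : 0 < P.ε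
  α_pos : 0 < P.α
  α_sq : P.α ^ 2 = P.L₂ * P.ε
  α_le : P.α ≤ P.ℓ
  γ_eq : P.γ = P.ℓ
  η_eq : P.η = P.d
  δx_pos : 0 < P.δx
  δy_eq : P.δy = P.δx
  Δy_pos : 0 < P.Δy
  Δy_mul : P.Δy * P.d = P.δx
  Δy_le : P.Δy ≤ P.ε / 100
  χ_le : P.χ + 5 * P.δx ≤ P.ε ^ 2 / (10000 * P.ℓ)
  smooth_le : 2 * (P.L₁ + 2 * P.α + 2 * P.γ) * P.δx ≤ (P.ε / 100) ^ 2

namespace Params.Tuned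

variable {P : Params} (t : P.Tuned)
include t

theorem d_pos : 0 < P.d := div_pos t.α_pos t.L₂_pos

theorem L₂_mul_d : P.L₂ * P.d = P.α := by
  have := t.L₂_pos
  unfold d
  field_simp

theorem α_mul_d : P.α * P.d = P.ε := by
  have := t.L₂_pos
  unfold d
  rw [← mul_div_assoc, ← sq, t.α_sq, mul_div_cancel_left₀ _ this.ne']

theorem decrease_eq : P.decrease = P.α * P.d ^ 2 / 32 := by
  have := t.L₂_pos
  unfold decrease d
  field_simp

theorem radius_eq : P.radius = P.d / 4 := by
  have := t.L₂_pos
  unfold radius d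
  field_simp

theorem sq_div_le : P.ε ^ 2 / P.ℓ ≤ P.α * P.d ^ 2 := by
  have := t.d_pos
  have h := t.α_le
  have := t.α_pos
  rw [← t.α_mul_d, div_le_iff₀ t.ℓ_pos, mul_pow]
  have : 0 ≤ P.α * P.d ^ 2 := by positivity
  nlinarith

theorem κx_one_le : 1 ≤ P.κx := by
  unfold κx
  rw [t.γ_eq, one_le_div t.α_pos]
  exact t.α_le

theorem sqrt_κx_one_le : 1 ≤ √P.κx := Real.one_le_sqrt.2 t.κx_one_le

theorem L₁_pos : 0 < P.L₁ := by
  have := t.ℓ_pos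
  have := t.μ_pos
  unfold L₁ κy
  positivity

theorem χ_nonneg : 0 ≤ P.χ := by
  have := t.ℓ_pos
  have := t.L₁_pos
  have := t.α_pos
  have := t.δx_pos
  have := t.d_pos
  have := t.κx_one_le
  unfold χ
  positivity

theorem small_le : P.χ + 5 * P.δx ≤ P.α * P.d ^ 2 / 10000 := by
  have h1 := t.χ_le
  have h2 := t.sq_div_le
  have : P.ε ^ 2 / (10000 * P.ℓ) = P.ε ^ 2 / P.ℓ / 10000 := by rw [div_div, mul_comm]
  linarith

end Params.Tuned

/-- Smoothness constant of the proximal objectives. -/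
def Params.LΨ (P : Params) : ℝ := P.L₁ + 2 * P.α + 2 * P.γ

/-- Error of one accelerated proximal step. -/
def Params.stepErr (P : Params) : ℝ := √(2 * P.LΨ * P.δx) * (P.d / 2) + 7 * P.δx

/-- `Φ(x) + α‖x - p‖²`. -/
def aug (P : Params) (f : Pair n m → ℝ) (p x : Vec n) : ℝ := primal f x + P.α * ‖x - p‖ ^ 2

theorem aug_self (P : Params) (f : Pair n m → ℝ) (p : Vec n) : aug P f p p = primal f p := by
  simp [aug]

/-- The standing assumptions of the analysis of IAPUN. -/
structure Regular (P : Params) (S : Subroutines n m) (f : Pair n m → ℝ) : Prop where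
  tuned : P.Tuned
  ncsc : IsNCSC f P.ℓ P.μ P.L₂
  accurate : S.Accurate P f

theorem Params.Tuned.LΨ_pos {P : Params} (t : P.Tuned) : 0 < P.LΨ := by
  have := t.ℓ_pos
  have := t.L₁_pos
  have := t.α_pos
  unfold Params.LΨ
  rw [t.γ_eq]
  positivity

theorem Params.Tuned.sqrt_LΨ_le {P : Params} (t : P.Tuned) : √(2 * P.LΨ * P.δx) ≤ P.ε / 100 :=
  (Real.sqrt_le_sqrt t.smooth_le).trans_eq
    (Real.sqrt_sq (by have := t.ε_pos; positivity))

theorem Params.Tuned.stepErr_nonneg {P : Params} (t : P.Tuned) : 0 ≤ P.stepErr := by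
  have := t.d_pos
  have := t.δx_pos
  unfold Params.stepErr
  positivity

/-- The reason for the form of χ: it dominates the error 2√κ_x · `stepErr` that a whole epoch
accumulates, with half of χ and a few δx to spare for the estimation errors. -/
theorem Params.Tuned.stepErr_le {P : Params} (t : P.Tuned) :
    2 * √P.κx * P.stepErr ≤ P.χ / 2 - 3 * P.δx := by
  have hd := t.d_pos
  have hα := t.α_pos
  have hℓ := t.ℓ_pos
  have hδ := t.δx_pos
  have hκ := t.κx_one_le
  have hκ' := t.sqrt_κx_one_le
  have hL := t.LΨ_pos
  have h1 : √(2 * P.LΨ * P.δx)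
      ≤ 2 * (2 * P.ℓ + P.L₁ + P.α) * √(2 * P.δx / (P.γ + 2 * P.α)) := by
    have e : P.LΨ = P.L₁ + 2 * P.α + 2 * P.ℓ := by unfold Params.LΨ; rw [t.γ_eq]
    have hL1 := t.L₁_pos
    rw [t.γ_eq]
    have hs : 0 < P.ℓ + 2 * P.α := by linarith
    rw [Real.sqrt_le_left (by positivity), mul_pow, Real.sq_sqrt (by positivity),
      mul_div_assoc', le_div_iff₀ hs]
    have b1 : P.ℓ + 2 * P.α ≤ P.LΨ := by linarith
    have b2 : P.LΨ ≤ 2 * (2 * P.ℓ + P.L₁ + P.α) := by linarith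
    have b3 : P.LΨ * (P.ℓ + 2 * P.α) ≤ (2 * (2 * P.ℓ + P.L₁ + P.α)) ^ 2 := by
      rw [sq]
      exact mul_le_mul b2 (b1.trans b2) hs.le (by linarith)
    nlinarith
  have h2 := mul_le_mul_of_nonneg_right h1 hd.le
  have h3 : P.χ = 6 * √P.κx * (11 * P.κx * P.δx
    + (2 * P.ℓ + P.L₁ + P.α) * √(2 * P.δx / (P.γ + 2 * P.α)) * P.d) := rfl
  have h4 : P.δx ≤ P.κx * P.δx := by nlinarith
  have h5 : P.stepErr ≤ (2 * P.ℓ + P.L₁ + P.α) * √(2 * P.δx / (P.γ + 2 * P.α)) * P.d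
      + 7 * P.δx := by
    unfold Params.stepErr
    linarith
  have hB : 0 ≤ (2 * P.ℓ + P.L₁ + P.α) * √(2 * P.δx / (P.γ + 2 * P.α)) * P.d := by
    have hL1 := t.L₁_pos
    positivity
  generalize (2 * P.ℓ + P.L₁ + P.α) * √(2 * P.δx / (P.γ + 2 * P.α)) * P.d = B at *
  rw [h3]
  have h6 := mul_le_mul_of_nonneg_left h5 (show 0 ≤ 2 * √P.κx by positivity)
  have h7 := mul_le_mul_of_nonneg_left h4 (show 0 ≤ 33 * √P.κx by positivity)
  have h8 : 19 * P.δx ≤ √P.κx * (19 * P.δx) := by nlinarith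
  have h9 : 0 ≤ √P.κx * B := by positivity
  nlinarith

namespace Regular

variable {P : Params} {S : Subroutines n m} {f : Pair n m → ℝ} (R : Regular P S f)
include R

theorem val_le (x : Vec n) : S.val f x ≤ primal f x + P.δx := by
  have := (abs_le.1 (R.accurate.value x)).2
  rw [R.tuned.δy_eq] at this
  unfold Subroutines.val
  linarith

theorem le_val (x : Vec n) : primal f x ≤ S.val f x + P.δx := by
  have := (abs_le.1 (R.accurate.value x)).1
  rw [R.tuned.δy_eq] at this
  unfold Subroutines.val
  linarith

theorem prox_smooth (p c x z : Vec n) : proxObjective P f p c z ≤ proxObjective P f p c x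
    + ⟪gradient (primal f) x + (2 * P.α) • (x - p) + (2 * P.γ) • (x - c), z - x⟫_ℝ
    + P.LΨ / 2 * ‖z - x‖ ^ 2 := by
  have h1 := R.ncsc.primal_le R.tuned.μ_pos R.tuned.μ_le x z
  have h2 := norm_sub_sq_expand x z p
  have h3 := norm_sub_sq_expand x z c
  simp only [proxObjective, inner_add_left, inner_smul_left, conj_trivial, h2, h3, Params.LΨ,
    Params.L₁, Params.κy]
  linarith

theorem prox_convex (p c x z : Vec n) : proxObjective P f p c x
    + ⟪gradient (primal f) x + (2 * P.α) • (x - p) + (2 * P.γ) • (x - c), z - x⟫_ℝ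
    + P.ℓ / 2 * ‖z - x‖ ^ 2 ≤ proxObjective P f p c z := by
  have h1 := R.ncsc.primal_ge R.tuned.μ_pos R.tuned.μ_le x z
  have h2 := norm_sub_sq_expand x z p
  have h3 := norm_sub_sq_expand x z c
  have h4 : 0 ≤ P.α * ‖z - x‖ ^ 2 := by have := R.tuned.α_pos; positivity
  simp only [proxObjective, inner_add_left, inner_smul_left, conj_trivial, h2, h3, R.tuned.γ_eq]
  linarith

theorem stationary {p c x u : Vec n} {X : Set (Vec n)} (hX : Convex ℝ X) (hx : x ∈ X)
    (hu : u ∈ X) (hmin : ∀ z ∈ X, proxObjective P f p c x ≤ proxObjective P f p c z + P.δx) :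
    -(√(2 * P.LΨ * P.δx) * ‖u - x‖) - 2 * P.δx
      ≤ ⟪gradient (primal f) x + (2 * P.α) • (x - p) + (2 * P.γ) • (x - c), u - x⟫_ℝ :=
  inner_ge_of_approx_min hX R.tuned.LΨ_pos R.tuned.δx_pos hx hu (R.prox_smooth p c x) hmin

/-- The exact counterpart of `zeta` is close to it. -/
theorem zeta_close (p u v : Vec n) :
    |zeta P S f p u v - (aug P f p u - aug P f p v
      - ⟪gradient (primal f) v + (2 * P.α) • (v - p), u - v⟫_ℝ - P.α / 2 * ‖u - v‖ ^ 2)|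
      ≤ 2 * P.δy + P.Δy * ‖u - v‖ := by
  have h1 := R.accurate.value u
  have h2 := R.accurate.value v
  have h3 : |⟪S.grd f v - gradient (primal f) v, u - v⟫_ℝ| ≤ P.Δy * ‖u - v‖ :=
    (abs_real_inner_le_norm _ _).trans
      (mul_le_mul_of_nonneg_right (R.accurate.grad v) (norm_nonneg _))
  rw [inner_sub_left] at h3
  change |S.val f u - _| ≤ _ at h1
  change |S.val f v - _| ≤ _ at h2
  rw [abs_le] at *
  simp only [zeta, aug, inner_add_left]
  constructor <;> linarith

/-- An approximate proximal step that passes the convexity test satisfies the inequality of the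
accelerated scheme. -/
theorem step_inequality {p c v u : Vec n} {X : Set (Vec n)} (hX : Convex ℝ X) (hv : v ∈ X)
    (hu : u ∈ X) (hmin : ∀ z ∈ X, proxObjective P f p c v ≤ proxObjective P f p c z + P.δx)
    (huv : ‖u - v‖ ≤ P.d / 2) (hz : -2 * P.δy - P.Δy * ‖u - v‖ ≤ zeta P S f p u v) :
    aug P f p v + ⟪(2 * P.γ) • (c - v), u - c⟫_ℝ + 2 * P.γ / 2 * ‖c - v‖ ^ 2
      + P.α / 4 * ‖u - c‖ ^ 2 ≤ aug P f p u + P.stepErr := by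
  have h1 := R.stationary hX hv hu hmin
  have h2 := (abs_le.1 (R.zeta_close p u v)).2
  have hΔ := R.tuned.Δy_pos
  have hα := R.tuned.α_pos
  have hαℓ := R.tuned.α_le
  have h3 := mul_le_mul_of_nonneg_left huv hΔ.le
  have h4 := mul_le_mul_of_nonneg_left huv (Real.sqrt_nonneg (2 * P.LΨ * P.δx))
  have h5 := R.tuned.Δy_mul
  rw [R.tuned.δy_eq] at h2 hz
  rw [inner_add_left (gradient (primal f) v + _), inner_smul_left, conj_trivial] at h1
  rw [inner_smul_left, conj_trivial]
  have e1 : ⟪v - c, u - v⟫_ℝ = -⟪c - v, u - c⟫_ℝ - ‖c - v‖ ^ 2 := by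
    have : u - v = (u - c) + (c - v) := by abel
    rw [this, inner_add_right, ← neg_sub c v, inner_neg_left, inner_neg_left,
      real_inner_self_eq_norm_sq]
    ring
  have e2 : ‖u - v‖ ^ 2 = ‖u - c‖ ^ 2 + 2 * ⟪c - v, u - c⟫_ℝ + ‖c - v‖ ^ 2 := by
    have : u - v = (u - c) + (c - v) := by abel
    rw [this, norm_add_sq_real, real_inner_comm]
  have e3 : -(‖u - c‖ * ‖c - v‖) ≤ ⟪c - v, u - c⟫_ℝ := by
    have := neg_le_of_abs_le (abs_real_inner_le_norm (c - v) (u - c))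
    linarith
  rw [e1] at h1
  -- The test certifies modulus α relative to v, but the scheme needs convexity relative to the
  -- centre c. Half of the modulus survives the move, and the proximal term pays for the rest
  -- (`e5`).
  have e4 : P.α / 4 * ‖u - c‖ ^ 2 - P.α / 2 * ‖c - v‖ ^ 2 ≤ P.α / 2 * ‖u - v‖ ^ 2 := by
    rw [e2]
    nlinarith [mul_nonneg hα.le (sq_nonneg (‖u - c‖ - 2 * ‖c - v‖))]
  have e5 : P.α / 2 * ‖c - v‖ ^ 2 ≤ P.γ * ‖c - v‖ ^ 2 := by
    rw [R.tuned.γ_eq]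
    nlinarith [mul_nonneg (sub_nonneg.2 hαℓ) (sq_nonneg ‖c - v‖),
      mul_nonneg hα.le (sq_nonneg ‖c - v‖)]
  -- 7 = 2 + 4 + 1: stationarity, the four value tolerances δy = δx, and 2Δy·d/2 = δx from the two
  -- gradient tolerances.
  have h6 : P.stepErr = √(2 * P.LΨ * P.δx) * (P.d / 2) + 7 * P.δx := rfl
  have := R.tuned.δx_pos
  linarith

/-- Convergence of the accelerated proximal point scheme while all pairs pass the test. -/
theorem convergence {p w : Vec n} {T : ℕ} {x : ℕ → Vec n}
    (hx : ∀ t ≤ T, x t = (iter P S f p t).1)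
    (h : ∀ t ≤ T, ∀ u, u = x t ∨ u = w → -2 * P.δy - P.Δy * ‖u - x (t + 1)‖
      ≤ zeta P S f p u (x (t + 1)) ∧ ‖u - x (t + 1)‖ ≤ P.d / 2 ∧ ∃ X : Set (Vec n), Convex ℝ X ∧
        x (t + 1) ∈ X ∧ u ∈ X ∧ ∀ z ∈ X, proxObjective P f p (iter P S f p t).2 (x (t + 1))
          ≤ proxObjective P f p (iter P S f p t).2 z + P.δx) :
    aug P f p (x (T + 1)) - aug P f p w
      ≤ (1 - 1 / (2 * √P.κx)) ^ (T + 1) * (aug P f p p - aug P f p w + P.α / 4 * ‖w - p‖ ^ 2)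
        + 2 * √P.κx * P.stepErr := by
  have hκ := R.tuned.sqrt_κx_one_le
  have hα := R.tuned.α_pos
  have hℓ := R.tuned.ℓ_pos
  have hκsq : √P.κx ^ 2 = P.γ / P.α := Real.sq_sqrt (by linarith [R.tuned.κx_one_le])
  -- With L = 2γ, the modulus α/2 left by `step_inequality` corresponds to q = 1/(2√κ_x), which is
  -- the momentum ω.
  have hqL : (1 / (2 * √P.κx)) ^ 2 * (2 * P.γ) / 2 = P.α / 4 := by
    rw [div_pow, mul_pow, hκsq, R.tuned.γ_eq]
    field_simp
    norm_num
  have key := nesterov_sequence (F := aug P f p) (Fw := aug P f p w) (w := w)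
    (q := 1 / (2 * √P.κx)) (L := 2 * P.γ) (err := P.stepErr) (x := x)
    (xt := fun t => (iter P S f p t).2) (T := T + 1) (by positivity)
    (by rw [div_le_one (by positivity)]; linarith) R.tuned.stepErr_nonneg
    (by rw [R.tuned.γ_eq]; positivity) (by rw [hx 0 (Nat.zero_le _)]; rfl)
    (fun t ht => by
      have e : P.ω = (1 - 1 / (2 * √P.κx)) / (1 + 1 / (2 * √P.κx)) := by
        unfold Params.ω
        field_simp
      rw [hx (t + 1) (by omega), hx t (by omega), ← e]
      rfl)
    (fun t ht => by
      obtain ⟨h1, h2, X, h3, h4, h5, h6⟩ := h t (by omega) (x t) (Or.inl rfl)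
      have := R.step_inequality h3 h4 h5 h6 h2 h1
      have : 0 ≤ P.α / 4 * ‖x t - (iter P S f p t).2‖ ^ 2 := by positivity
      linarith)
    (fun t ht => by
      obtain ⟨h1, h2, X, h3, h4, h5, h6⟩ := h t (by omega) w (Or.inr rfl)
      rw [hqL]
      exact R.step_inequality h3 h4 h5 h6 h2 h1)
  rw [hqL, hx 0 (Nat.zero_le _), norm_sub_rev] at key
  have e : P.stepErr / (1 / (2 * √P.κx)) = 2 * √P.κx * P.stepErr := by field_simp
  rw [e] at key
  exact key

theorem aug_le_of_not_exceeds {p x : Vec n} (h : ¬ Exceeds P S f p x) :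
    aug P f p x ≤ primal f p + P.χ + 4 * P.δx := by
  have h1 := R.val_le p
  have h2 := R.le_val x
  have h3 := not_lt.1 h
  rw [R.tuned.δy_eq] at h3
  unfold aug
  linarith

theorem lt_aug_of_exceeds {p x : Vec n} (h : Exceeds P S f p x) :
    primal f p + P.χ < aug P f p x := by
  have h1 := R.le_val p
  have h2 := R.val_le x
  have h3 : _ < _ := h
  rw [R.tuned.δy_eq] at h3
  unfold aug
  linarith

/-- If the augmented value has hardly risen, then α‖x - p‖² is at most the drop of Φ up to errors.
Without a drop of αd²/32 this keeps x within d/4 of p. -/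
theorem norm_le_of_no_decrease {p x : Vec n}
    (h1 : aug P f p x ≤ primal f p + P.χ + 5 * P.δx)
    (h2 : S.val f p - P.decrease < S.val f x) : ‖x - p‖ ≤ P.d / 4 := by
  have h3 := R.le_val p
  have h4 := R.val_le x
  have h5 := R.tuned.small_le
  have h6 := R.tuned.χ_nonneg
  have hd := R.tuned.d_pos
  rw [R.tuned.decrease_eq] at h2
  unfold aug at h1
  have hU : 0 < P.α * P.d ^ 2 := by have := R.tuned.α_pos; positivity
  have : P.α * ‖x - p‖ ^ 2 ≤ P.α * (P.d / 4) ^ 2 := by nlinarith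
  exact le_of_sq_le_sq (le_of_mul_le_mul_left this R.tuned.α_pos) (by positivity)

theorem prx_min (p c z : Vec n) :
    proxObjective P f p c (S.prx f p c) ≤ proxObjective P f p c z + P.δx :=
  R.accurate.prox p c z

theorem aug_prx_le (p x : Vec n) :
    aug P f p (S.prx f p x) + P.γ * ‖S.prx f p x - x‖ ^ 2 ≤ aug P f p x + P.δx := by
  have := R.prx_min p x x
  simpa [proxObjective, aug] using this

/-- The negative curvature step decreases the objective. -/
theorem exploit_decrease {p : Vec n} {w : Option (Vec n)} {T : ℕ} {x : ℕ → Vec n} (h0 : x 0 = p)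
    (hball : ∀ t ≤ T + 1, ‖x t - p‖ ≤ P.d / 4)
    (haug : ∀ t ≤ T, aug P f p (x t) ≤ primal f p + P.χ + 5 * P.δx)
    (hw : ∀ w', w = some w' →
      ‖w' - p‖ ≤ P.d / 4 ∧ aug P f p w' ≤ primal f p + P.χ + 5 * P.δx)
    (hpair : ¬ ∀ t ≤ T, ∀ u, u = x t ∨ w = some u →
      -2 * P.δy - P.Δy * ‖u - x (t + 1)‖ ≤ zeta P S f p u (x (t + 1))) :
    ∃ q, ((exploitNcvx P S p w ((List.range (T + 1)).map fun i => x (i + 1))).run f).1 = some q ∧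
      primal f q ≤ primal f p - P.α * P.d ^ 2 / 40 := by
  rcases exploitNcvx_fst P S f p w ((List.range (T + 1)).map fun i => x (i + 1)) with
    ⟨-, h⟩ | ⟨u, v, huv, hζ, q, hq, -, hq1, hq2⟩
  · exfalso
    refine hpair fun t ht u hu => ?_
    refine h (u, x (t + 1)) ?_
    rw [← h0]
    exact (mem_candidatePairs (T + 1) x).2 ⟨t, by omega, rfl, hu⟩
  · refine ⟨q, hq, ?_⟩
    rw [← h0] at huv
    obtain ⟨i, hi, hv, hu⟩ := (mem_candidatePairs (T + 1) x).1 huv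
    simp only at hv hu
    have hub : ‖u - p‖ ≤ P.d / 4 ∧ aug P f p u ≤ primal f p + P.χ + 5 * P.δx := by
      rcases hu with hu | hu
      · rw [hu]; exact ⟨hball i (by omega), haug i (by omega)⟩
      · exact hw u hu
    have hvb : ‖v - p‖ ≤ P.d / 4 := by rw [hv]; exact hball (i + 1) (by omega)
    have hr : ‖u - v‖ ≤ P.d / 2 := by
      have := norm_sub_le_norm_sub_add_norm_sub u p v
      rw [norm_sub_rev p v] at this
      linarith [hub.1]
    have hz := (abs_le.1 (R.zeta_close p u v)).1
    have hα := R.tuned.α_pos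
    have hd := R.tuned.d_pos
    -- The quadratic α‖· - p‖² contributes α‖u - v‖² to the Bregman difference, so failure of
    -- modulus α for the augmented function leaves curvature below -α for Φ.
    have hneg : primal f u - primal f v - ⟪gradient (primal f) v, u - v⟫_ℝ
        < -(P.α / 2 * ‖u - v‖ ^ 2) := by
      have e := norm_sub_sq_expand v u p
      rw [inner_add_left, inner_smul_left, conj_trivial] at hz
      simp only [aug] at hz
      rw [e] at hz
      linarith
    have key := negative_curvature (η := P.η) R.ncsc.primal_differentiable
      R.ncsc.primal_gradient_differentiable R.ncsc.primal_hessian_lipschitz R.tuned.L₂_pos.le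
      (by rw [R.tuned.η_eq]; exact hd.le) hneg
    have a1 := R.val_le (u + (P.η / ‖u - v‖) • (u - v))
    have a2 := R.val_le (u - (P.η / ‖u - v‖) • (u - v))
    have a3 := R.le_val q
    have a4 : primal f u ≤ aug P f p u := by
      unfold aug
      have : 0 ≤ P.α * ‖u - p‖ ^ 2 := by positivity
      linarith
    have a5 := R.tuned.small_le
    have a6 := R.tuned.χ_nonneg
    -- With η = d and ‖u - v‖ ≤ d/2 the two terms are at most -αd²/2 and αd²/3. The better endpoint
    -- gets half of the sum, αd²/12, which leaves αd²/40 after all errors.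
    have a7 : P.η ^ 2 * (P.L₂ * ‖u - v‖ - P.α) + P.L₂ / 3 * P.η ^ 3 ≤ -(P.α * P.d ^ 2 / 6) := by
      rw [R.tuned.η_eq]
      have b1 := mul_le_mul_of_nonneg_left hr R.tuned.L₂_pos.le
      have b2 := R.tuned.L₂_mul_d
      have b3 : P.L₂ * ‖u - v‖ - P.α ≤ -(P.α / 2) := by linarith
      have b4 := mul_le_mul_of_nonneg_left b3 (sq_nonneg P.d)
      have b5 : P.L₂ / 3 * P.d ^ 3 = P.α * P.d ^ 2 / 3 := by rw [← b2]; ring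
      linarith
    have hU : 0 < P.α * P.d ^ 2 := by positivity
    linarith [hub.2]

end Regular

end Epoch

end

end Minimax

namespace Minimax

open scoped InnerProductSpace

noncomputable section

/-! ### Each flag leads to a decrease of Φ or to a nearly stationary point -/

section Progress

variable {n m : ℕ}

/-- The Flag 4 test uses a slower rate than the scheme achieves. The energy E may be slightly
negative, at least -(χ + 5δx), so the difference of the two rates times E must not cost more than
χ/2 up to multiples of δx. For a = 1/(6s) one has (1 - a)⁴ ≤ 1 - 3a, and z - z⁴ ≤ 1/2 bounds the
gap. -/
theorem rate_bounds {s : ℝ} (hs : 1 ≤ s) :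
    0 ≤ 1 - 1 / (6 * s) ∧ 1 - 1 / (6 * s) ≤ 1 ∧ ∀ N : ℕ,
      (1 - 1 / (2 * s)) ^ N ≤ (1 - 1 / (6 * s)) ^ N ∧
      (1 - 1 / (6 * s)) ^ N - (1 - 1 / (2 * s)) ^ N ≤ 1 / 2 := by
  have e : 1 / (2 * s) = 3 * (1 / (6 * s)) := by field_simp; norm_num
  have ha : 0 < 1 / (6 * s) := by positivity
  have ha' : 1 / (6 * s) ≤ 1 / 6 := by gcongr; linarith
  rw [e]
  generalize 1 / (6 * s) = a at *
  refine ⟨by linarith, by linarith, fun N => ⟨?_, ?_⟩⟩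
  · exact pow_le_pow_left₀ (by linarith) (by linarith) N
  · have h1 : (1 - a) ^ 4 ≤ 1 - 3 * a := by
      nlinarith [mul_nonneg ha.le (sub_nonneg.2 ha'), mul_nonneg (mul_nonneg ha.le ha.le) ha.le,
        mul_nonneg (mul_nonneg ha.le ha.le) (sub_nonneg.2 ha')]
    have h2 := pow_le_pow_left₀ (by positivity) h1 N
    rw [← pow_mul, mul_comm 4 N, pow_mul] at h2
    generalize (1 - a) ^ N = z at *
    nlinarith [sq_nonneg (z ^ 2 - 1 / 2), sq_nonneg (z - 1 / 2)]

theorem candidatePairs_subset {w : Option (Vec n)} {uv : Vec n × Vec n} (l : List (Vec n))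
    (x : Vec n) (h : uv ∈ candidatePairs w x l) :
    (uv.1 = x ∨ uv.1 ∈ l ++ w.toList) ∧ uv.2 ∈ l := by
  induction l generalizing x with
  | nil => simp [candidatePairs] at h
  | cons y l ih =>
    simp only [candidatePairs, List.mem_cons, List.mem_append, List.mem_map] at h
    rcases h with rfl | ⟨v, hv, rfl⟩ | h
    · simp
    · simp [hv]
    · obtain ⟨h1, h2⟩ := ih y h
      simp only [List.mem_append, List.mem_cons] at h1 ⊢
      tauto

namespace Regular

variable {P : Params} {S : Subroutines n m} {f : Pair n m → ℝ} (R : Regular P S f)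
include R

/-- A gradient step of length 1/LΨ from the approximate minimizer cannot gain more than δx. -/
theorem prx_gradient_norm_le (p c : Vec n) :
    ‖gradient (primal f) (S.prx f p c) + (2 * P.α) • (S.prx f p c - p)
      + (2 * P.γ) • (S.prx f p c - c)‖ ≤ √(2 * P.LΨ * P.δx) := by
  have hL := R.tuned.LΨ_pos
  set x := S.prx f p c
  set g := gradient (primal f) x + (2 * P.α) • (x - p) + (2 * P.γ) • (x - c) with hg
  have h1 := R.prox_smooth p c x (x - P.LΨ⁻¹ • g)
  have h2 : _ ≤ proxObjective P f p c _ + _ := R.prx_min p c (x - P.LΨ⁻¹ • g)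
  rw [← hg, sub_sub_cancel_left, inner_neg_right, inner_smul_right, norm_neg, norm_smul,
    real_inner_self_eq_norm_sq, Real.norm_of_nonneg (by positivity)] at h1
  change proxObjective P f p c x ≤ _ at h2
  apply Real.le_sqrt_of_sq_le
  have e : -(P.LΨ⁻¹ * ‖g‖ ^ 2) + P.LΨ / 2 * (P.LΨ⁻¹ * ‖g‖) ^ 2 = -(‖g‖ ^ 2 / (2 * P.LΨ)) := by
    field_simp; ring
  have h3 : ‖g‖ ^ 2 / (2 * P.LΨ) ≤ P.δx := by linarith
  rw [div_le_iff₀ (by positivity)] at h3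
  linarith

/-- If the unconstrained proximal point leaves the ball, then the constrained one is close to its
boundary. -/
theorem prxBall_near_boundary {p c : Vec n} (h : P.d / 4 < ‖p - S.prx f p c‖) :
    9 / 40 * P.d ≤ ‖S.prxBall f p c - p‖ := by
  by_contra! hc
  have hd := R.tuned.d_pos
  have hℓ := R.tuned.ℓ_pos
  set x := S.prx f p c with hx
  set w := S.prxBall f p c with hw
  have hD : P.d / 40 ≤ ‖x - w‖ := by
    have := norm_sub_le_norm_sub_add_norm_sub x w p
    rw [norm_sub_rev x p] at this
    linarith
  have hD0 : 0 < ‖x - w‖ := by linarith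
  -- The point at distance d/80 from w towards x is still in the ball, as 9/40 + 1/80 < 1/4. Both w
  -- and x are δx-minimizers in comparison with it, and strong convexity between them gives
  -- ℓ(d/80)²/2 ≤ δx, which is false.
  obtain ⟨τ, hτ⟩ : ∃ τ, τ * ‖x - w‖ = P.d / 80 := ⟨P.d / 80 / ‖x - w‖, by field_simp⟩
  have hτ0 : 0 < τ := by
    by_contra! h0
    nlinarith
  have hτ1 : τ ≤ 1 / 2 := by
    by_contra! h0
    nlinarith
  have hmem : w + τ • (x - w) ∈ Metric.closedBall p P.radius := by
    rw [mem_closedBall_iff_norm, R.tuned.radius_eq]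
    have e : w + τ • (x - w) - p = (w - p) + τ • (x - w) := by abel
    rw [e]
    refine (norm_add_le _ _).trans ?_
    rw [norm_smul, Real.norm_of_nonneg hτ0.le, hτ]
    linarith
  have h1 : proxObjective P f p c w ≤ _ := R.accurate.proxBall p c _ hmem
  have h2 : proxObjective P f p c x ≤ _ := R.prx_min p c (w + τ • (x - w))
  have h3 := R.prox_convex p c (w + τ • (x - w)) w
  have h4 := R.prox_convex p c (w + τ • (x - w)) x
  have e1 : w - (w + τ • (x - w)) = -(τ • (x - w)) := by abel
  have e2 : x - (w + τ • (x - w)) = (1 - τ) • (x - w) := by module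
  rw [e1, inner_neg_right, inner_smul_right, norm_neg, norm_smul, Real.norm_of_nonneg hτ0.le,
    hτ] at h3
  rw [e2, inner_smul_right, norm_smul, Real.norm_of_nonneg (by linarith)] at h4
  have h5 := mul_le_mul_of_nonneg_left h3 (show 0 ≤ 1 - τ by linarith)
  have h6 := mul_le_mul_of_nonneg_left h4 hτ0.le
  have h7 := mul_le_mul_of_nonneg_left h1 (show 0 ≤ 1 - τ by linarith)
  have h8 := mul_le_mul_of_nonneg_left h2 hτ0.le
  have h9 : P.ℓ / 2 * (P.d / 80 * (P.d / 80)) ≤ P.δx := by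
    have b1 : P.d / 80 ≤ (1 - τ) * ‖x - w‖ := by nlinarith
    have b2 : P.ℓ / 2 * (τ * ((1 - τ) * ‖x - w‖) ^ 2) = P.ℓ / 2 * ((1 - τ) * ((P.d / 80) * ((1 - τ) * ‖x - w‖))) := by
      rw [← hτ]; ring
    have b3 : P.ℓ / 2 * (P.d / 80 * (P.d / 80)) ≤ P.ℓ / 2 * (P.d / 80 * ((1 - τ) * ‖x - w‖)) := by
      gcongr
    have b4 : (1 - τ) * (P.d / 80) ^ 2 ≥ 1 / 2 * (P.d / 80) ^ 2 := by
      have := sq_nonneg (P.d / 80)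
      nlinarith
    have b5 : 1 / 2 * (P.d / 80 * ((1 - τ) * ‖x - w‖))
        ≤ (1 - τ) * (P.d / 80 * ((1 - τ) * ‖x - w‖)) := by
      have : 0 ≤ P.d / 80 * ((1 - τ) * ‖x - w‖) := by
        have : 0 ≤ 1 - τ := by linarith
        positivity
      nlinarith
    have b6 := mul_le_mul_of_nonneg_left b4.le (show 0 ≤ P.ℓ / 2 by positivity)
    have b7 := mul_le_mul_of_nonneg_left b5 (show 0 ≤ P.ℓ / 2 by positivity)
    linarith
  have h10 := R.tuned.χ_le
  have h11 := R.tuned.χ_nonneg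
  have h12 : P.ε ^ 2 / (10000 * P.ℓ) ≤ P.ℓ * P.d ^ 2 / 10000 := by
    rw [← R.tuned.α_mul_d, div_le_div_iff₀ (by positivity) (by positivity)]
    have := pow_le_pow_left₀ R.tuned.α_pos.le R.tuned.α_le 2
    have h13 : 0 ≤ P.d ^ 2 := by positivity
    nlinarith
  have : 0 < P.ℓ * P.d ^ 2 := by positivity
  nlinarith

/-- One epoch makes progress or finds a nearly stationary point. -/
theorem epoch_progress {p : Vec n} {T : ℕ} {c : Certificate n}
    (hnone : ∀ t < T, ((certifyAt P S f p t).run f).1 = none)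
    (hc : ((certifyAt P S f p T).run f).1 = some c) :
    ∃ q, ((nextPoint P S p c (iterates P S f p T ++ [c.last])).run f).1 = some q ∧
      (‖S.grd f q‖ ≤ 3 * P.ε / 4 ∨ primal f q ≤ primal f p - P.α * P.d ^ 2 / 40) := by
  have t := R.tuned
  have hδ := t.δx_pos
  have hα := t.α_pos
  have hd := t.d_pos
  have hχ := t.χ_nonneg
  have hs := t.small_le
  have hU : 0 < P.α * P.d ^ 2 := by positivity
  have hdec : P.decrease = P.α * P.d ^ 2 / 32 := t.decrease_eq
  have herr := t.stepErr_le
  -- The actual trajectory: its last point may have been replaced by the minimizer over the ball.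
  let x : ℕ → Vec n := fun t => if t = T + 1 then c.last else (iter P S f p t).1
  have hxt : ∀ t ≤ T, x t = (iter P S f p t).1 := fun t ht => if_neg (by omega)
  have hxT : x (T + 1) = c.last := if_pos rfl
  have htraj : iterates P S f p T ++ [c.last] = (List.range (T + 1)).map fun i => x (i + 1) := by
    rw [List.range_succ, List.map_append, List.map_singleton, hxT]
    congr 1
    refine List.map_congr_left fun i hi => ?_
    rw [List.mem_range] at hi
    rw [hxt _ (by omega)]
  have hx0 : x 0 = p := by rw [hxt 0 (Nat.zero_le _)]; rfl
  have hmem : ∀ t, t < T + 1 → x (t + 1) ∈ iterates P S f p T ++ [c.last] := fun t ht => by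
    rw [htraj]; exact List.mem_map.2 ⟨t, List.mem_range.2 ht, rfl⟩
  have haug : ∀ t ≤ T, aug P f p (x t) ≤ primal f p + P.χ + 5 * P.δx := by
    intro t ht
    cases t with
    | zero => rw [hx0, aug_self]; linarith
    | succ t =>
      have := R.aug_le_of_not_exceeds (certify_eq_none P S f (hnone t ht)).1
      rw [hxt _ ht]
      linarith
  have hprx : ∀ t, (iter P S f p (t + 1)).1 = S.prx f p (iter P S f p t).2 := fun t => rfl
  have hball : (∀ z ∈ iterates P S f p T ++ [c.last] ++ c.w.toList,
      S.val f p - P.decrease < S.val f z) → ∀ t ≤ T, ‖x t - p‖ ≤ P.d / 4 := by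
    intro h t ht
    cases t with
    | zero => rw [hx0, sub_self, norm_zero]; positivity
    | succ t =>
      exact R.norm_le_of_no_decrease (haug _ ht)
        (h _ (List.mem_append_left _ (hmem t (by omega))))
  -- Reduction of the flags 1, 2, 4 to the case in which no function value has decreased.
  have hfall : ((∀ z ∈ iterates P S f p T ++ [c.last] ++ c.w.toList,
        S.val f p - P.decrease < S.val f z) →
      ‖x (T + 1) - p‖ ≤ P.d / 4 ∧
      (∀ w', c.w = some w' → ‖w' - p‖ ≤ P.d / 4 ∧
        aug P f p w' ≤ primal f p + P.χ + 5 * P.δx) ∧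
      ¬ ∀ t ≤ T, ∀ u, u = x t ∨ c.w = some u →
        -2 * P.δy - P.Δy * ‖u - x (t + 1)‖ ≤ zeta P S f p u (x (t + 1))) →
      ∃ q, ((fallback P S p c (iterates P S f p T ++ [c.last])).run f).1 = some q ∧
        primal f q ≤ primal f p - P.α * P.d ^ 2 / 40 := by
    intro h
    rcases fallback_fst P S f (p := p) (c := c) (traj := iterates P S f p T ++ [c.last])
      (by rw [hdec]; positivity) with ⟨z, -, h1, h2⟩ | ⟨h1, h2⟩
    · refine ⟨z, h1, ?_⟩
      have a1 := R.val_le p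
      have a2 := R.le_val z
      linarith
    · obtain ⟨h3, h4, h5⟩ := h h1
      rw [h2, htraj]
      refine R.exploit_decrease hx0 (fun t ht => ?_) haug h4 h5
      rcases Nat.lt_or_ge T t with h6 | h6
      · rw [show t = T + 1 by omega]; exact h3
      · exact hball h1 t h6
  -- Flag 2: the scheme with reference point `p`.
  have htwo : c.w = some p → Exceeds P S f p c.last → ‖p - c.last‖ ≤ P.radius →
      (c.last = (iter P S f p (T + 1)).1 ∨ c.last = S.prxBall f p (iter P S f p T).2) →
      ∃ q, ((fallback P S p c (iterates P S f p T ++ [c.last])).run f).1 = some q ∧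
        primal f q ≤ primal f p - P.α * P.d ^ 2 / 40 := by
    intro hw hex hr hlast
    refine hfall fun hno => ?_
    have hball' := hball hno
    rw [t.radius_eq, norm_sub_rev] at hr
    have hballT : ‖x (T + 1) - p‖ ≤ P.d / 4 := by rw [hxT]; exact hr
    refine ⟨hballT, fun w' hw' => ?_, fun hgood => ?_⟩
    · rw [hw] at hw'
      cases hw'
      rw [sub_self, norm_zero, aug_self]
      exact ⟨by positivity, by linarith⟩
    · have hub : ∀ t ≤ T, ∀ u, u = x t ∨ u = p → ‖u - p‖ ≤ P.d / 4 := by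
        rintro t ht u (rfl | rfl)
        · exact hball' t ht
        · rw [sub_self, norm_zero]; positivity
      have key := R.convergence (w := p) hxt (fun t ht u hu => by
        refine ⟨hgood t ht u (hu.imp_right fun h => by rw [hw, h]), ?_, ?_⟩
        · have a1 := hub t ht u hu
          have a2 : ‖x (t + 1) - p‖ ≤ P.d / 4 := by
            rcases Nat.lt_or_ge t T with h6 | h6
            · exact hball' _ h6
            · rw [show t = T by omega]; exact hballT
          have := norm_sub_le_norm_sub_add_norm_sub u p (x (t + 1))
          rw [norm_sub_rev p] at this
          linarith
        · by_cases hcase : t < T ∨ c.last = (iter P S f p (T + 1)).1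
          · refine ⟨Set.univ, convex_univ, trivial, trivial, fun z _ => ?_⟩
            have : x (t + 1) = S.prx f p (iter P S f p t).2 := by
              rcases hcase with h | h
              · rw [hxt _ h, hprx]
              · rcases Nat.lt_or_ge t T with h6 | h6
                · rw [hxt _ h6, hprx]
                · rw [show t = T by omega, hxT, h, hprx]
            rw [this]
            exact R.prx_min p _ z
          · push Not at hcase
            have hT : t = T := by omega
            have hl := hlast.resolve_left hcase.2
            refine ⟨Metric.closedBall p P.radius, convex_closedBall p _, ?_, ?_, ?_⟩
            · rw [hT, hxT, hl]; exact R.accurate.proxBall_mem p _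
            · rw [mem_closedBall_iff_norm, R.tuned.radius_eq]; exact hub t ht u hu
            · rw [hT, hxT, hl]; exact R.accurate.proxBall p _)
      -- With reference point p the initial potential is 0, so the augmented value has risen by at
      -- most χ/2, whereas the test found a rise of more than χ.
      rw [hxT, sub_self, sub_self, norm_zero] at key
      have := R.lt_aug_of_exceeds hex
      rw [aug_self] at key
      linarith
  rcases certify_eq_some P S f hc with ⟨h1, z, h2, h3⟩ | ⟨y, h1, h2, h3, h4⟩ | ⟨y, h1, h2, h3⟩ |
    ⟨y, h1, h2, h3, h4⟩ | ⟨w, h1, h2, h3, h4⟩ | ⟨w, h1, h2, h3, h4⟩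
  · obtain ⟨q, a1, a2⟩ := hfall fun hno =>
      absurd h3 (not_le.2 (hno z (List.mem_append_left _ (List.mem_append_left _ h2))))
    refine ⟨q, ?_, Or.inr a2⟩
    rw [h1] at a1 ⊢
    exact a1
  · obtain ⟨q, a1, a2⟩ := htwo (by rw [h1]) (by rw [h1]; exact h2) (by rw [h1]; exact h3)
      (Or.inl (by rw [h1]; exact h4))
    refine ⟨q, ?_, Or.inr a2⟩
    rw [h1] at a1 ⊢
    exact a1
  · have hr : ‖p - y‖ ≤ P.radius := by
      rw [norm_sub_rev, ← mem_closedBall_iff_norm, h3]; exact R.accurate.proxBall_mem p _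
    obtain ⟨q, a1, a2⟩ := htwo (by rw [h1]) (by rw [h1]; exact h2) (by rw [h1]; exact hr)
      (Or.inr (by rw [h1]; exact h3))
    refine ⟨q, ?_, Or.inr a2⟩
    rw [h1] at a1 ⊢
    exact a1
  -- Flag 3: α(9d/40)² exceeds αd²/40 by more than the errors.
  · refine ⟨y, by rw [h1]; rfl, Or.inr ?_⟩
    rw [t.radius_eq, hprx] at h3
    have a1 := R.prxBall_near_boundary h3
    have a2 := R.aug_le_of_not_exceeds h2
    rw [← h4] at a1
    have a3 := pow_le_pow_left₀ (by positivity) a1 2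
    have a4 := mul_le_mul_of_nonneg_left a3 hα.le
    unfold aug at a2
    nlinarith
  · have hlast : c.last = (iter P S f p (T + 1)).1 := by rw [h1]
    have hw : c.w = some w := by rw [h1]
    obtain ⟨q, a1, a2⟩ := hfall fun hno => by
      have hball' := hball hno
      have b1 := R.aug_le_of_not_exceeds h2
      have b2 := R.aug_prx_le p (iter P S f p (T + 1)).1
      rw [← h3] at b2
      have b3 : 0 ≤ P.γ * ‖w - (iter P S f p (T + 1)).1‖ ^ 2 := by
        rw [t.γ_eq]; have := t.ℓ_pos; positivity
      have hballT : ‖x (T + 1) - p‖ ≤ P.d / 4 := by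
        rw [hxT, hlast]
        refine R.norm_le_of_no_decrease (by linarith) (hlast ▸ ?_)
        exact hno _ (by simp)
      have hballw : ‖w - p‖ ≤ P.d / 4 :=
        R.norm_le_of_no_decrease (by linarith) (hno _ (by simp [hw]))
      refine ⟨hballT, fun w' hw' => ?_, fun hgood => ?_⟩
      · rw [hw] at hw'
        cases hw'
        exact ⟨hballw, by linarith⟩
      · have hub : ∀ t ≤ T, ∀ u, u = x t ∨ u = w → ‖u - p‖ ≤ P.d / 4 := by
          rintro t ht u (rfl | rfl)
          · exact hball' t ht
          · exact hballw
        have key := R.convergence (w := w) hxt (fun t ht u hu => by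
          refine ⟨hgood t ht u (hu.imp_right fun h => by rw [hw, h]), ?_, ?_⟩
          · have a1 := hub t ht u hu
            have a2 : ‖x (t + 1) - p‖ ≤ P.d / 4 := by
              rcases Nat.lt_or_ge t T with h6 | h6
              · exact hball' _ h6
              · rw [show t = T by omega]; exact hballT
            have := norm_sub_le_norm_sub_add_norm_sub u p (x (t + 1))
            rw [norm_sub_rev p] at this
            linarith
          · refine ⟨Set.univ, convex_univ, trivial, trivial, fun z _ => ?_⟩
            have : x (t + 1) = S.prx f p (iter P S f p t).2 := by
              rcases Nat.lt_or_ge t T with h6 | h6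
              · rw [hxt _ h6, hprx]
              · rw [show t = T by omega, hxT, hlast, hprx]
            rw [this]
            exact R.prx_min p _ z)
        rw [hxT, hlast] at key
        rw [length_iterates, t.δy_eq] at h4
        obtain ⟨r0, r1, r2⟩ := rate_bounds t.sqrt_κx_one_le
        obtain ⟨r3, r4⟩ := r2 (T + 1)
        have r5 := pow_nonneg r0 (T + 1)
        have r6 := pow_le_one₀ r0 r1 (n := T + 1)
        have e1 : aug P f p p - aug P f p w + P.α / 4 * ‖w - p‖ ^ 2 - 2 * P.δx
            ≤ energy P S f p w := by
          have c1 := R.le_val p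
          have c2 := R.val_le w
          rw [aug_self]
          unfold aug energy
          linarith
        have e2 := mul_le_mul_of_nonneg_left e1 r5
        -- Flag 4: the test gives a lower bound for γ‖w - x_t‖² with the slow rate, `key` and `b2`
        -- an upper bound with the fast rate. They are incompatible because E cannot be very
        -- negative.
        have e3 : -(P.χ + 5 * P.δx) ≤ aug P f p p - aug P f p w + P.α / 4 * ‖w - p‖ ^ 2 := by
          have : 0 ≤ P.α / 4 * ‖w - p‖ ^ 2 := by positivity
          rw [aug_self]
          linarith
        generalize aug P f p p - aug P f p w + P.α / 4 * ‖w - p‖ ^ 2 = E at *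
        generalize (1 - 1 / (6 * √P.κx)) ^ (T + 1) = ρ at *
        generalize (1 - 1 / (2 * √P.κx)) ^ (T + 1) = ρ' at *
        nlinarith
    refine ⟨q, ?_, Or.inr a2⟩
    rw [h1] at a1 ⊢
    exact a1
  · refine ⟨w, by rw [h1]; rfl, ?_⟩
    by_cases hg : ‖S.grd f w‖ ≤ 3 * P.ε / 4
    · exact Or.inl hg
    right
    push Not at hg
    have b1 := R.aug_le_of_not_exceeds h2
    have b2 := R.aug_prx_le p (iter P S f p (T + 1)).1
    have b4 := R.prx_gradient_norm_le p (iter P S f p (T + 1)).1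
    rw [← h3] at b2 b4
    have hγ : 0 < P.γ := by rw [t.γ_eq]; exact t.ℓ_pos
    have b3 : 0 ≤ P.γ * ‖w - (iter P S f p (T + 1)).1‖ ^ 2 := by positivity
    have b5 : ‖S.grd f w‖ ≤ ‖gradient (primal f) w‖ + P.Δy := by
      have := norm_le_norm_add_norm_sub' (S.grd f w) (gradient (primal f) w)
      have := R.accurate.grad w
      change ‖S.grd f w - _‖ ≤ _ at this
      linarith
    have b6 : ‖gradient (primal f) w‖ ≤ √(2 * P.LΨ * P.δx) + 2 * P.α * ‖w - p‖
        + 2 * P.γ * ‖w - (iter P S f p (T + 1)).1‖ := by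
      have e : gradient (primal f) w = (gradient (primal f) w + (2 * P.α) • (w - p)
        + (2 * P.γ) • (w - (iter P S f p (T + 1)).1)) - (2 * P.α) • (w - p)
        - (2 * P.γ) • (w - (iter P S f p (T + 1)).1) := by abel
      rw [e]
      refine (norm_sub_le _ _).trans ?_
      refine add_le_add ((norm_sub_le _ _).trans (add_le_add b4 ?_)) ?_
      · rw [norm_smul, Real.norm_of_nonneg (by positivity)]
      · rw [norm_smul, Real.norm_of_nonneg (by positivity)]
    have b7 := t.sqrt_LΨ_le
    have b8 := t.Δy_le
    have b9 := t.α_mul_d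
    -- Flag 5: in units of ε = αd, 2‖w - p‖/d ≥ 0.75 - 0.01 - 0.01 - 0.05, from the gradient test,
    -- Δy, the stationarity error and the residual 2γ‖w - x_t‖ ≤ ε/20.
    have b10 : 34 / 100 * P.d ≤ ‖w - p‖ := by
      have : P.α * (34 / 100 * P.d) ≤ P.α * ‖w - p‖ := by linarith
      exact le_of_mul_le_mul_left this hα
    have b11 := mul_le_mul_of_nonneg_left (pow_le_pow_left₀ (by positivity) b10 2) hα.le
    unfold aug at b1 b2
    nlinarith

end Regular

end Progress

end

end Minimax

namespace Minimax

open scoped InnerProductSpace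

noncomputable section

/-! ### Length, location and cost of an epoch; the complete run -/

section Outer

variable {n m : ℕ}

theorem nextPoint_mem {P : Params} {S : Subroutines n m} {f : Pair n m → ℝ} {p q : Vec n}
    {c : Certificate n} {traj : List (Vec n)} {Ω : Set (Vec n)} (hdec : 0 < P.decrease)
    (hz : ∀ z ∈ traj ++ c.w.toList, z ∈ Ω)
    (hl : ∀ uv ∈ candidatePairs c.w p traj,
      uv.1 + (P.η / ‖uv.1 - uv.2‖) • (uv.1 - uv.2) ∈ Ω ∧
      uv.1 - (P.η / ‖uv.1 - uv.2‖) • (uv.1 - uv.2) ∈ Ω)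
    (hq : ((nextPoint P S p c traj).run f).1 = some q) : q ∈ Ω := by
  have key : ((fallback P S p c traj).run f).1 = some q → q ∈ Ω := by
    intro hq
    rcases fallback_fst P S f (p := p) (c := c) (traj := traj) hdec with
      ⟨z, h1, h2, -⟩ | ⟨-, h2⟩
    · rw [hq] at h2
      cases h2
      exact hz _ h1
    · rw [h2] at hq
      rcases exploitNcvx_fst P S f p c.w traj with ⟨h3, -⟩ | ⟨u, v, h3, -, q', h4, h5, -⟩
      · rw [hq] at h3; cases h3
      · rw [hq] at h4
        cases h4
        rcases h5 with rfl | rfl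
        · exact (hl _ h3).1
        · exact (hl _ h3).2
  obtain ⟨flag, w, x⟩ := c
  have hw : w = some q → q ∈ Ω := fun h => hz q (by simp [h])
  cases flag
  exacts [key hq, key hq, hw hq, key hq, hw hq]

theorem outerLoop_succ {P : Params} {S : Subroutines n m} {f : Pair n m → ℝ} {B K : ℕ}
    {p q : Vec n} {c : Certificate n} {traj : List (Vec n)}
    (h1 : ((innerLoop P S p B [] p p).run f).1 = some (c, traj))
    (h2 : ((nextPoint P S p c traj).run f).1 = some q) :
    ((outerLoop P S B (K + 1) p).run f).1 = (if ‖S.grd f q‖ ≤ 3 * P.ε / 4 then some q else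
      ((outerLoop P S B K q).run f).1) ∧
    ((outerLoop P S B (K + 1) p).run f).2 = ((innerLoop P S p B [] p p).run f).2
      + (((nextPoint P S p c traj).run f).2 + (((S.estimate q).run f).2
      + if ‖S.grd f q‖ ≤ 3 * P.ε / 4 then 0 else ((outerLoop P S B K q).run f).2)) := by
  constructor
  · simp only [outerLoop, Prog.run_bind_fst, h1, h2, Prog.run_ite, Prog.run_pure,
      apply_ite Prod.fst]
    rfl
  · simp only [outerLoop, Prog.run_bind_snd, h1, h2, Prog.run_ite, Prog.run_pure,
      apply_ite Prod.snd]
    rfl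

namespace Regular

variable {P : Params} {S : Subroutines n m} {f : Pair n m → ℝ} (R : Regular P S f)
include R

/-- While neither Flag 4 nor Flag 5 is raised, γ‖w - x_t‖² lies between ε²/(1600ℓ) and the decaying
energy plus errors. The energy is at most Δ + 2δx because its quadratic terms sum to something
nonpositive. -/
theorem running_energy {p : Vec n} {t : ℕ} {Δ : ℝ} (hΔ : ∀ x, primal f p - primal f x ≤ Δ)
    (h : ((certifyAt P S f p t).run f).1 = none) :
    P.ε ^ 2 / (2000 * P.ℓ) ≤ (1 - 1 / (6 * √P.κx)) ^ (t + 1) * (Δ + 2 * P.δx) := by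
  obtain ⟨-, h1, h2⟩ := certify_eq_none P S f h
  have hℓ := R.tuned.ℓ_pos
  have hε := R.tuned.ε_pos
  have hδ := R.tuned.δx_pos
  have hα := R.tuned.α_pos
  obtain ⟨r0, -, -⟩ := rate_bounds R.tuned.sqrt_κx_one_le
  set w := S.prx f p (iter P S f p (t + 1)).1
  rw [length_iterates, R.tuned.γ_eq, R.tuned.δy_eq] at h1
  rw [R.tuned.γ_eq] at h2
  have h3 : energy P S f p w ≤ Δ + 2 * P.δx := by
    have a1 := R.val_le p
    have a2 := R.le_val w
    have a3 := hΔ w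
    have : 0 ≤ P.α * ‖w - p‖ ^ 2 := by positivity
    unfold energy
    linarith
  have h4 := mul_le_mul_of_nonneg_left h3 (pow_nonneg r0 (t + 1))
  have h5 := pow_le_pow_left₀ (by positivity) h2.le 2
  have h6 : P.ε ^ 2 / (1600 * P.ℓ) ≤ P.ℓ * ‖w - (iter P S f p (t + 1)).1‖ ^ 2 := by
    rw [div_le_iff₀ (by positivity)]
    linarith
  have h7 := R.tuned.χ_le
  have e1 : P.ε ^ 2 / (1600 * P.ℓ) = P.ε ^ 2 / P.ℓ / 1600 := by rw [div_div, mul_comm]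
  have e2 : P.ε ^ 2 / (2000 * P.ℓ) = P.ε ^ 2 / P.ℓ / 2000 := by rw [div_div, mul_comm]
  have e3 : P.ε ^ 2 / (10000 * P.ℓ) = P.ε ^ 2 / P.ℓ / 10000 := by rw [div_div, mul_comm]
  rw [e1] at h6
  rw [e3] at h7
  rw [e2]
  have : 0 < P.ε ^ 2 / P.ℓ := by positivity
  linarith

theorem exists_epoch_end {p : Vec n} {Tm : ℕ} {Δ : ℝ} (hΔ : ∀ x, primal f p - primal f x ≤ Δ)
    (hTm : (1 - 1 / (6 * √P.κx)) ^ (Tm + 1) * (Δ + 2 * P.δx) < P.ε ^ 2 / (2000 * P.ℓ)) :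
    ∃ T ≤ Tm, ∃ c, ((certifyAt P S f p T).run f).1 = some c ∧
      ∀ t < T, ((certifyAt P S f p t).run f).1 = none := by
  classical
  have hex : ∃ T, ((certifyAt P S f p T).run f).1 ≠ none :=
    ⟨Tm, fun h => absurd (R.running_energy hΔ h) (not_le.2 hTm)⟩
  obtain ⟨c, hc⟩ := Option.ne_none_iff_exists'.1 (Nat.find_spec hex)
  refine ⟨Nat.find hex, ?_, c, hc, fun t ht => not_not.1 (Nat.find_min hex ht)⟩
  exact Nat.find_min' hex fun h => absurd (R.running_energy hΔ h) (not_le.2 hTm)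

/-- Comparison with the competitor p. The bound is crude, but it only enters the cost through a
logarithm. -/
theorem norm_prx_sub_le {p c : Vec n} {Δ ρ r : ℝ} (hΔ : ∀ x, primal f p - primal f x ≤ Δ)
    (hρ0 : 0 ≤ ρ) (hρ : Δ + P.ε ^ 2 / P.ℓ ≤ P.α * ρ ^ 2) (hr : ρ ≤ r) (hc : ‖c - p‖ ≤ r) :
    ‖S.prx f p c - p‖ ≤ 2 * P.κx * r := by
  have hα := R.tuned.α_pos
  have hℓ := R.tuned.ℓ_pos
  have hκ := R.tuned.κx_one_le
  have hr0 : 0 ≤ r := hρ0.trans hr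
  have h1 := R.prx_min p c p
  simp only [proxObjective, sub_self, norm_zero] at h1
  have h2 := hΔ (S.prx f p c)
  have h3 : 0 ≤ P.γ * ‖S.prx f p c - c‖ ^ 2 := by rw [R.tuned.γ_eq]; positivity
  rw [norm_sub_rev p c] at h1
  have h4 := pow_le_pow_left₀ (norm_nonneg _) hc 2
  have h5 := pow_le_pow_left₀ hρ0 hr 2
  have h6 : P.γ = P.κx * P.α := by unfold Params.κx; field_simp
  have h7 : P.δx ≤ P.ε ^ 2 / P.ℓ := by
    have a1 := R.tuned.χ_le
    have a2 := R.tuned.χ_nonneg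
    have a3 := R.tuned.δx_pos
    have e3 : P.ε ^ 2 / (10000 * P.ℓ) = P.ε ^ 2 / P.ℓ / 10000 := by rw [div_div, mul_comm]
    have : 0 ≤ P.ε ^ 2 / P.ℓ := by positivity
    linarith
  have h8 : P.γ * ‖c - p‖ ^ 2 ≤ P.α * (P.κx * r ^ 2) := by
    rw [h6, mul_comm P.κx, mul_assoc]; gcongr
  have h9 : P.α * ‖S.prx f p c - p‖ ^ 2 ≤ P.α * ((2 * P.κx * r) ^ 2) := by
    have h10 : ρ ^ 2 ≤ P.κx * r ^ 2 := by nlinarith [sq_nonneg r]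
    have h11 : 2 * (P.κx * r ^ 2) ≤ (2 * P.κx * r) ^ 2 := by
      have : 0 ≤ P.κx * r ^ 2 := by positivity
      nlinarith
    have h12 := mul_le_mul_of_nonneg_left (add_le_add h10 h11) hα.le
    have h13 := mul_le_mul_of_nonneg_left h10 hα.le
    have h14 := mul_le_mul_of_nonneg_left h11 hα.le
    linarith
  exact le_of_sq_le_sq (le_of_mul_le_mul_left h9 hα) (by positivity)

/-- The points that are visited in an epoch remain in a ball. -/
theorem epoch_region {p : Vec n} {T : ℕ} {Δ ρ : ℝ} (hΔ : ∀ x, primal f p - primal f x ≤ Δ)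
    (hρ0 : 0 ≤ ρ) (hρ : Δ + P.ε ^ 2 / P.ℓ ≤ P.α * ρ ^ 2)
    (hnone : ∀ t < T, ((certifyAt P S f p t).run f).1 = none) {t : ℕ} (ht : t ≤ T) :
    ‖(iter P S f p t).1 - p‖ ≤ ρ ∧ ‖(iter P S f p t).2 - p‖ ≤ 3 * ρ ∧
      ‖(iter P S f p (t + 1)).1 - p‖ ≤ 6 * P.κx * ρ ∧
      ‖S.prx f p (iter P S f p (t + 1)).1 - p‖ ≤ 12 * P.κx ^ 2 * ρ := by
  have hα := R.tuned.α_pos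
  have hκ := R.tuned.sqrt_κx_one_le
  have hκ' := R.tuned.κx_one_le
  -- Iterates that passed the progress test stay within ρ, uniformly in t. The factors κ_x enter
  -- only for points that have not yet been tested, so they do not compound.
  have h1 : ∀ t ≤ T, ‖(iter P S f p t).1 - p‖ ≤ ρ := by
    intro t ht
    cases t with
    | zero => simpa [iter] using hρ0
    | succ t =>
      have a1 := R.aug_le_of_not_exceeds (certify_eq_none P S f (hnone t ht)).1
      have a2 := hΔ (iter P S f p (t + 1)).1
      have a3 := R.tuned.χ_le
      have a4 : P.ε ^ 2 / (10000 * P.ℓ) = P.ε ^ 2 / P.ℓ / 10000 := by rw [div_div, mul_comm]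
      have a5 : 0 ≤ P.ε ^ 2 / P.ℓ := by have := R.tuned.ℓ_pos; positivity
      have a6 := R.tuned.δx_pos
      unfold aug at a1
      have : P.α * ‖(iter P S f p (t + 1)).1 - p‖ ^ 2 ≤ P.α * ρ ^ 2 := by linarith
      exact le_of_sq_le_sq (le_of_mul_le_mul_left this hα) hρ0
  have h2 : ‖(iter P S f p t).2 - p‖ ≤ 3 * ρ := by
    cases t with
    | zero => simpa [iter] using hρ0
    | succ t =>
      have a1 := h1 (t + 1) ht
      have a2 := h1 t (by omega)
      have e : (iter P S f p (t + 1)).2 - p = ((iter P S f p (t + 1)).1 - p)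
          + P.ω • (((iter P S f p (t + 1)).1 - p) - ((iter P S f p t).1 - p)) := by
        simp only [iter]; module
      have hω0 : 0 ≤ P.ω := div_nonneg (by linarith) (by linarith)
      have hω1 : P.ω ≤ 1 := (div_le_one (by linarith)).2 (by linarith)
      rw [e]
      refine (norm_add_le _ _).trans ?_
      rw [norm_smul, Real.norm_of_nonneg hω0]
      have a3 := norm_sub_le ((iter P S f p (t + 1)).1 - p) ((iter P S f p t).1 - p)
      have a4 := mul_le_of_le_one_left (norm_nonneg
        (((iter P S f p (t + 1)).1 - p) - ((iter P S f p t).1 - p))) hω1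
      linarith
  have h3 : ‖(iter P S f p (t + 1)).1 - p‖ ≤ 6 * P.κx * ρ :=
    (R.norm_prx_sub_le hΔ hρ0 hρ (by linarith) h2).trans_eq (by ring)
  refine ⟨h1 t ht, h2, h3, ?_⟩
  refine (R.norm_prx_sub_le hΔ hρ0 hρ ?_ h3).trans_eq (by ring)
  nlinarith

/-- Progress, location and cost of one epoch. -/
theorem epoch {p : Vec n} {Tm B M : ℕ} {Δ ρ : ℝ} {Ω : Set (Vec n)}
    (hΔ : ∀ x, primal f p - primal f x ≤ Δ) (hρ0 : 0 ≤ ρ)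
    (hρ : Δ + P.ε ^ 2 / P.ℓ ≤ P.α * ρ ^ 2)
    (hTm : (1 - 1 / (6 * √P.κx)) ^ (Tm + 1) * (Δ + 2 * P.δx) < P.ε ^ 2 / (2000 * P.ℓ))
    (hB : Tm < B) (hΩ : Metric.closedBall p (12 * P.κx ^ 2 * ρ + 2 * P.d) ⊆ Ω)
    (hM : ∀ x ∈ Ω, ((S.estimate x).run f).2 ≤ M)
    (hM1 : ∀ p ∈ Ω, ∀ c ∈ Ω, ((S.prox p c).run f).2 ≤ M)
    (hM2 : ∀ p ∈ Ω, ∀ c ∈ Ω, ((S.proxBall p c).run f).2 ≤ M) :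
    ∃ c traj q, ((innerLoop P S p B [] p p).run f).1 = some (c, traj) ∧
      ((nextPoint P S p c traj).run f).1 = some q ∧
      (‖S.grd f q‖ ≤ 3 * P.ε / 4 ∨ primal f q ≤ primal f p - P.α * P.d ^ 2 / 40) ∧
      ‖q - p‖ ≤ 12 * P.κx ^ 2 * ρ + 2 * P.d ∧
      ((innerLoop P S p B [] p p).run f).2 + ((nextPoint P S p c traj).run f).2
        ≤ 14 * (Tm + 1) * M := by
  have hd := R.tuned.d_pos
  have hκ := R.tuned.κx_one_le
  obtain ⟨T, hT, c, hc, hnone⟩ := R.exists_epoch_end hΔ hTm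
  obtain ⟨q, hq, hprog⟩ := R.epoch_progress hnone hc
  have hreg := fun t (ht : t ≤ T) => R.epoch_region hΔ hρ0 hρ hnone ht
  have hκρ1 : ρ ≤ P.κx * ρ := by nlinarith
  have hκρ2 : P.κx * ρ ≤ P.κx ^ 2 * ρ := by nlinarith
  have hball : ∀ x, ‖x - p‖ ≤ 12 * P.κx ^ 2 * ρ + P.d → x ∈ Ω := fun x hx =>
    hΩ (by rw [mem_closedBall_iff_norm]; linarith)
  have hp : ‖p - p‖ ≤ 12 * P.κx ^ 2 * ρ + P.d := by rw [sub_self, norm_zero]; positivity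
  have hi1 : ∀ t ≤ T, ‖(iter P S f p (t + 1)).1 - p‖ ≤ 12 * P.κx ^ 2 * ρ + P.d := fun t ht => by
    have := (hreg t ht).2.2.1
    nlinarith
  have hi2 : ∀ t ≤ T, ‖(iter P S f p t).2 - p‖ ≤ 12 * P.κx ^ 2 * ρ + P.d := fun t ht => by
    have := (hreg t ht).2.1
    nlinarith
  have hi3 : ∀ t ≤ T, ‖S.prx f p (iter P S f p (t + 1)).1 - p‖ ≤ 12 * P.κx ^ 2 * ρ + P.d :=
    fun t ht => by
      have := (hreg t ht).2.2.2
      linarith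
  have hi4 : ∀ c, ‖S.prxBall f p c - p‖ ≤ 12 * P.κx ^ 2 * ρ + P.d := fun c => by
    have h1 := R.accurate.proxBall_mem p c
    rw [mem_closedBall_iff_norm, R.tuned.radius_eq] at h1
    change ‖S.prxBall f p c - p‖ ≤ _ at h1
    have : 0 ≤ P.κx ^ 2 * ρ := by positivity
    linarith
  have hiter : ∀ t ≤ T, ∀ x ∈ iterates P S f p t, ‖x - p‖ ≤ 12 * P.κx ^ 2 * ρ + P.d := by
    intro t ht x hx
    obtain ⟨i, hi, rfl⟩ := List.mem_map.1 hx
    rw [List.mem_range] at hi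
    exact hi1 i (by omega)
  have hclast : ‖c.last - p‖ ≤ 12 * P.κx ^ 2 * ρ + P.d ∧
      ∀ w, c.w = some w → ‖w - p‖ ≤ 12 * P.κx ^ 2 * ρ + P.d := by
    rcases certify_eq_some P S f hc with ⟨rfl, -⟩ | ⟨y, rfl, -, -, rfl⟩ | ⟨y, rfl, -, rfl⟩ |
      ⟨y, rfl, -, -, rfl⟩ | ⟨w, rfl, -, rfl, -⟩ | ⟨w, rfl, -, rfl, -⟩
    · exact ⟨hi1 T le_rfl, fun w hw => by cases hw⟩
    · exact ⟨hi1 T le_rfl, fun w hw => by cases hw; exact hp⟩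
    · exact ⟨hi4 _, fun w hw => by cases hw; exact hp⟩
    · exact ⟨hi4 _, fun w hw => by cases hw; exact hi4 _⟩
    · exact ⟨hi1 T le_rfl, fun w hw => by cases hw; exact hi3 T le_rfl⟩
    · exact ⟨hi1 T le_rfl, fun w hw => by cases hw; exact hi3 T le_rfl⟩
  have hz : ∀ z ∈ (iterates P S f p T ++ [c.last]) ++ c.w.toList,
      ‖z - p‖ ≤ 12 * P.κx ^ 2 * ρ + P.d := by
    intro z hz
    rcases List.mem_append.1 hz with hz | hz
    · rcases List.mem_append.1 hz with hz | hz
      · exact hiter T le_rfl z hz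
      · rw [List.mem_singleton.1 hz]; exact hclast.1
    · exact hclast.2 z (by simpa using hz)
  have hl : ∀ uv ∈ candidatePairs c.w p (iterates P S f p T ++ [c.last]),
      ‖uv.1 - p‖ ≤ 12 * P.κx ^ 2 * ρ + P.d ∧ ‖uv.2 - p‖ ≤ 12 * P.κx ^ 2 * ρ + P.d := by
    intro uv huv
    obtain ⟨h1, h2⟩ := candidatePairs_subset _ _ huv
    refine ⟨?_, hz _ (List.mem_append_left _ h2)⟩
    rcases h1 with h1 | h1
    · rw [h1]; exact hp
    · exact hz _ h1
  have hstep : ∀ uv ∈ candidatePairs c.w p (iterates P S f p T ++ [c.last]),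
      uv.1 + (P.η / ‖uv.1 - uv.2‖) • (uv.1 - uv.2)
        ∈ Metric.closedBall p (12 * P.κx ^ 2 * ρ + 2 * P.d) ∧
      uv.1 - (P.η / ‖uv.1 - uv.2‖) • (uv.1 - uv.2)
        ∈ Metric.closedBall p (12 * P.κx ^ 2 * ρ + 2 * P.d) := by
    intro uv huv
    have h1 := (hl uv huv).1
    have h2 : ‖(P.η / ‖uv.1 - uv.2‖) • (uv.1 - uv.2)‖ ≤ P.d := by
      rw [R.tuned.η_eq, norm_smul, norm_div, norm_norm, Real.norm_of_nonneg hd.le]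
      -- If both points coincide, the displacement is 0, since division by 0 gives 0.
      rcases (norm_nonneg (uv.1 - uv.2)).eq_or_lt with h | h
      · rw [← h, mul_zero]; exact hd.le
      · rw [div_mul_cancel₀ _ h.ne']
    rw [mem_closedBall_iff_norm, mem_closedBall_iff_norm, add_sub_right_comm, sub_right_comm]
    exact ⟨(norm_add_le _ _).trans (by linarith), (norm_sub_le _ _).trans (by linarith)⟩
  have hpΩ := hball p hp
  have hcert : ∀ t ≤ T, ((certifyAt P S f p t).run f).2 ≤ (t + 4) * M ∧
      (((certifyAt P S f p t).run f).1 = none → ((certifyAt P S f p t).run f).2 ≤ 4 * M) := by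
    intro t ht
    have := certify_snd (P := P) hM hpΩ (hball _ (hi1 t ht))
      (fun x hx => hball x (hiter t ht x hx)) (hball _ (hi3 t ht)) (hball _ (hi4 (iter P S f p t).2))
      (hM1 p hpΩ _ (hball _ (hi1 t ht))) (hM2 p hpΩ _ (hball _ (hi2 t ht)))
    rwa [length_iterates] at this
  have hloop : ((innerLoop P S p B [] p p).run f).1 = some (c, iterates P S f p T ++ [c.last]) :=
    innerLoop_fst P S f hc B 0 (Nat.zero_le _) (by omega) fun s _ hs => hnone s hs
  have hcost1 : ((innerLoop P S p B [] p p).run f).2 ≤ (T - 0) * (5 * M) + (T + 5) * M :=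
    innerLoop_snd P S f hc (fun t ht => hM1 p hpΩ _ (hball _ (hi2 t ht))) (hcert T le_rfl).1
      (fun t ht => (hcert t ht.le).2 (hnone t ht)) B 0 (Nat.zero_le _) (by omega)
      fun s _ hs => hnone s hs
  have hcost2 := nextPoint_snd (P := P) (c := c) hM hpΩ (fun z h => hball z (hz z h))
    (fun uv h => ⟨hball _ (hl uv h).1, hball _ (hl uv h).2, hΩ (hstep uv h).1,
      hΩ (hstep uv h).2⟩)
  have hmem : q ∈ Metric.closedBall p (12 * P.κx ^ 2 * ρ + 2 * P.d) := by
    refine nextPoint_mem (by rw [R.tuned.decrease_eq]; have := R.tuned.α_pos; positivity)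
      (fun z h => ?_) hstep hq
    rw [mem_closedBall_iff_norm]
    linarith [hz z h]
  refine ⟨c, _, q, hloop, hq, hprog, mem_closedBall_iff_norm.1 hmem, ?_⟩
  rw [List.length_append, length_iterates, List.length_singleton] at hcost2
  rw [Nat.sub_zero] at hcost1
  have : T * M ≤ Tm * M := Nat.mul_le_mul_right _ hT
  nlinarith

/-- The complete run of IAPUN. -/
theorem outerLoop_run {p₀ : Vec n} {Tm B M : ℕ} {Δ ρ : ℝ} {Ω : Set (Vec n)}
    (hΔ : ∀ x, primal f p₀ - primal f x ≤ Δ) (hρ0 : 0 ≤ ρ)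
    (hρ : Δ + P.ε ^ 2 / P.ℓ ≤ P.α * ρ ^ 2)
    (hTm : (1 - 1 / (6 * √P.κx)) ^ (Tm + 1) * (Δ + 2 * P.δx) < P.ε ^ 2 / (2000 * P.ℓ))
    (hB : Tm < B)
    (hM : ∀ x ∈ Ω, ((S.estimate x).run f).2 ≤ M)
    (hM1 : ∀ p ∈ Ω, ∀ c ∈ Ω, ((S.prox p c).run f).2 ≤ M)
    (hM2 : ∀ p ∈ Ω, ∀ c ∈ Ω, ((S.proxBall p c).run f).2 ≤ M) (k : ℕ) :
    ∀ (K : ℕ) (p : Vec n), k ≤ K → primal f p ≤ primal f p₀ →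
      primal f p - (⨅ x, primal f x) < k * (P.α * P.d ^ 2 / 40) →
      Metric.closedBall p (k * (12 * P.κx ^ 2 * ρ + 2 * P.d)) ⊆ Ω →
      ∃ p' N, (outerLoop P S B K p).run f = (some p', N) ∧ ‖gradient (primal f) p'‖ ≤ P.ε ∧
        N ≤ k * (15 * (Tm + 1) * M) := by
  have hU : 0 < P.α * P.d ^ 2 := by
    have := R.tuned.α_pos
    have := R.tuned.d_pos
    positivity
  have hrad : 0 ≤ 12 * P.κx ^ 2 * ρ + 2 * P.d := by
    have := R.tuned.κx_one_le
    have := R.tuned.d_pos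
    positivity
  induction k with
  -- k counts the epochs that the remaining gap Φ(p) - Φ* can pay for. With k = 0 the gap would be
  -- negative; each unsuccessful epoch lowers both k and the radius still needed inside Ω.
  | zero =>
    intro K p _ _ h
    have := R.ncsc.iInf_le_primal p
    simp only [Nat.cast_zero, zero_mul] at h
    linarith
  | succ k ih =>
    intro K p hK hp hk hΩ
    obtain ⟨K, rfl⟩ : ∃ K', K = K' + 1 := ⟨K - 1, by omega⟩
    have hk1 : 12 * P.κx ^ 2 * ρ + 2 * P.d
        ≤ ((k + 1 : ℕ) : ℝ) * (12 * P.κx ^ 2 * ρ + 2 * P.d) := by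
      have : (0 : ℝ) ≤ k * (12 * P.κx ^ 2 * ρ + 2 * P.d) := by positivity
      push_cast
      linarith
    have hΩ' := (Metric.closedBall_subset_closedBall hk1).trans hΩ
    obtain ⟨c, traj, q, h1, h2, h3, h4, h5⟩ := R.epoch (fun x => by linarith [hΔ x]) hρ0 hρ hTm hB
      hΩ' hM hM1 hM2
    obtain ⟨h6, h7⟩ := outerLoop_succ (K := K) h1 h2
    have hq : ((S.estimate q).run f).2 ≤ M := hM q (hΩ' (mem_closedBall_iff_norm.2 h4))
    by_cases hg : ‖S.grd f q‖ ≤ 3 * P.ε / 4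
    · rw [if_pos hg] at h6 h7
      refine ⟨q, ((outerLoop P S B (K + 1) p).run f).2, Prod.ext h6 rfl, ?_, ?_⟩
      · have a1 := R.accurate.grad q
        change ‖S.grd f q - _‖ ≤ _ at a1
        rw [norm_sub_rev] at a1
        have a2 := norm_le_norm_add_norm_sub' (gradient (primal f) q) (S.grd f q)
        have a3 := R.tuned.Δy_le
        have a4 := R.tuned.ε_pos
        linarith
      · rw [h7]
        have : 0 ≤ k * (15 * (Tm + 1) * M) := Nat.zero_le _
        nlinarith
    · rw [if_neg hg] at h6 h7
      have h8 := h3.resolve_left hg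
      obtain ⟨p', N, a1, a2, a3⟩ := ih K q (by omega) (by linarith) (by
        push_cast at hk
        linarith) (by
        refine Set.Subset.trans (Metric.closedBall_subset_closedBall' ?_) hΩ
        rw [dist_eq_norm]
        push_cast
        linarith)
      refine ⟨p', ((outerLoop P S B (K + 1) p).run f).2, Prod.ext (by rw [h6, a1]) rfl, a2, ?_⟩
      rw [h7, a1]
      nlinarith

end Regular

end Outer

end

end Minimax

namespace Minimax

open scoped InnerProductSpace

noncomputable section

/-! ### Polynomial data give logarithmic cost; accuracy of the three subroutines -/

section Implementation

variable {n m : ℕ}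

namespace SolverInput

theorem innerSteps_le {r A : ℝ} {k : ℕ} (hA : 1 ≤ A) (hr : r ≤ A ^ k) :
    (innerSteps r : ℝ) ≤ 50 * k * Real.log A + 1 := by
  have h1 : 0 ≤ 50 * Real.log (max 1 r) := by
    have := Real.log_nonneg (le_max_left 1 r); positivity
  have h2 : Real.log (max 1 r) ≤ k * Real.log A := by
    rw [← Real.log_pow]
    exact Real.log_le_log (by positivity) (max_le (one_le_pow₀ hA) hr)
  have h3 := (Nat.ceil_lt_add_one h1).le
  change (innerSteps r : ℝ) ≤ _ at h3
  linarith

theorem outerSteps_le (I : SolverInput n m) {G A : ℝ} {k : ℕ} (hA : 1 ≤ A) (hq : 0 < I.q)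
    (hr : 2 * (13 * I.ℓ * I.tol ^ 2 + G ^ 2 / I.μ) / I.τ ≤ A ^ k) :
    (I.outerSteps G : ℝ) ≤ 1 / I.q * (k * Real.log A) + 1 := by
  set r := 2 * (13 * I.ℓ * I.tol ^ 2 + G ^ 2 / I.μ) / I.τ with hr'
  have h1 : 0 ≤ 1 / I.q * Real.log (max 1 r) := by
    have := Real.log_nonneg (le_max_left 1 r); positivity
  have h2 : Real.log (max 1 r) ≤ k * Real.log A := by
    rw [← Real.log_pow]
    exact Real.log_le_log (by positivity) (max_le (one_le_pow₀ hA) hr)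
  have h3 := (Nat.ceil_lt_add_one h1).le
  change (I.outerSteps G : ℝ) ≤ _ at h3
  have h4 := mul_le_mul_of_nonneg_left h2 (show 0 ≤ 1 / I.q by positivity)
  linarith

variable {I : SolverInput n m} {f : Pair n m → ℝ} {X : Set (Vec n)} {L₂ : ℝ}

theorem Admissible.inv_q (Ad : I.Admissible f X L₂) : 1 / I.q = √3 * √(I.ℓ / I.μ) := by
  have := Ad.μ_pos
  have := Ad.ℓ_pos
  rw [q, ← Real.sqrt_mul (by norm_num), one_div, ← Real.sqrt_inv]
  congr 1
  field_simp

theorem Admissible.inv_q_le (Ad : I.Admissible f X L₂) : 1 / I.q ≤ 2 * √(I.ℓ / I.μ) := by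
  rw [Ad.inv_q]
  gcongr
  rw [Real.sqrt_le_left (by norm_num)]
  norm_num

theorem Admissible.one_le_cond (Ad : I.Admissible f X L₂) : 1 ≤ I.ℓ / I.μ :=
  (one_le_div Ad.μ_pos).2 Ad.μ_le

theorem Admissible.sqrt_cond_le (Ad : I.Admissible f X L₂) : √(I.ℓ / I.μ) ≤ I.ℓ / I.μ := by
  have := Ad.one_le_cond
  rw [Real.sqrt_le_left (by linarith)]
  nlinarith

/-- The duality gap of the solver for tolerances relative to a target accuracy `δ`. -/
theorem Admissible.gap_le (Ad : I.Admissible f X L₂) {δ : ℝ}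
    (htol : 400 * (1 + I.ℓ / I.μ) ^ 2 * (I.ℓ * I.tol ^ 2) ≤ δ)
    (hτ : 6 * (1 + I.ℓ / I.μ) * I.τ ≤ δ) :
    3 * I.ℓ / I.μ * (I.τ + I.err / I.q + I.err) + I.err ≤ δ := by
  have h1 := Ad.one_le_cond
  have h2 := Ad.inv_q_le.trans (mul_le_mul_of_nonneg_left Ad.sqrt_cond_le (by norm_num))
  have hτ0 := Ad.τ_pos
  have hℓ := Ad.ℓ_pos
  have h0 : 0 ≤ I.ℓ * I.tol ^ 2 := by positivity
  have e1 : I.err = 13 * (I.ℓ * I.tol ^ 2) := by unfold err; ring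
  have e2 : I.err / I.q = 13 * (I.ℓ * I.tol ^ 2) * (1 / I.q) := by rw [e1]; ring
  have e3 : 3 * I.ℓ / I.μ = 3 * (I.ℓ / I.μ) := by ring
  rw [e2, e3, e1]
  generalize I.ℓ / I.μ = κ at *
  generalize I.ℓ * I.tol ^ 2 = t at *
  have h3 := mul_le_mul_of_nonneg_left h2 (show 0 ≤ 13 * t by positivity)
  have h4 := mul_le_mul_of_nonneg_left h3 (show 0 ≤ 3 * κ by positivity)
  have h5 : t ≤ κ * t := by nlinarith
  have h6 : κ * t ≤ κ * (κ * t) := by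
    have := mul_le_mul_of_nonneg_left h5 (show 0 ≤ κ by linarith)
    linarith
  nlinarith

theorem four_mul_pow_le {A : ℝ} (hA : 4 ≤ A) (k : ℕ) : 4 * A ^ k ≤ A ^ (k + 1) := by
  rw [pow_succ, mul_comm]
  gcongr

theorem grad_sum_le {A e t : ℝ} (hA : 4 ≤ A) (he : 0 ≤ e) (ht : t ≤ e) {k : ℕ} :
    2 * (e * A ^ k) + t ≤ e * A ^ (k + 1) := by
  have h1 : 1 ≤ A ^ k := one_le_pow₀ (by linarith)
  have h2 := mul_le_mul_of_nonneg_left (four_mul_pow_le hA k) he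
  nlinarith

theorem sq_grad_div_le {ℓ μ ε A G : ℝ} (hℓ : 0 < ℓ) (hμ : 0 < μ) (hA : 4 ≤ A) {k : ℕ}
    (hG0 : 0 ≤ G) (hG : G ≤ ε * A ^ k) (hκ : 1 + ℓ / μ ≤ A) :
    G ^ 2 / μ ≤ ε ^ 2 / ℓ * A ^ (2 * k + 1) := by
  have h1 := pow_le_pow_left₀ hG0 hG 2
  have h2 : (ε * A ^ k) ^ 2 / μ = ε ^ 2 / ℓ * (A ^ (2 * k) * (ℓ / μ)) := by
    rw [mul_pow, ← pow_mul, mul_comm k 2]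
    field_simp
  calc _ ≤ (ε * A ^ k) ^ 2 / μ := by gcongr
    _ ≤ _ := by
      rw [h2, pow_succ A (2 * k)]
      gcongr
      linarith

theorem le_radius_sq {ℓ μ ε A : ℝ} (hℓ : 0 < ℓ) (hμ : 0 < μ) (hA : 4 ≤ A) {k : ℕ}
    (hκ : 1 + ℓ / μ ≤ A) :
    ε ^ 2 / ℓ * A ^ (2 * k) ≤ μ / 4 * (ε / ℓ * A ^ (k + 1)) ^ 2 := by
  have hA0 : 0 < A := by linarith
  have hu : 0 ≤ ε ^ 2 / ℓ := by positivity
  have e : ε ^ 2 / ℓ * A ^ (2 * k) = μ * (ε / ℓ) ^ 2 * (ℓ / μ) * A ^ (2 * k) := by field_simp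
  have e2 : μ / 4 * (ε / ℓ * A ^ (k + 1)) ^ 2 = μ * (ε / ℓ) ^ 2 * (A ^ 2 / 4) * A ^ (2 * k) := by
    rw [mul_pow, ← pow_mul, add_mul, pow_add, mul_comm k 2]
    ring
  have h : ℓ / μ ≤ A ^ 2 / 4 := by nlinarith
  rw [e, e2]
  have h1 : 0 ≤ μ * (ε / ℓ) ^ 2 := by positivity
  exact mul_le_mul_of_nonneg_right (mul_le_mul_of_nonneg_left h h1) (by positivity)

theorem one_le_log {A : ℝ} (hA : 4 ≤ A) : 1 ≤ Real.log A := by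
  have h1 : Real.exp 1 ≤ A := by linarith [Real.exp_one_lt_d9]
  have := Real.log_le_log (Real.exp_pos 1) h1
  rwa [Real.log_exp] at this

theorem mul_steps_le {s l a b : ℝ} (hs : 1 ≤ s) (hl : 1 ≤ l) (hb0 : 0 ≤ b)
    (ha : a ≤ 2550 * l + 4) (hb : b ≤ 184 * (s * l) + 3) : a * b ≤ 478000 * s * l ^ 2 := by
  have h1 : 1 ≤ s * l := by nlinarith
  calc a * b ≤ (2554 * l) * (187 * (s * l)) :=
        mul_le_mul (by linarith) (by linarith) hb0 (by linarith)
    _ ≤ _ := by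
        have : 0 ≤ s * l ^ 2 := by positivity
        linarith

/-- The cost of the solver is of order `√(ℓ/μ) log² A` if all data are polynomial in `A`. -/
theorem Admissible.cost_le (Ad : I.Admissible f X L₂) {A ε tb tt : ℝ} (hA : 4 ≤ A) (hε : 0 < ε)
    (hκ : 1 + I.ℓ / I.μ ≤ A) (htb : 0 < tb) (htb1 : 20 * (1 + I.ℓ / I.μ) * tb ≤ 1)
    (htbA : 1 ≤ tb * A ^ 34) (httA : 1 ≤ tt * A ^ 63)
    (htol : I.tol = ε / I.ℓ * tb) (hτ : I.τ = ε ^ 2 / I.ℓ * tt)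
    (hx : ‖I.objX f I.x₀ I.y₀‖ ≤ ε * A ^ 12) (hy : ‖gradY f I.x₀ I.y₀‖ ≤ ε * A ^ 12) :
    (((I.solve).run f).2 : ℝ) ≤ 478000 * √(I.ℓ / I.μ) * Real.log A ^ 2 := by
  have hℓ := Ad.ℓ_pos
  have hμ := Ad.μ_pos
  have hA1 : 1 ≤ A := by linarith
  have hA0 : 0 < A := by linarith
  have hκ1 := Ad.one_le_cond
  have hiq := Ad.inv_q_le.trans (mul_le_mul_of_nonneg_left Ad.sqrt_cond_le (by norm_num))
  have hlog := one_le_log hA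
  have hsκ : 1 ≤ √(I.ℓ / I.μ) := Real.one_le_sqrt.2 hκ1
  have hu : 0 < ε ^ 2 / I.ℓ := by positivity
  have htb2 : 40 * tb ≤ 1 := by nlinarith
  have hℓtol : I.ℓ * I.tol = ε * tb := by rw [htol]; field_simp
  have e1 : I.err = ε ^ 2 / I.ℓ * (13 * tb ^ 2) := by unfold err; rw [htol]; field_simp
  have hG0 : 0 ≤ 2 * (ε * A ^ 12) + I.ℓ * I.tol := by rw [hℓtol]; positivity
  have hG : 2 * (ε * A ^ 12) + I.ℓ * I.tol ≤ ε * A ^ 13 :=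
    grad_sum_le hA hε.le (by rw [hℓtol]; nlinarith)
  have hGμ : (2 * (ε * A ^ 12) + I.ℓ * I.tol) ^ 2 / I.μ ≤ ε ^ 2 / I.ℓ * A ^ 27 :=
    sq_grad_div_le hℓ hμ hA hG0 hG hκ
  have hA27 : 1 ≤ A ^ 27 := one_le_pow₀ hA1
  have hA28 := four_mul_pow_le hA 27
  have hA29 := four_mul_pow_le hA 28
  have hA30 := four_mul_pow_le hA 29
  norm_num1 at hA28 hA29 hA30
  -- In units of ε and ε/ℓ all data are powers of A: initial gradients A¹², dual gradient A¹³, its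
  -- square over μ A²⁷, radius of the dual iterates A¹⁶. The exponents affect only constants.
  have hD : 2 * I.err / I.q + (2 * (ε * A ^ 12) + I.ℓ * I.tol) ^ 2 / I.μ
      ≤ I.μ / 4 * (ε / I.ℓ * A ^ 16) ^ 2 := by
    have h1 : 2 * I.err / I.q ≤ ε ^ 2 / I.ℓ * 1 := by
      have h2 : 2 * I.err / I.q = ε ^ 2 / I.ℓ * (26 * tb ^ 2 * (1 / I.q)) := by rw [e1]; ring
      rw [h2]
      refine mul_le_mul_of_nonneg_left ?_ hu.le
      have h3 := mul_le_mul_of_nonneg_left hiq (show 0 ≤ 26 * tb ^ 2 by positivity)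
      have h4 := mul_le_mul_of_nonneg_left htb1 htb.le
      nlinarith
    have h2 : ε ^ 2 / I.ℓ * A ^ 30 ≤ I.μ / 4 * (ε / I.ℓ * A ^ 16) ^ 2 :=
      le_radius_sq (k := 15) hℓ hμ hA hκ
    have h3 : ε ^ 2 / I.ℓ * (1 + A ^ 27) ≤ ε ^ 2 / I.ℓ * A ^ 30 :=
      mul_le_mul_of_nonneg_left (by linarith) hu.le
    linarith
  have hcost := Ad.solve_cost (D := ε / I.ℓ * A ^ 16) (by positivity) hx hy hD
  have hin : (innerSteps ((ε * A ^ 12 + I.ℓ * (ε / I.ℓ * A ^ 16)) / (I.ℓ * I.tol)) : ℝ)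
      ≤ 50 * (51 : ℕ) * Real.log A + 1 := by
    refine innerSteps_le hA1 ?_
    rw [hℓtol, div_le_iff₀ (by positivity)]
    have h1 : I.ℓ * (ε / I.ℓ * A ^ 16) = ε * A ^ 16 := by field_simp
    have h2 : A ^ 51 * (ε * tb) = ε * (A ^ 17 * (tb * A ^ 34)) := by
      rw [show A ^ 51 = A ^ 17 * A ^ 34 by rw [← pow_add]]
      ring
    rw [h1, h2, ← mul_add]
    refine mul_le_mul_of_nonneg_left ?_ hε.le
    have h3 : A ^ 17 * 1 ≤ A ^ 17 * (tb * A ^ 34) := by gcongr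
    have h4 : A ^ 12 ≤ A ^ 16 := pow_le_pow_right₀ hA1 (by norm_num)
    have h5 := four_mul_pow_le hA 16
    norm_num1 at h5
    have : 0 < A ^ 16 := by positivity
    linarith
  have hout : (I.outerSteps (2 * (ε * A ^ 12) + I.ℓ * I.tol) : ℝ)
      ≤ 1 / I.q * ((92 : ℕ) * Real.log A) + 1 := by
    refine I.outerSteps_le hA1 Ad.q_pos ?_
    have hτ0 := Ad.τ_pos
    rw [div_le_iff₀ hτ0, hτ]
    have h1 : A ^ 92 * (ε ^ 2 / I.ℓ * tt) = ε ^ 2 / I.ℓ * (A ^ 29 * (tt * A ^ 63)) := by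
      rw [show A ^ 92 = A ^ 29 * A ^ 63 by rw [← pow_add]]
      ring
    rw [h1]
    have h3 : A ^ 29 * 1 ≤ A ^ 29 * (tt * A ^ 63) := by gcongr
    have h4 : 13 * I.ℓ * I.tol ^ 2 ≤ ε ^ 2 / I.ℓ * 1 := by
      change I.err ≤ _
      rw [e1]
      exact mul_le_mul_of_nonneg_left (by nlinarith) hu.le
    have h5 := mul_le_mul_of_nonneg_left h3 hu.le
    have h6 : ε ^ 2 / I.ℓ * (2 * (1 + A ^ 27)) ≤ ε ^ 2 / I.ℓ * (A ^ 29 * 1) :=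
      mul_le_mul_of_nonneg_left (by linarith) hu.le
    linarith
  have hcost' : (((I.solve).run f).2 : ℝ) ≤
      ((innerSteps ((ε * A ^ 12 + I.ℓ * (ε / I.ℓ * A ^ 16)) / (I.ℓ * I.tol)) : ℝ) + 3)
        * ((I.outerSteps (2 * (ε * A ^ 12) + I.ℓ * I.tol) : ℝ) + 2) := by exact_mod_cast hcost
  refine hcost'.trans ?_
  have h1 : 1 / I.q * ((92 : ℕ) * Real.log A) ≤ 2 * √(I.ℓ / I.μ) * (92 * Real.log A) := by
    push_cast
    exact mul_le_mul_of_nonneg_right Ad.inv_q_le (by positivity)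
  push_cast at hin
  exact mul_steps_le hsκ hlog (by positivity) (by linarith) (by linarith)

end SolverInput

/-- The subroutines of IAPUN. -/
def solverSubroutines (P : Params) (tol τ : ℝ) (y₀ : Vec m) (Pr : Vec n → Vec n → Vec n) :
    Subroutines n m where
  estimate x := (SolverInput.solve ⟨fun _ => x, P.α, P.ℓ, P.μ, tol, τ, x, x, x, y₀⟩).bind
    fun r => .query (pair x r.2) fun a => .ret (a.1, a.2.fst)
  prox p c := (SolverInput.solve ⟨id, P.α, P.ℓ, P.μ, tol, τ, p, c, p, y₀⟩).bind fun r => .ret r.1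
  proxBall p c := (SolverInput.solve ⟨Pr p, P.α, P.ℓ, P.μ, tol, τ, p, c, p, y₀⟩).bind
    fun r => .ret r.1

section Accuracy

variable {P : Params} {f : Pair n m → ℝ} {tol τ : ℝ} {y₀ : Vec m} {Pr : Vec n → Vec n → Vec n}

/-- With X = {x} the saddle problem is just the maximization of f(x, ·), and the proximal terms
centred at x vanish. -/
theorem admissible_estimate (t : P.Tuned) (hf : IsNCSC f P.ℓ P.μ P.L₂) (htol : 0 < tol)
    (hτ : 0 < τ) (x : Vec n) :
    SolverInput.Admissible ⟨fun _ => x, P.α, P.ℓ, P.μ, tol, τ, x, x, x, y₀⟩ f {x} P.L₂ where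
  ncsc := hf
  proj z := by simp
  start := rfl
  α_nonneg := t.α_pos.le
  α_le := t.α_le
  μ_pos := t.μ_pos
  μ_le := t.μ_le
  tol_pos := htol
  τ_pos := hτ

theorem admissible_prox (t : P.Tuned) (hf : IsNCSC f P.ℓ P.μ P.L₂) (htol : 0 < tol)
    (hτ : 0 < τ) (p c : Vec n) :
    SolverInput.Admissible ⟨id, P.α, P.ℓ, P.μ, tol, τ, p, c, p, y₀⟩ f Set.univ P.L₂ where
  ncsc := hf
  proj z := by simp
  start := trivial
  α_nonneg := t.α_pos.le
  α_le := t.α_le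
  μ_pos := t.μ_pos
  μ_le := t.μ_le
  tol_pos := htol
  τ_pos := hτ

theorem admissible_proxBall (t : P.Tuned) (hf : IsNCSC f P.ℓ P.μ P.L₂) (htol : 0 < tol)
    (hτ : 0 < τ) (hPr : ∀ p, IsProjection (Metric.closedBall p P.radius) (Pr p)) (p c : Vec n) :
    SolverInput.Admissible ⟨Pr p, P.α, P.ℓ, P.μ, tol, τ, p, c, p, y₀⟩ f
      (Metric.closedBall p P.radius) P.L₂ where
  ncsc := hf
  proj := hPr p
  start := Metric.mem_closedBall_self (by rw [t.radius_eq]; linarith [t.d_pos])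
  α_nonneg := t.α_pos.le
  α_le := t.α_le
  μ_pos := t.μ_pos
  μ_le := t.μ_le
  tol_pos := htol
  τ_pos := hτ

/-- All properties follow from a duality gap of at most δ. Maximizing over y in the gap gives the
values and the proximal properties; strong concavity turns the gap into a distance to the maximizer,
and Danskin's formula into a gradient error with square at most 2(ℓ/μ)ℓδ. -/
theorem solverSubroutines_accurate (t : P.Tuned) (hf : IsNCSC f P.ℓ P.μ P.L₂) (htol : 0 < tol)
    (hτ : 0 < τ) (hPr : ∀ p, IsProjection (Metric.closedBall p P.radius) (Pr p)) {δ : ℝ}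
    (htolδ : 400 * (1 + P.ℓ / P.μ) ^ 2 * (P.ℓ * tol ^ 2) ≤ δ)
    (hτδ : 6 * (1 + P.ℓ / P.μ) * τ ≤ δ) (hδx : δ ≤ P.δx)
    (hδΔ : 2 * (P.ℓ / P.μ) * (P.ℓ * δ) ≤ P.Δy ^ 2) :
    (solverSubroutines P tol τ y₀ Pr).Accurate P f := by
  have hμ := t.μ_pos
  have hℓ := t.ℓ_pos
  have hle := fun x y => hf.le_primal t.μ_pos t.μ_le x y
  have hest : ∀ x, ∃ yh, ((solverSubroutines P tol τ y₀ Pr).estimate x).run f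
      = ((f (pair x yh), gradX f x yh),
        ((SolverInput.solve ⟨fun _ => x, P.α, P.ℓ, P.μ, tol, τ, x, x, x, y₀⟩).run f).2 + 1) ∧
      ∀ y, f (pair x y) ≤ f (pair x yh) + δ := by
    intro x
    have Ad := admissible_estimate (y₀ := y₀) t hf htol hτ x
    obtain ⟨h1, h2⟩ := Ad.solve_gap
    have h3 := Ad.gap_le htolδ hτδ
    refine ⟨_, Prog.run_bind _ _ _, fun y => ?_⟩
    have h4 := h2 x rfl y
    rw [Set.mem_singleton_iff.1 h1] at h4
    simp only [SolverInput.obj, sub_self, norm_zero] at h4 h3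
    linarith
  have hobj : ∀ (I : SolverInput n m) (X : Set (Vec n)), I.α = P.α → I.ℓ = P.ℓ →
      (∀ x ∈ X, ∀ y, I.obj f ((I.solve).run f).1.1 y ≤ I.obj f x ((I.solve).run f).1.2 + δ) →
      ∀ x ∈ X, proxObjective P f I.p I.c ((I.solve).run f).1.1
        ≤ proxObjective P f I.p I.c x + P.δx := by
    intro I X h1 h2 h3 x hx
    set xh := ((I.solve).run f).1.1
    have h4 : primal f xh ≤ proxObjective P f I.p I.c x + P.δx - P.α * ‖xh - I.p‖ ^ 2
        - P.γ * ‖xh - I.c‖ ^ 2 := by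
      refine ciSup_le fun y => ?_
      have a1 := h3 x hx y
      have a2 := hle x ((I.solve).run f).1.2
      unfold SolverInput.obj at a1
      rw [h1, h2] at a1
      unfold proxObjective
      rw [t.γ_eq]
      linarith
    unfold proxObjective at h4 ⊢
    linarith
  refine ⟨fun x => ?_, fun x => ?_, fun p c x => ?_, fun p c => ?_, fun p c x hx => ?_⟩
  · obtain ⟨yh, h1, h2⟩ := hest x
    rw [h1, t.δy_eq, abs_le]
    have h3 : primal f x ≤ f (pair x yh) + δ := ciSup_le h2
    have h4 := hle x yh
    constructor <;> simp only <;> linarith [t.δx_pos]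
  · obtain ⟨yh, h1, h2⟩ := hest x
    obtain ⟨ys, -, h3, -, h4⟩ := hf.exists_primal t.μ_pos t.μ_le x
    rw [h1, h3]
    refine (hf.gradX_lipschitz_snd x yh ys).trans ?_
    have h5 := h4 yh
    have h6 := h2 ys
    have h7 : P.μ / 2 * ‖yh - ys‖ ^ 2 ≤ δ := by linarith
    refine le_of_sq_le_sq ?_ t.Δy_pos.le
    refine le_trans ?_ hδΔ
    have h8 := mul_le_mul_of_nonneg_left h7 (show 0 ≤ 2 * (P.ℓ / P.μ) * P.ℓ by positivity)
    have e : 2 * (P.ℓ / P.μ) * P.ℓ * (P.μ / 2 * ‖yh - ys‖ ^ 2) = (P.ℓ * ‖yh - ys‖) ^ 2 := by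
      field_simp
    rw [e] at h8
    linarith
  · have Ad := admissible_prox (y₀ := y₀) t hf htol hτ p c
    have e : (((solverSubroutines P tol τ y₀ Pr).prox p c).run f).1
        = ((SolverInput.solve ⟨id, P.α, P.ℓ, P.μ, tol, τ, p, c, p, y₀⟩).run f).1.1 :=
      congrArg Prod.fst (Prog.run_bind f (SolverInput.solve _) _)
    rw [e]
    exact hobj ⟨id, P.α, P.ℓ, P.μ, tol, τ, p, c, p, y₀⟩ Set.univ rfl rfl
      (fun x hx y => (Ad.solve_gap.2 x hx y).trans
        (add_le_add le_rfl (Ad.gap_le htolδ hτδ))) x trivial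
  · have Ad := admissible_proxBall (y₀ := y₀) t hf htol hτ hPr p c
    have e : (((solverSubroutines P tol τ y₀ Pr).proxBall p c).run f).1
        = ((SolverInput.solve ⟨Pr p, P.α, P.ℓ, P.μ, tol, τ, p, c, p, y₀⟩).run f).1.1 :=
      congrArg Prod.fst (Prog.run_bind f (SolverInput.solve _) _)
    rw [e]
    exact Ad.solve_gap.1
  · have Ad := admissible_proxBall (y₀ := y₀) t hf htol hτ hPr p c
    have e : (((solverSubroutines P tol τ y₀ Pr).proxBall p c).run f).1
        = ((SolverInput.solve ⟨Pr p, P.α, P.ℓ, P.μ, tol, τ, p, c, p, y₀⟩).run f).1.1 :=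
      congrArg Prod.fst (Prog.run_bind f (SolverInput.solve _) _)
    rw [e]
    exact hobj ⟨Pr p, P.α, P.ℓ, P.μ, tol, τ, p, c, p, y₀⟩ _ rfl rfl
      (fun x hx y => (Ad.solve_gap.2 x hx y).trans
        (add_le_add le_rfl (Ad.gap_le htolδ hτδ))) x hx

end Accuracy

end Implementation

end

end Minimax

namespace Minimax

open scoped InnerProductSpace

noncomputable section

/-! ### Explicit tolerances -/

section Parameters

/-- The relative accuracy of the subroutines in terms of `a = ℓ² / (L₂ ε)` and `K = 1 + ℓ / μ`. -/
def relAcc (a K : ℝ) : ℝ := 1 / (10 ^ 7 * a * K)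

/-- The relative accuracy of the solver of the subproblems. -/
def relGap (a K : ℝ) : ℝ := relAcc a K ^ 2 / (2 * a * K)

/-- The parameters of IAPUN as functions of the problem constants. -/
def stdParams (ℓ μ L₂ ε : ℝ) : Params where
  ℓ := ℓ
  μ := μ
  L₂ := L₂
  ε := ε
  α := √(L₂ * ε)
  γ := ℓ
  η := √(L₂ * ε) / L₂
  δx := ε ^ 2 / ℓ * relAcc (ℓ ^ 2 / (L₂ * ε)) (1 + ℓ / μ) ^ 2
  δy := ε ^ 2 / ℓ * relAcc (ℓ ^ 2 / (L₂ * ε)) (1 + ℓ / μ) ^ 2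
  Δy := ε ^ 2 / ℓ * relAcc (ℓ ^ 2 / (L₂ * ε)) (1 + ℓ / μ) ^ 2 / (√(L₂ * ε) / L₂)

variable {a K : ℝ}

theorem relAcc_pos (ha : 1 ≤ a) (hK : 1 ≤ K) : 0 < relAcc a K := by
  unfold relAcc; positivity

theorem relAcc_mul_le (ha : 1 ≤ a) (hK : 1 ≤ K) : 10 ^ 7 * (K * a * relAcc a K) ≤ 1 := by
  unfold relAcc
  apply le_of_eq
  field_simp

theorem relAcc_le (ha : 1 ≤ a) (hK : 1 ≤ K) : 10 ^ 7 * relAcc a K ≤ 1 := by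
  have h1 := relAcc_pos ha hK
  have h2 : 1 ≤ K * a := by nlinarith
  have h3 := relAcc_mul_le ha hK
  have h4 := mul_le_mul_of_nonneg_right h2 h1.le
  linarith

theorem relGap_pos (ha : 1 ≤ a) (hK : 1 ≤ K) : 0 < relGap a K := by
  have := relAcc_pos ha hK
  unfold relGap; positivity

theorem relGap_le (ha : 1 ≤ a) (hK : 1 ≤ K) : relGap a K ≤ relAcc a K := by
  have h1 := relAcc_pos ha hK
  have h2 := relAcc_le ha hK
  have h3 : 1 ≤ a * K := by nlinarith
  unfold relGap
  rw [div_le_iff₀ (by positivity)]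
  nlinarith

theorem inv_relGap (ha : 1 ≤ a) (hK : 1 ≤ K) :
    1 = relGap a K * (2 * 10 ^ 14 * (a ^ 3 * K ^ 3)) := by
  unfold relGap relAcc
  field_simp

/-- The tolerance is at least an inverse power of A, so attaining it costs O(log A) steps. Even the
numerical constant is absorbed by a power of A, as 2·10¹⁴ ≤ 4²⁴. -/
theorem inv_relGap_le {A : ℝ} (ha : 1 ≤ a) (hK : 1 ≤ K) (hA : 4 ≤ A) (haA : a ≤ A) (hKA : K ≤ A) :
    1 ≤ relGap a K * A ^ 30 := by
  rw [inv_relGap ha hK]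
  have h1 := relGap_pos ha hK
  refine mul_le_mul_of_nonneg_left ?_ h1.le
  calc 2 * 10 ^ 14 * (a ^ 3 * K ^ 3) ≤ 4 ^ 24 * (A ^ 3 * A ^ 3) := by
        gcongr
        norm_num
    _ ≤ A ^ 24 * (A ^ 3 * A ^ 3) := by gcongr
    _ = A ^ 30 := by rw [← pow_add, ← pow_add]

/-- The relative gradient tolerance of the solver. -/
def relTol (a K : ℝ) : ℝ := relGap a K / (20 * K)

/-- The relative value tolerance of the solver. -/
def relVal (a K : ℝ) : ℝ := relGap a K ^ 2 / (6 * K)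

theorem relTol_pos (ha : 1 ≤ a) (hK : 1 ≤ K) : 0 < relTol a K := by
  have := relGap_pos ha hK
  unfold relTol; positivity

theorem relVal_pos (ha : 1 ≤ a) (hK : 1 ≤ K) : 0 < relVal a K := by
  have := relGap_pos ha hK
  unfold relVal; positivity

theorem relTol_mul_le (ha : 1 ≤ a) (hK : 1 ≤ K) : 20 * K * relTol a K ≤ 1 := by
  have h1 := relGap_le ha hK
  have h2 := relAcc_le ha hK
  have h3 := relAcc_pos ha hK
  have e : 20 * K * relTol a K = relGap a K := by unfold relTol; field_simp
  linarith

theorem inv_relTol_le {A : ℝ} (ha : 1 ≤ a) (hK : 1 ≤ K) (hA : 4 ≤ A) (haA : a ≤ A) (hKA : K ≤ A) :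
    1 ≤ relTol a K * A ^ 34 := by
  have h1 := inv_relGap_le ha hK hA haA hKA
  have h0 := relTol_pos ha hK
  have e : relGap a K = relTol a K * (20 * K) := by unfold relTol; field_simp
  have h2 : 20 * K ≤ A ^ 4 := by
    have : (4 : ℝ) ^ 3 ≤ A ^ 3 := by gcongr
    have h3 : A ^ 4 = A ^ 3 * A := by ring
    nlinarith
  rw [e] at h1
  refine h1.trans ?_
  rw [show A ^ 34 = A ^ 4 * A ^ 30 by rw [← pow_add], ← mul_assoc (relTol a K) (A ^ 4)]
  exact mul_le_mul_of_nonneg_right (mul_le_mul_of_nonneg_left h2 h0.le) (by positivity)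

theorem inv_relVal_le {A : ℝ} (ha : 1 ≤ a) (hK : 1 ≤ K) (hA : 4 ≤ A) (haA : a ≤ A) (hKA : K ≤ A) :
    1 ≤ relVal a K * A ^ 63 := by
  have h1 := inv_relGap_le ha hK hA haA hKA
  have h0 := relVal_pos ha hK
  have e : relGap a K ^ 2 = relVal a K * (6 * K) := by unfold relVal; field_simp
  have h2 : 6 * K ≤ A ^ 3 := by
    have : (4 : ℝ) ^ 2 ≤ A ^ 2 := by gcongr
    have h3 : A ^ 3 = A ^ 2 * A := by ring
    nlinarith
  have h3 : 1 ≤ (relGap a K * A ^ 30) ^ 2 := one_le_pow₀ h1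
  rw [mul_pow, e, ← pow_mul] at h3
  refine h3.trans ?_
  rw [show A ^ 63 = A ^ 3 * A ^ (30 * 2) by rw [← pow_add],
    ← mul_assoc (relVal a K) (A ^ 3)]
  exact mul_le_mul_of_nonneg_right (mul_le_mul_of_nonneg_left h2 h0.le) (by positivity)

variable {ℓ μ L₂ ε : ℝ}

theorem one_le_ratio (hL : 0 < L₂) (hε : 0 < ε) (h : ε ≤ ℓ ^ 2 / L₂) :
    1 ≤ ℓ ^ 2 / (L₂ * ε) := by
  rw [le_div_iff₀ hL] at h
  rw [one_le_div (by positivity)]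
  linarith

theorem sqrt_le_of_le (hℓ : 0 < ℓ) (hL : 0 < L₂) (h : ε ≤ ℓ ^ 2 / L₂) : √(L₂ * ε) ≤ ℓ := by
  rw [le_div_iff₀ hL] at h
  rw [Real.sqrt_le_left hℓ.le]
  linarith

theorem ratio_eq (hL : 0 < L₂) (hε : 0 < ε) :
    ℓ ^ 2 / (L₂ * ε) = (ℓ / √(L₂ * ε)) ^ 2 := by
  rw [div_pow, Real.sq_sqrt (by positivity)]

/-- The error `χ` in terms of the relative accuracy. -/
theorem chi_bound {ℓ α d ε s K κ b δ c : ℝ} (hℓ : 0 < ℓ) (hα : 0 < α) (hε : 0 < ε) (hs : 1 ≤ s)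
    (hαs : ℓ = α * s) (hd : d = ε / α) (hK : K = 1 + κ) (hκ : 1 ≤ κ) (hb : 0 < b) (hb1 : b ≤ 1)
    (hδ : δ = ε ^ 2 / ℓ * b ^ 2) (hc : c = 2 * ℓ + (1 + κ) * ℓ + α)
    (hbK : 10 ^ 7 * (K * s ^ 2 * b) ≤ 1) :
    6 * √s * (11 * s * δ + c * √(2 * δ / (ℓ + 2 * α)) * d) + 5 * δ ≤ ε ^ 2 / (10000 * ℓ) := by
  have hu : 0 < ε ^ 2 / ℓ := by positivity
  have hαℓ : α ≤ ℓ := by rw [hαs]; nlinarith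
  have hK0 : 2 ≤ K := by linarith
  have hd2 : d = ε * s / ℓ := by rw [hd, hαs]; field_simp
  have hr : √(2 * δ / (ℓ + 2 * α)) ≤ 2 * ε * b / ℓ := by
    rw [Real.sqrt_le_left (by positivity), hδ]
    have e : (2 * ε * b / ℓ) ^ 2 = 4 * (ε ^ 2 / ℓ * b ^ 2) / ℓ := by field_simp; norm_num
    rw [e]
    gcongr
    · norm_num
    · linarith
  have hc2 : c ≤ 4 * K * ℓ := by rw [hc, hK]; nlinarith
  have hc0 : 0 ≤ c := by rw [hc]; positivity
  have h1 : c * √(2 * δ / (ℓ + 2 * α)) * d ≤ ε ^ 2 / ℓ * (8 * (K * s * b)) := by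
    calc _ ≤ 4 * K * ℓ * (2 * ε * b / ℓ) * (ε * s / ℓ) := by
          rw [hd2]
          gcongr
      _ = _ := by field_simp; norm_num
  have hbb : b ^ 2 ≤ K * b := by nlinarith
  have h2 : 11 * s * δ ≤ ε ^ 2 / ℓ * (11 * (K * s * b)) := by
    have : s * b ^ 2 ≤ K * s * b := by nlinarith
    calc _ = ε ^ 2 / ℓ * (11 * (s * b ^ 2)) := by rw [hδ]; ring
      _ ≤ _ := by gcongr
  have h3 : √s ≤ s := by
    rw [Real.sqrt_le_left (by linarith)]
    nlinarith
  have h4 : 6 * √s * (11 * s * δ + c * √(2 * δ / (ℓ + 2 * α)) * d)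
      ≤ 6 * s * (ε ^ 2 / ℓ * (19 * (K * s * b))) := by
    exact mul_le_mul (by linarith) (by linarith)
      (add_nonneg (by rw [hδ]; positivity) (by rw [hd]; positivity)) (by linarith)
  have h5 : 5 * δ ≤ ε ^ 2 / ℓ * (5 * (K * s ^ 2 * b)) := by
    have : b ^ 2 ≤ K * s ^ 2 * b := by
      have : K * b * 1 ≤ K * b * s ^ 2 := by gcongr; exact one_le_pow₀ hs
      linarith
    calc _ = ε ^ 2 / ℓ * (5 * b ^ 2) := by rw [hδ]; ring
      _ ≤ _ := by gcongr
  have h6 : ε ^ 2 / (10000 * ℓ) = ε ^ 2 / ℓ * (1 / 10000) := by field_simp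
  rw [h6]
  have h7 : ε ^ 2 / ℓ * (119 * (K * s ^ 2 * b)) ≤ ε ^ 2 / ℓ * (1 / 10000) := by
    gcongr
    linarith
  linarith

theorem stdParams_tuned (hℓ : 0 < ℓ) (hμ : 0 < μ) (hμℓ : μ ≤ ℓ) (hL : 0 < L₂) (hε : 0 < ε)
    (h : ε ≤ ℓ ^ 2 / L₂) : (stdParams ℓ μ L₂ ε).Tuned := by
  have ha := one_le_ratio hL hε h
  have hκ : 1 ≤ ℓ / μ := (one_le_div hμ).2 hμℓ
  have hK : 1 ≤ 1 + ℓ / μ := by linarith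
  have hα : 0 < √(L₂ * ε) := by positivity
  have hαℓ := sqrt_le_of_le hℓ hL h
  have hα2 : √(L₂ * ε) ^ 2 = L₂ * ε := Real.sq_sqrt (by positivity)
  have hbp := relAcc_pos ha hK
  have hb1 := relAcc_le ha hK
  have hbK := relAcc_mul_le ha hK
  have hs : 1 ≤ ℓ / √(L₂ * ε) := (one_le_div hα).2 hαℓ
  have hd : √(L₂ * ε) / L₂ = ε / √(L₂ * ε) := by
    rw [div_eq_div_iff hL.ne' hα.ne', ← sq, hα2]; ring
  have hdp : 0 < √(L₂ * ε) / L₂ := by positivity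
  refine ⟨hℓ, hμ, hμℓ, hL, hε, hα, hα2, hαℓ, rfl, rfl, ?_, rfl, ?_, ?_, ?_, ?_, ?_⟩
  · change 0 < ε ^ 2 / ℓ * relAcc _ _ ^ 2
    positivity
  · change 0 < ε ^ 2 / ℓ * relAcc _ _ ^ 2 / _
    positivity
  · exact div_mul_cancel₀ _ hdp.ne'
  · change ε ^ 2 / ℓ * relAcc _ _ ^ 2 / (√(L₂ * ε) / L₂) ≤ ε / 100
    generalize relAcc (ℓ ^ 2 / (L₂ * ε)) (1 + ℓ / μ) = b at *
    rw [hd]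
    generalize √(L₂ * ε) = α at *
    have e : ε ^ 2 / ℓ * b ^ 2 / (ε / α) = ε * b ^ 2 * (α / ℓ) := by field_simp
    have h1 : α / ℓ ≤ 1 := (div_le_one hℓ).2 hαℓ
    rw [e]
    calc ε * b ^ 2 * (α / ℓ) ≤ ε * b ^ 2 * 1 := by gcongr
      _ ≤ ε * (1 / 100) := by
        rw [mul_one]
        gcongr
        nlinarith
      _ = ε / 100 := by ring
  · change 6 * √(ℓ / √(L₂ * ε)) * (11 * (ℓ / √(L₂ * ε)) * (ε ^ 2 / ℓ * relAcc _ _ ^ 2)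
      + (2 * ℓ + (1 + ℓ / μ) * ℓ + √(L₂ * ε))
        * √(2 * (ε ^ 2 / ℓ * relAcc _ _ ^ 2) / (ℓ + 2 * √(L₂ * ε))) * (√(L₂ * ε) / L₂))
      + 5 * (ε ^ 2 / ℓ * relAcc _ _ ^ 2) ≤ ε ^ 2 / (10000 * ℓ)
    refine chi_bound hℓ hα hε hs (by field_simp) hd rfl hκ hbp (by linarith) rfl rfl ?_
    rwa [← ratio_eq hL hε]
  · change 2 * ((1 + ℓ / μ) * ℓ + 2 * √(L₂ * ε) + 2 * ℓ) * (ε ^ 2 / ℓ * relAcc _ _ ^ 2)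
      ≤ (ε / 100) ^ 2
    generalize relAcc (ℓ ^ 2 / (L₂ * ε)) (1 + ℓ / μ) = b at *
    generalize √(L₂ * ε) = α at *
    generalize ℓ / μ = κ at *
    have h1 : 2 * ((1 + κ) * ℓ + 2 * α + 2 * ℓ) ≤ 10 * (1 + κ) * ℓ := by nlinarith
    have h2 : (1 + κ) * b ≤ 1 := by
      have := mul_le_mul_of_nonneg_left ha (show 0 ≤ (1 + κ) * b by positivity)
      nlinarith
    calc _ ≤ 10 * (1 + κ) * ℓ * (ε ^ 2 / ℓ * b ^ 2) := by gcongr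
      _ = 10 * ε ^ 2 * ((1 + κ) * b * b) := by field_simp
      _ ≤ 10 * ε ^ 2 * (1 * b) := by gcongr
      _ ≤ _ := by nlinarith [sq_nonneg ε]

end Parameters

/-! ### Initial gradients of the subproblems -/

section Data

variable {n m : ℕ} {f : Pair n m → ℝ} {ℓ μ L₂ : ℝ}

/-- An ascent step of length 1/ℓ gains at least ‖∇_y f‖²/(2ℓ), and it cannot pass the maximum. -/
theorem IsNCSC.gradY_sq_le (hf : IsNCSC f ℓ μ L₂) (hμ : 0 < μ) (hμℓ : μ ≤ ℓ) (x : Vec n)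
    (y : Vec m) : ‖gradY f x y‖ ^ 2 ≤ 2 * ℓ * (primal f x - f (pair x y)) := by
  have hℓ := hμ.trans_le hμℓ
  have h1 := (hf.ge_snd x y (y + ℓ⁻¹ • gradY f x y)).trans (hf.le_primal hμ hμℓ x _)
  rw [add_sub_cancel_left, inner_smul_right, real_inner_self_eq_norm_sq, norm_smul,
    Real.norm_of_nonneg (by positivity)] at h1
  have e : ‖gradY f x y‖ ^ 2
      = 2 * ℓ * (ℓ⁻¹ * ‖gradY f x y‖ ^ 2 - ℓ / 2 * (ℓ⁻¹ * ‖gradY f x y‖) ^ 2) := by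
    field_simp; ring
  rw [e]
  exact mul_le_mul_of_nonneg_left (by linarith) (by linarith)

theorem IsNCSC.gradient_primal_sq_le (hf : IsNCSC f ℓ μ L₂) (hμ : 0 < μ) (hμℓ : μ ≤ ℓ)
    (x : Vec n) : ‖gradient (primal f) x‖ ^ 2
      ≤ 2 * ((1 + ℓ / μ) * ℓ) * (primal f x - ⨅ x, primal f x) := by
  have hℓ := hμ.trans_le hμℓ
  have hL : 0 < (1 + ℓ / μ) * ℓ := by positivity
  set g := gradient (primal f) x
  have h1 := hf.primal_le hμ hμℓ x (x - ((1 + ℓ / μ) * ℓ)⁻¹ • g)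
  have h2 := hf.iInf_le_primal (x - ((1 + ℓ / μ) * ℓ)⁻¹ • g)
  generalize (1 + ℓ / μ) * ℓ = L at *
  rw [sub_sub_cancel_left, inner_neg_right, inner_smul_right, real_inner_self_eq_norm_sq,
    norm_neg, norm_smul, Real.norm_of_nonneg (by positivity)] at h1
  change _ ≤ _ + -(L⁻¹ * ‖g‖ ^ 2) + _ at h1
  have e : ‖g‖ ^ 2 = 2 * L * (L⁻¹ * ‖g‖ ^ 2 - L / 2 * (L⁻¹ * ‖g‖) ^ 2) := by field_simp; ring
  rw [e]
  exact mul_le_mul_of_nonneg_left (by linarith) (by linarith)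

/-- By Danskin's formula ∇_x f(x, y) differs from ∇Φ(x) by at most ℓ times the distance from y to
the maximizer, which strong concavity bounds by the gap. -/
theorem IsNCSC.gradX_le (hf : IsNCSC f ℓ μ L₂) (hμ : 0 < μ) (hμℓ : μ ≤ ℓ) (x : Vec n)
    (y : Vec m) : ‖gradX f x y‖ ≤ ‖gradient (primal f) x‖
      + √(2 * (ℓ / μ) * ℓ * (primal f x - f (pair x y))) := by
  have hℓ := hμ.trans_le hμℓ
  obtain ⟨ys, h1, h2, -, h4⟩ := hf.exists_primal hμ hμℓ x
  have h5 := h4 y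
  rw [h2, ← sub_le_iff_le_add']
  refine (norm_sub_norm_le _ _).trans ((hf.gradX_lipschitz_snd x y ys).trans ?_)
  refine Real.le_sqrt_of_sq_le ?_
  have e : (ℓ * ‖y - ys‖) ^ 2 = 2 * (ℓ / μ) * ℓ * (μ / 2 * ‖y - ys‖ ^ 2) := by field_simp
  rw [e]
  gcongr
  linarith

/-- A bound for the initial gradients of the subproblems centred in a large ball. -/
theorem IsNCSC.data_bound (hf : IsNCSC f ℓ μ L₂) (hμ : 0 < μ) (hμℓ : μ ≤ ℓ) {ε A : ℝ}
    (hε : 0 < ε) (hA : 4 ≤ A) (hκ : 1 + ℓ / μ ≤ A) {p₀ : Vec n} {y₀ : Vec m}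
    (hΔ : ℓ * (primal f p₀ - ⨅ x, primal f x) ≤ ε ^ 2 * A ^ 2)
    (hD : ℓ * (primal f p₀ - f (pair p₀ y₀)) ≤ ε ^ 2 * A) {p c : Vec n}
    (hp : ‖p - p₀‖ ≤ ε / ℓ * A ^ 10) (hc : ‖c - p₀‖ ≤ ε / ℓ * A ^ 10) (α : ℝ) :
    ‖gradX f p y₀ + proxShift α ℓ p c p‖ ≤ ε * A ^ 12 ∧ ‖gradY f p y₀‖ ≤ ε * A ^ 12 := by
  have hℓ := hμ.trans_le hμℓ
  have hA0 : 0 < A := by linarith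
  have hκ0 : 0 < ℓ / μ := by positivity
  have hD0 : 0 ≤ ℓ * (primal f p₀ - f (pair p₀ y₀)) :=
    mul_nonneg hℓ.le (sub_nonneg.2 (hf.le_primal hμ hμℓ p₀ y₀))
  have hΔ0 : 0 ≤ ℓ * (primal f p₀ - ⨅ x, primal f x) :=
    mul_nonneg hℓ.le (sub_nonneg.2 (hf.iInf_le_primal p₀))
  have hA4 : 2 * A ^ 3 ≤ A ^ 4 := by
    have h1 := SolverInput.four_mul_pow_le hA 3
    have : 0 < A ^ 3 := by positivity
    norm_num1 at h1
    linarith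
  have hA1 : A ≤ A ^ 3 := le_self_pow₀ (by linarith) (by norm_num)
  have hA2 : A * A ≤ A ^ 3 := by
    rw [← sq]
    exact pow_le_pow_right₀ (by linarith) (by norm_num)
  have hε2 : 0 < ε ^ 2 := by positivity
  have e4 : (ε * A ^ 2) ^ 2 = ε ^ 2 * A ^ 4 := by rw [mul_pow, ← pow_mul]
  have hfin : ∀ {t : ℝ}, t ≤ ε ^ 2 * (2 * A ^ 3) → t ≤ (ε * A ^ 2) ^ 2 := fun h => by
    rw [e4]
    exact h.trans (mul_le_mul_of_nonneg_left hA4 hε2.le)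
  have g1 : ‖gradY f p₀ y₀‖ ≤ ε * A ^ 2 := by
    refine le_of_sq_le_sq ((hf.gradY_sq_le hμ hμℓ p₀ y₀).trans (hfin ?_)) (by positivity)
    have := mul_le_mul_of_nonneg_left hA1 hε2.le
    linarith
  have g2 : ‖gradient (primal f) p₀‖ ≤ ε * A ^ 2 := by
    refine le_of_sq_le_sq ((hf.gradient_primal_sq_le hμ hμℓ p₀).trans (hfin ?_)) (by positivity)
    calc _ = 2 * ((1 + ℓ / μ) * (ℓ * (primal f p₀ - ⨅ x, primal f x))) := by ring
      _ ≤ 2 * (A * (ε ^ 2 * A ^ 2)) := by gcongr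
      _ = _ := by ring
  have g3 : √(2 * (ℓ / μ) * ℓ * (primal f p₀ - f (pair p₀ y₀))) ≤ ε * A ^ 2 := by
    rw [Real.sqrt_le_left (by positivity)]
    refine hfin ?_
    calc _ = 2 * ((ℓ / μ) * (ℓ * (primal f p₀ - f (pair p₀ y₀)))) := by ring
      _ ≤ 2 * (A * (ε ^ 2 * A)) := by gcongr; linarith
      _ = ε ^ 2 * (2 * (A * A)) := by ring
      _ ≤ _ := by gcongr
  have g4 := hf.gradX_le hμ hμℓ p₀ y₀
  have hr : ℓ * ‖p - p₀‖ ≤ ε * A ^ 10 := by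
    calc ℓ * ‖p - p₀‖ ≤ ℓ * (ε / ℓ * A ^ 10) := by gcongr
      _ = _ := by field_simp
  have hr2 : ℓ * ‖p - c‖ ≤ 2 * (ε * A ^ 10) := by
    have h1 : ‖p - c‖ ≤ ‖p - p₀‖ + ‖c - p₀‖ := by
      rw [← sub_sub_sub_cancel_right p c p₀]
      exact norm_sub_le _ _
    calc ℓ * ‖p - c‖ ≤ ℓ * (ε / ℓ * A ^ 10 + ε / ℓ * A ^ 10) := by gcongr; linarith
      _ = _ := by field_simp; norm_num
  have hA10 : ε * A ^ 2 ≤ ε * A ^ 10 := by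
    gcongr
    · linarith
    · norm_num
  have hA12 : 16 * (ε * A ^ 10) ≤ ε * A ^ 12 := by
    have : (4 : ℝ) ^ 2 ≤ A ^ 2 := by gcongr
    calc 16 * (ε * A ^ 10) = 4 ^ 2 * (ε * A ^ 10) := by norm_num
      _ ≤ A ^ 2 * (ε * A ^ 10) := by gcongr
      _ = _ := by ring
  have hpos : 0 < ε * A ^ 10 := by positivity
  have h1 := hf.gradX_lipschitz_fst p p₀ y₀
  have h2 := hf.gradY_lipschitz_fst p p₀ y₀
  have h3 := norm_sub_norm_le (gradX f p y₀) (gradX f p₀ y₀)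
  have h4 := norm_sub_norm_le (gradY f p y₀) (gradY f p₀ y₀)
  refine ⟨?_, by linarith⟩
  have h5 : ‖proxShift α ℓ p c p‖ = 2 * (ℓ * ‖p - c‖) := by
    rw [proxShift, sub_self, smul_zero, zero_add, norm_smul, Real.norm_of_nonneg (by positivity),
      mul_assoc]
  have h6 := norm_add_le (gradX f p y₀) (proxShift α ℓ p c p)
  linarith

end Data

end

end Minimax

namespace Minimax

open scoped InnerProductSpace

noncomputable section

/-! ### Total cost -/

section Assembly

variable {n m : ℕ} {ℓ μ L₂ ε : ℝ}

/-- The subroutines of IAPUN as functions of the problem constants and of the projections onto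
the balls of radius `α / (4 L₂)`. -/
def stdSubroutines (ℓ μ L₂ ε : ℝ) (y₀ : Vec m) (Pr : Vec n → Vec n → Vec n) : Subroutines n m :=
  solverSubroutines (stdParams ℓ μ L₂ ε) (ε / ℓ * relTol (ℓ ^ 2 / (L₂ * ε)) (1 + ℓ / μ))
    (ε ^ 2 / ℓ * relVal (ℓ ^ 2 / (L₂ * ε)) (1 + ℓ / μ)) y₀ Pr

theorem relGap_sq_le {a K κ : ℝ} (ha : 1 ≤ a) (hK : 1 ≤ K) (hκ : κ ≤ K) :
    2 * κ * relGap a K ^ 2 ≤ relAcc a K ^ 4 / a := by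
  have hb := relAcc_pos ha hK
  unfold relGap
  rw [div_pow, ← pow_mul, le_div_iff₀ (by linarith)]
  have e : 2 * κ * (relAcc a K ^ (2 * 2) / (2 * a * K) ^ 2) * a
      = relAcc a K ^ 4 * (κ / (2 * a * K ^ 2)) := by field_simp
  rw [e]
  refine mul_le_of_le_one_right (by positivity) ?_
  rw [div_le_one (by positivity)]
  have h1 : K ≤ K ^ 2 := le_self_pow₀ hK (by norm_num)
  nlinarith [sq_nonneg K]

theorem stdSubroutines_accurate {f : Pair n m → ℝ} {y₀ : Vec m} {Pr : Vec n → Vec n → Vec n}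
    (t : (stdParams ℓ μ L₂ ε).Tuned) (hf : IsNCSC f ℓ μ L₂)
    (ha : 1 ≤ ℓ ^ 2 / (L₂ * ε)) (hK : 1 ≤ 1 + ℓ / μ)
    (hPr : ∀ p, IsProjection (Metric.closedBall p (stdParams ℓ μ L₂ ε).radius) (Pr p)) :
    (stdSubroutines ℓ μ L₂ ε y₀ Pr).Accurate (stdParams ℓ μ L₂ ε) f := by
  have hℓ : 0 < ℓ := t.ℓ_pos
  have hμ : 0 < μ := t.μ_pos
  have hL : 0 < L₂ := t.L₂_pos
  have hε : 0 < ε := t.ε_pos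
  have hb := relAcc_pos ha hK
  have hg := relGap_pos ha hK
  have hgb := relGap_le ha hK
  have hgs := relGap_sq_le ha hK (κ := ℓ / μ) (by linarith)
  have h1 := relTol_pos ha hK
  have h2 := relVal_pos ha hK
  have hK0 : 0 < 1 + ℓ / μ := by linarith
  refine solverSubroutines_accurate (δ := ε ^ 2 / ℓ * relGap (ℓ ^ 2 / (L₂ * ε)) (1 + ℓ / μ) ^ 2)
    t hf (by positivity) (by positivity) hPr ?_ ?_ ?_ ?_
  · change 400 * (1 + ℓ / μ) ^ 2 * (ℓ * (ε / ℓ * relTol _ _) ^ 2) ≤ _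
    unfold relTol
    generalize relGap (ℓ ^ 2 / (L₂ * ε)) (1 + ℓ / μ) = g at *
    generalize 1 + ℓ / μ = K at *
    apply le_of_eq
    field_simp
    norm_num
  · change 6 * (1 + ℓ / μ) * (ε ^ 2 / ℓ * relVal _ _) ≤ _
    unfold relVal
    generalize relGap (ℓ ^ 2 / (L₂ * ε)) (1 + ℓ / μ) = g at *
    generalize 1 + ℓ / μ = K at *
    apply le_of_eq
    field_simp
  · change _ ≤ ε ^ 2 / ℓ * relAcc _ _ ^ 2
    gcongr
  · change 2 * (ℓ / μ) * (ℓ * (ε ^ 2 / ℓ * relGap _ _ ^ 2))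
      ≤ (ε ^ 2 / ℓ * relAcc _ _ ^ 2 / (√(L₂ * ε) / L₂)) ^ 2
    have e : (ε ^ 2 / ℓ * relAcc (ℓ ^ 2 / (L₂ * ε)) (1 + ℓ / μ) ^ 2 / (√(L₂ * ε) / L₂)) ^ 2
        = ε ^ 2 * (relAcc (ℓ ^ 2 / (L₂ * ε)) (1 + ℓ / μ) ^ 4 / (ℓ ^ 2 / (L₂ * ε))) := by
      generalize relAcc (ℓ ^ 2 / (L₂ * ε)) (1 + ℓ / μ) = b
      rw [div_pow, div_pow (√_), Real.sq_sqrt (by positivity)]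
      field_simp
    rw [e]
    calc _ = ε ^ 2 * (2 * (ℓ / μ) * relGap (ℓ ^ 2 / (L₂ * ε)) (1 + ℓ / μ) ^ 2) := by field_simp
      _ ≤ _ := by gcongr

/-- Every subroutine call in a large ball costs `O(√(ℓ/μ) log² A)` oracle calls. -/
theorem stdSubroutines_cost {f : Pair n m → ℝ} {y₀ : Vec m} {Pr : Vec n → Vec n → Vec n}
    (t : (stdParams ℓ μ L₂ ε).Tuned) (hf : IsNCSC f ℓ μ L₂)
    (hPr : ∀ p, IsProjection (Metric.closedBall p (stdParams ℓ μ L₂ ε).radius) (Pr p))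
    {A : ℝ} (hA : 4 ≤ A) (ha : 1 ≤ ℓ ^ 2 / (L₂ * ε)) (haA : ℓ ^ 2 / (L₂ * ε) ≤ A)
    (hκ : 1 + ℓ / μ ≤ A) {p₀ : Vec n}
    (hΔ : ℓ * (primal f p₀ - ⨅ x, primal f x) ≤ ε ^ 2 * A ^ 2)
    (hD : ℓ * (primal f p₀ - f (pair p₀ y₀)) ≤ ε ^ 2 * A) {p c : Vec n}
    (hp : ‖p - p₀‖ ≤ ε / ℓ * A ^ 10) (hc : ‖c - p₀‖ ≤ ε / ℓ * A ^ 10) :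
    ((((stdSubroutines ℓ μ L₂ ε y₀ Pr).estimate p).run f).2 : ℝ)
        ≤ 480000 * √(ℓ / μ) * Real.log A ^ 2 ∧
    ((((stdSubroutines ℓ μ L₂ ε y₀ Pr).prox p c).run f).2 : ℝ)
        ≤ 480000 * √(ℓ / μ) * Real.log A ^ 2 ∧
    ((((stdSubroutines ℓ μ L₂ ε y₀ Pr).proxBall p c).run f).2 : ℝ)
        ≤ 480000 * √(ℓ / μ) * Real.log A ^ 2 := by
  have hℓ : 0 < ℓ := t.ℓ_pos
  have hμ : 0 < μ := t.μ_pos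
  have hμℓ : μ ≤ ℓ := t.μ_le
  have hε : 0 < ε := t.ε_pos
  have hK : 1 ≤ 1 + ℓ / μ := by
    have : 0 < ℓ / μ := by positivity
    linarith
  have ht1 := relTol_pos ha hK
  have ht2 := relVal_pos ha hK
  have hbd := fun c hc => hf.data_bound hμ hμℓ hε hA hκ hΔ hD (p := p) (c := c) hp hc √(L₂ * ε)
  have hs1 : 1 ≤ √(ℓ / μ) := Real.one_le_sqrt.2 ((one_le_div hμ).2 hμℓ)
  have hs2 : 1 ≤ Real.log A ^ 2 := one_le_pow₀ (SolverInput.one_le_log hA)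
  have hs : 1 ≤ √(ℓ / μ) * Real.log A ^ 2 := one_le_mul_of_one_le_of_one_le hs1 hs2
  have key : ∀ {I : SolverInput n m} {X : Set (Vec n)}, I.Admissible f X L₂ → I.α = √(L₂ * ε) →
      I.ℓ = ℓ → I.μ = μ → I.x₀ = p → I.p = p → I.y₀ = y₀ → ‖I.c - p₀‖ ≤ ε / ℓ * A ^ 10 →
      I.tol = ε / ℓ * relTol (ℓ ^ 2 / (L₂ * ε)) (1 + ℓ / μ) →
      I.τ = ε ^ 2 / ℓ * relVal (ℓ ^ 2 / (L₂ * ε)) (1 + ℓ / μ) →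
      ((I.solve.run f).2 : ℝ) ≤ 478000 * √(ℓ / μ) * Real.log A ^ 2 := by
    intro I X Ad h1 h2 h3 h4 h5 h6 h7 h8 h9
    have hb := hbd _ h7
    have h := Ad.cost_le (A := A) (ε := ε) (tb := relTol (ℓ ^ 2 / (L₂ * ε)) (1 + ℓ / μ))
      (tt := relVal (ℓ ^ 2 / (L₂ * ε)) (1 + ℓ / μ)) hA hε (by rwa [h2, h3]) ht1
      (by rw [h2, h3]; exact relTol_mul_le ha hK) (inv_relTol_le ha hK hA haA hκ)
      (inv_relVal_le ha hK hA haA hκ) (by rw [h8, h2]) (by rw [h9, h2])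
      (by rw [SolverInput.objX, h1, h2, h4, h5, h6]; exact hb.1) (by rw [h4, h6]; exact hb.2)
    rwa [h2, h3] at h
  refine ⟨?_, ?_, ?_⟩
  · have e : (((stdSubroutines ℓ μ L₂ ε y₀ Pr).estimate p).run f).2
        = ((SolverInput.solve ⟨fun _ => p, √(L₂ * ε), ℓ, μ, _, _, p, p, p, y₀⟩).run f).2 + 1 :=
      congrArg Prod.snd (Prog.run_bind f (SolverInput.solve _) _)
    have h := key (admissible_estimate t hf (tol := ε / ℓ * relTol _ _)
      (τ := ε ^ 2 / ℓ * relVal _ _) (by positivity) (by positivity) p)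
      rfl rfl rfl rfl rfl rfl hp rfl rfl
    rw [e]
    push_cast
    refine (add_le_add_left h 1).trans ?_
    linarith
  · have e : (((stdSubroutines ℓ μ L₂ ε y₀ Pr).prox p c).run f).2
        = ((SolverInput.solve ⟨id, √(L₂ * ε), ℓ, μ, _, _, p, c, p, y₀⟩).run f).2 + 0 :=
      congrArg Prod.snd (Prog.run_bind f (SolverInput.solve _) _)
    have h := key (admissible_prox t hf (tol := ε / ℓ * relTol _ _)
      (τ := ε ^ 2 / ℓ * relVal _ _) (by positivity) (by positivity) p c)
      rfl rfl rfl rfl rfl rfl hc rfl rfl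
    rw [e, add_zero]
    refine h.trans ?_
    linarith
  · have e : (((stdSubroutines ℓ μ L₂ ε y₀ Pr).proxBall p c).run f).2
        = ((SolverInput.solve ⟨Pr p, √(L₂ * ε), ℓ, μ, _, _, p, c, p, y₀⟩).run f).2 + 0 :=
      congrArg Prod.snd (Prog.run_bind f (SolverInput.solve _) _)
    have h := key (admissible_proxBall t hf (tol := ε / ℓ * relTol _ _)
      (τ := ε ^ 2 / ℓ * relVal _ _) (by positivity) (by positivity) hPr p c)
      rfl rfl rfl rfl rfl rfl hc rfl rfl
    rw [e, add_zero]
    refine h.trans ?_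
    linarith

/-- Powers of the rate of the accelerated method that are polynomially small. -/
theorem rate_pow_le {s A : ℝ} {N : ℕ} (hs : 1 ≤ s) (hA : 1 ≤ A)
    (hN : 48 * s * Real.log A ≤ N) : (1 - 1 / (6 * s)) ^ N * A ^ 8 ≤ 1 := by
  have h1 : 1 - 1 / (6 * s) ≤ Real.exp (-(1 / (6 * s))) := by
    have := Real.add_one_le_exp (-(1 / (6 * s)))
    linarith
  have h2 := pow_le_pow_left₀ (rate_bounds hs).1 h1 N
  have h3 : A ^ 8 = Real.exp (8 * Real.log A) := by
    rw [mul_comm, Real.exp_mul, Real.exp_log (by linarith)]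
    norm_cast
  rw [← Real.exp_nat_mul] at h2
  calc _ ≤ Real.exp (N * -(1 / (6 * s))) * A ^ 8 := by gcongr
    _ = Real.exp (N * -(1 / (6 * s)) + 8 * Real.log A) := by rw [h3, ← Real.exp_add]
    _ ≤ 1 := by
      rw [Real.exp_le_one_iff]
      have h4 : 48 * s * Real.log A * (1 / (6 * s)) ≤ N * (1 / (6 * s)) := by gcongr
      have h5 : 48 * s * Real.log A * (1 / (6 * s)) = 8 * Real.log A := by field_simp; ring
      linarith

theorem rpow_three_halves_div (hL : 0 < L₂) (hε : 0 < ε) :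
    ε ^ (3 / 2 : ℝ) / L₂ ^ (1 / 2 : ℝ) = ε ^ 2 / √(L₂ * ε) := by
  rw [Real.sqrt_eq_rpow, Real.mul_rpow hL.le hε.le, div_eq_div_iff (by positivity) (by positivity),
    show (3 / 2 : ℝ) = 2 - 1 / 2 by norm_num, Real.rpow_sub hε]
  field_simp
  norm_cast

/-- The fractional powers are √κ_x/U: iterations per epoch, up to logarithms, over the decrease per
epoch, up to a constant. -/
theorem rpow_rate (hℓ : 0 < ℓ) (hL : 0 < L₂) (hε : 0 < ε) :
    ℓ ^ (1 / 2 : ℝ) * L₂ ^ (1 / 4 : ℝ) / ε ^ (7 / 4 : ℝ)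
      = √(ℓ / √(L₂ * ε)) / (ε ^ 2 / √(L₂ * ε)) := by
  have h1 : √(L₂ * ε) = (L₂ * ε) ^ (1 / 4 : ℝ) * (L₂ * ε) ^ (1 / 4 : ℝ) := by
    rw [Real.sqrt_eq_rpow, ← Real.rpow_add (by positivity)]
    norm_num
  have h2 : √(ℓ / √(L₂ * ε)) = ℓ ^ (1 / 2 : ℝ) / (L₂ * ε) ^ (1 / 4 : ℝ) := by
    rw [Real.sqrt_div hℓ.le, Real.sqrt_eq_rpow ℓ, h1, Real.sqrt_mul_self (by positivity)]
  have h3 : ε ^ (7 / 4 : ℝ) = ε ^ 2 / ε ^ (1 / 4 : ℝ) := by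
    rw [show (7 / 4 : ℝ) = 2 - 1 / 4 by norm_num, Real.rpow_sub hε]
    norm_cast
  rw [h2, h1, h3, Real.mul_rpow hL.le hε.le]
  field_simp

theorem energy_le_radius {α s A v Δ : ℝ} (hα : 0 < α) (hs : 1 ≤ s) (hA : 4 ≤ A)
    (hsA : s ^ 2 ≤ A) (hvA : v ≤ A) (hΔ : Δ = v * (ε ^ 2 / α)) :
    Δ + ε ^ 2 / (α * s) ≤ α * (ε / (α * s) * A ^ 2) ^ 2 := by
  have e1 : Δ + ε ^ 2 / (α * s) = ε ^ 2 / (α * s ^ 2) * (v * s ^ 2 + s) := by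
    rw [hΔ]; field_simp
  have e2 : α * (ε / (α * s) * A ^ 2) ^ 2 = ε ^ 2 / (α * s ^ 2) * A ^ 4 := by
    field_simp
  rw [e1, e2]
  refine mul_le_mul_of_nonneg_left ?_ (by positivity)
  have h1 : v * s ^ 2 ≤ A * A := mul_le_mul hvA hsA (by positivity) (by linarith)
  have h2 : s ≤ A := by nlinarith
  have h3 : 16 * (A * A) ≤ A ^ 4 := by
    have : (4 : ℝ) ^ 2 ≤ A ^ 2 := by gcongr
    calc 16 * (A * A) = 4 ^ 2 * A ^ 2 := by ring
      _ ≤ A ^ 2 * A ^ 2 := by gcongr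
      _ = _ := by ring
  nlinarith

theorem rate_energy_lt {A r δ Δ u : ℝ} (hu : 0 < u) (hA : 4 ≤ A) (hr0 : 0 ≤ r)
    (hr : r * A ^ 8 ≤ 1) (hδ : δ ≤ u) (hΔ : Δ ≤ u * A ^ 2) : r * (Δ + 2 * δ) < u / 2000 := by
  have h1 : (4 : ℝ) ^ 6 ≤ A ^ 6 := by gcongr
  have h2 : (4 : ℝ) ^ 2 ≤ A ^ 2 := by gcongr
  have h3 : Δ + 2 * δ ≤ u * (9 / 8 * A ^ 2) := by nlinarith
  have h4 : r * A ^ 2 ≤ 1 / 4 ^ 6 := by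
    rw [le_div_iff₀ (by norm_num)]
    calc r * A ^ 2 * 4 ^ 6 ≤ r * A ^ 2 * A ^ 6 := by gcongr
      _ = r * A ^ 8 := by rw [mul_assoc, ← pow_add]
      _ ≤ 1 := hr
  calc r * (Δ + 2 * δ) ≤ r * (u * (9 / 8 * A ^ 2)) := by gcongr
    _ = u * (9 / 8 * (r * A ^ 2)) := by ring
    _ ≤ u * (9 / 8 * (1 / 4 ^ 6)) := by gcongr
    _ < u * (1 / 2000) := by gcongr; norm_num
    _ = _ := by ring

/-- Bounds the total drift of k epochs, where e = ε/ℓ, s = κ_x, ρ = eA² and d = es: the whole run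
stays within (ε/ℓ)A¹⁰ of p₀. -/
theorem drift_le {e s A k : ℝ} (he : 0 ≤ e) (hs : 1 ≤ s) (hA : 4 ≤ A) (hsA : s ^ 2 ≤ A)
    (hk : k ≤ 40 * A + 1) : k * (12 * s ^ 2 * (e * A ^ 2) + 2 * (e * s)) ≤ e * A ^ 10 := by
  have h0 : s ≤ A := by nlinarith
  have h1 : 12 * s ^ 2 * A ^ 2 + 2 * s ≤ A ^ 5 := by
    have a1 : A ≤ A ^ 3 := le_self_pow₀ (by linarith) (by norm_num)
    have a2 : (4 : ℝ) ^ 2 ≤ A ^ 2 := by gcongr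
    calc 12 * s ^ 2 * A ^ 2 + 2 * s ≤ 12 * A * A ^ 2 + 2 * A ^ 3 := by gcongr; linarith
      _ ≤ 4 ^ 2 * A ^ 3 := by nlinarith [pow_pos (show 0 < A by linarith) 3]
      _ ≤ A ^ 2 * A ^ 3 := by gcongr
      _ = _ := by rw [← pow_add]
  have h2 : 40 * A + 1 ≤ A ^ 5 := by
    have : (4 : ℝ) ^ 4 ≤ A ^ 4 := by gcongr
    calc 40 * A + 1 ≤ 4 ^ 4 * A := by linarith
      _ ≤ A ^ 4 * A := by gcongr
      _ = _ := by ring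
  have h3 : 0 ≤ 12 * s ^ 2 * A ^ 2 + 2 * s := by positivity
  calc _ = e * (k * (12 * s ^ 2 * A ^ 2 + 2 * s)) := by ring
    _ ≤ e * (A ^ 5 * A ^ 5) := by gcongr; linarith
    _ = _ := by rw [← pow_add]

/-- Epochs times iterations times calls. The maximum with U covers the epoch that is run even if the
gap D is tiny. -/
theorem total_cost_le {N k T M : ℕ} {D U s κ l : ℝ} (hN : N ≤ k * (15 * (T + 1) * M))
    (hU : 0 < U) (hs : 0 ≤ s) (hκ : 0 ≤ κ) (hl : 0 ≤ l) (hk : (k : ℝ) ≤ 40 * D / U + 1)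
    (hT : (T : ℝ) + 1 ≤ 50 * (s * l)) (hM : (M : ℝ) ≤ 480000 * κ * l ^ 2) :
    (N : ℝ) ≤ 15000000000 * (κ * max D U * (s / U)) * l ^ 3 := by
  have h1 : (N : ℝ) ≤ k * (15 * (T + 1) * M) := by exact_mod_cast hN
  have h2 : 40 * D / U + 1 ≤ 41 * max D U / U := by
    rw [div_add_one hU.ne']
    gcongr
    linarith [le_max_left D U, le_max_right D U]
  have h3 : 0 ≤ max D U / U := div_nonneg (hU.le.trans (le_max_right _ _)) hU.le
  calc (N : ℝ) ≤ k * (15 * (T + 1) * M) := h1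
    _ ≤ (41 * max D U / U) * (15 * (50 * (s * l)) * (480000 * κ * l ^ 2)) := by
      gcongr
      exact hk.trans h2
    _ = 14760000000 * (κ * (max D U / U) * s * l ^ 3) := by ring
    _ ≤ 15000000000 * (κ * (max D U / U) * s * l ^ 3) := by gcongr; norm_num
    _ = _ := by ring

/-- IAPUN with the standard parameters and subroutines. -/
theorem stdSubroutines_returns {f : Pair n m → ℝ} {y₀ : Vec m} {Pr : Vec n → Vec n → Vec n}
    (t : (stdParams ℓ μ L₂ ε).Tuned) (hf : IsNCSC f ℓ μ L₂)
    (hPr : ∀ p, IsProjection (Metric.closedBall p (stdParams ℓ μ L₂ ε).radius) (Pr p))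
    (ha : 1 ≤ ℓ ^ 2 / (L₂ * ε)) {p₀ : Vec n} {A : ℝ}
    (hA : A = 2 + ℓ / μ + ℓ ^ 2 / (L₂ * ε)
      + (primal f p₀ - ⨅ x, primal f x) / (ε ^ 2 / √(L₂ * ε))
      + ℓ * (primal f p₀ - f (pair p₀ y₀)) / ε ^ 2) :
    ∃ (p : Vec n) (N : ℕ),
      IAPUNReturns (stdParams ℓ μ L₂ ε) (stdSubroutines ℓ μ L₂ ε y₀ Pr) f p₀ p N ∧
      ‖gradient (primal f) p‖ ≤ ε ∧
      (N : ℝ) ≤ 15000000000 * (√(ℓ / μ) *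
        max (primal f p₀ - ⨅ x, primal f x) (ε ^ 2 / √(L₂ * ε)) *
        (√(ℓ / √(L₂ * ε)) / (ε ^ 2 / √(L₂ * ε)))) * Real.log A ^ 3 := by
  have hℓ : 0 < ℓ := t.ℓ_pos
  have hμ : 0 < μ := t.μ_pos
  have hμℓ : μ ≤ ℓ := t.μ_le
  have hL : 0 < L₂ := t.L₂_pos
  have hε : 0 < ε := t.ε_pos
  have hα : 0 < √(L₂ * ε) := t.α_pos
  have hκ : 1 ≤ ℓ / μ := (one_le_div hμ).2 hμℓ
  have hK : 1 ≤ 1 + ℓ / μ := by linarith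
  have hb := relAcc_pos ha hK
  have hb1 := relAcc_le ha hK
  have R : Regular (stdParams ℓ μ L₂ ε) (stdSubroutines ℓ μ L₂ ε y₀ Pr) f :=
    ⟨t, hf, stdSubroutines_accurate t hf ha hK hPr⟩
  have hs : 1 ≤ ℓ / √(L₂ * ε) := t.κx_one_le
  have hss : 1 ≤ √(ℓ / √(L₂ * ε)) := Real.one_le_sqrt.2 hs
  have hdε : √(L₂ * ε) * (stdParams ℓ μ L₂ ε).d = ε := t.α_mul_d
  have hd : (stdParams ℓ μ L₂ ε).d = ε / √(L₂ * ε) := by rw [eq_div_iff hα.ne', mul_comm, hdε]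
  set Δ := primal f p₀ - ⨅ x, primal f x with hΔdef
  have hΔ0 : 0 ≤ Δ := sub_nonneg.2 (hf.iInf_le_primal p₀)
  have hD0 : 0 ≤ ℓ * (primal f p₀ - f (pair p₀ y₀)) / ε ^ 2 :=
    div_nonneg (mul_nonneg hℓ.le (sub_nonneg.2 (hf.le_primal hμ hμℓ p₀ y₀))) (by positivity)
  have hU : 0 < ε ^ 2 / √(L₂ * ε) := by positivity
  have hv0 : 0 ≤ Δ / (ε ^ 2 / √(L₂ * ε)) := by positivity
  have hA4 : 4 ≤ A := by linarith
  have haA : ℓ ^ 2 / (L₂ * ε) ≤ A := by linarith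
  have hκA : 1 + ℓ / μ ≤ A := by linarith
  have hvA : Δ / (ε ^ 2 / √(L₂ * ε)) ≤ A := by linarith
  have hDA : ℓ * (primal f p₀ - f (pair p₀ y₀)) ≤ ε ^ 2 * A := by
    have : ℓ * (primal f p₀ - f (pair p₀ y₀)) / ε ^ 2 ≤ A := by linarith
    rwa [div_le_iff₀' (by positivity)] at this
  have hsA : (ℓ / √(L₂ * ε)) ^ 2 ≤ A := by rwa [← ratio_eq hL hε]
  have hsA1 : ℓ / √(L₂ * ε) ≤ A := by nlinarith
  have hΔv : Δ = Δ / (ε ^ 2 / √(L₂ * ε)) * (ε ^ 2 / √(L₂ * ε)) := (div_mul_cancel₀ _ hU.ne').symm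
  have hΔA : ℓ * Δ ≤ ε ^ 2 * A ^ 2 := by
    calc ℓ * Δ = ε ^ 2 * (Δ / (ε ^ 2 / √(L₂ * ε)) * (ℓ / √(L₂ * ε))) := by field_simp
      _ ≤ ε ^ 2 * (A * A) := by gcongr
      _ = _ := by ring
  have hlog := SolverInput.one_le_log hA4
  have hcost := fun p hp c hc =>
    stdSubroutines_cost (y₀ := y₀) (p := p) (c := c) t hf hPr hA4 ha haA hκA hΔA hDA hp hc
  -- 48 = 6·8: the rate 1 - 1/(6√κ_x) then falls below A⁻⁸ within T steps. The +1 in k makes the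
  -- budget strictly larger than the gap divided by U/40.
  set T := ⌈48 * √(ℓ / √(L₂ * ε)) * Real.log A⌉₊ with hT
  set M := ⌊480000 * √(ℓ / μ) * Real.log A ^ 2⌋₊ with hM
  set k := ⌊40 * Δ / (ε ^ 2 / √(L₂ * ε))⌋₊ + 1 with hk
  have hx : 1 ≤ √(ℓ / √(L₂ * ε)) * Real.log A := one_le_mul_of_one_le_of_one_le hss hlog
  have hT1 : 48 * √(ℓ / √(L₂ * ε)) * Real.log A ≤ T := Nat.le_ceil _
  have hT2 : (T : ℝ) + 1 ≤ 50 * (√(ℓ / √(L₂ * ε)) * Real.log A) := by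
    have := Nat.ceil_lt_add_one (show 0 ≤ 48 * √(ℓ / √(L₂ * ε)) * Real.log A by positivity)
    rw [← hT] at this
    linarith
  have hk1 : 40 * Δ / (ε ^ 2 / √(L₂ * ε)) < k := by
    rw [hk]
    push_cast
    exact Nat.lt_floor_add_one _
  have hk2 : (k : ℝ) ≤ 40 * Δ / (ε ^ 2 / √(L₂ * ε)) + 1 := by
    rw [hk]
    push_cast
    exact add_le_add_left (Nat.floor_le (by positivity)) 1
  have hball : ∀ x : Vec n, x ∈ Metric.closedBall p₀ (ε / ℓ * A ^ 10) →
      ‖x - p₀‖ ≤ ε / ℓ * A ^ 10 := fun x hx => mem_closedBall_iff_norm.1 hx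
  obtain ⟨p, N, h1, h2, h3⟩ := R.outerLoop_run (p₀ := p₀) (Tm := T) (B := max (T + 1) k) (M := M)
    (Δ := Δ) (ρ := ε / ℓ * A ^ 2) (Ω := Metric.closedBall p₀ (ε / ℓ * A ^ 10))
    (fun x => sub_le_sub_left (hf.iInf_le_primal x) _) (by positivity)
    (by
      have := energy_le_radius (ε := ε) hα hs hA4 hsA hvA hΔv
      rwa [mul_div_cancel₀ ℓ hα.ne'] at this)
    (by
      have h := rate_energy_lt (u := ε ^ 2 / ℓ) (δ := (stdParams ℓ μ L₂ ε).δx) (Δ := Δ)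
        (by positivity) hA4 (pow_nonneg (rate_bounds hss).1 (T + 1))
        (rate_pow_le hss (by linarith) (by push_cast; linarith))
        (mul_le_of_le_one_right (by positivity) (pow_le_one₀ hb.le (by linarith)))
        (by rw [div_mul_eq_mul_div, le_div_iff₀ hℓ]; linarith)
      rwa [div_div, mul_comm ℓ 2000] at h)
    (lt_of_lt_of_le (Nat.lt_succ_self T) (le_max_left _ _))
    (fun x hx => Nat.le_floor (hcost x (hball x hx) x (hball x hx)).1)
    (fun p hp c hc => Nat.le_floor (hcost p (hball p hp) c (hball c hc)).2.1)
    (fun p hp c hc => Nat.le_floor (hcost p (hball p hp) c (hball c hc)).2.2) k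
    (max (T + 1) k) p₀ (le_max_right _ _) le_rfl
    (by
      rw [← hΔdef, hd]
      change Δ < k * (√(L₂ * ε) * (ε / √(L₂ * ε)) ^ 2 / 40)
      rw [div_lt_iff₀ hU] at hk1
      have e : √(L₂ * ε) * (ε / √(L₂ * ε)) ^ 2 = ε ^ 2 / √(L₂ * ε) := by field_simp
      rw [e]
      linarith)
    (by
      refine Metric.closedBall_subset_closedBall ?_
      rw [hd]
      have e : ε / √(L₂ * ε) = ε / ℓ * (ℓ / √(L₂ * ε)) := by field_simp
      rw [e]
      refine drift_le (by positivity) hs hA4 hsA (hk2.trans ?_)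
      rw [mul_div_assoc]
      linarith)
  exact ⟨p, N, ⟨_, h1⟩, h2, total_cost_le h3 hU (by positivity) (by positivity) (by linarith) hk2
    hT2 (Nat.floor_le (by positivity))⟩

end Assembly

end

end Minimax

theorem mainTheorem2 :
    ∃ (C : ℝ) (q : ℕ), 0 < C ∧
      ∀ ℓ μ L₂ ε : ℝ, 0 < ℓ → 0 < μ → 0 < L₂ → 0 < ε → ε ≤ ℓ ^ 2 / L₂ →
        ∃ δx δy Δy : ℝ, 0 < δx ∧ 0 < δy ∧ 0 < Δy ∧
          ∀ P : Minimax.Params,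
            P = { ℓ := ℓ, μ := μ, L₂ := L₂, ε := ε, α := √(L₂ * ε), γ := ℓ,
                  η := √(L₂ * ε) / L₂, δx := δx, δy := δy, Δy := Δy } →
            ∀ (n m : ℕ), 0 < m → ∀ y₀ : Minimax.Vec m,
              ∃ S : Minimax.Subroutines n m,
                ∀ f : Minimax.Pair n m → ℝ, Minimax.IsNCSC f ℓ μ L₂ →
                  S.Accurate P f ∧
                  ∀ p₀ : Minimax.Vec n, ∃ (p : Minimax.Vec n) (N : ℕ),
                    Minimax.IAPUNReturns P S f p₀ p N ∧
                    ‖gradient (Minimax.primal f) p‖ ≤ ε ∧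
                    (N : ℝ) ≤ C *
                      (√(ℓ / μ) *
                        max (Minimax.primal f p₀ - ⨅ x, Minimax.primal f x)
                          (ε ^ (3 / 2 : ℝ) / L₂ ^ (1 / 2 : ℝ)) *
                        ℓ ^ (1 / 2 : ℝ) * L₂ ^ (1 / 4 : ℝ) / ε ^ (7 / 4 : ℝ)) *
                      Real.log (2 + ℓ / μ + ℓ ^ 2 / (L₂ * ε)
                        + L₂ ^ (1 / 2 : ℝ) *
                            (Minimax.primal f p₀ - ⨅ x, Minimax.primal f x) / ε ^ (3 / 2 : ℝ)
                        + ℓ * (Minimax.primal f p₀ - f (Minimax.pair p₀ y₀)) / ε ^ 2) ^ q := by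
  -- The exponent 3: one logarithm from the iterations of an epoch, two from the nested loops of a
  -- subroutine.
  refine ⟨15000000000, 3, by norm_num, fun ℓ μ L₂ ε hℓ hμ hL hε h => ?_⟩
  have ha := Minimax.one_le_ratio hL hε h
  have hb := Minimax.relAcc_pos ha (K := 1 + ℓ / μ) (le_add_of_nonneg_right (by positivity))
  refine ⟨(Minimax.stdParams ℓ μ L₂ ε).δx, (Minimax.stdParams ℓ μ L₂ ε).δy,
    (Minimax.stdParams ℓ μ L₂ ε).Δy, ?_, ?_, ?_, ?_⟩
  · change 0 < ε ^ 2 / ℓ * Minimax.relAcc _ _ ^ 2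
    positivity
  · change 0 < ε ^ 2 / ℓ * Minimax.relAcc _ _ ^ 2
    positivity
  · change 0 < ε ^ 2 / ℓ * Minimax.relAcc _ _ ^ 2 / (√(L₂ * ε) / L₂)
    positivity
  rintro P rfl n m hm y₀
  have hr : 0 ≤ (Minimax.stdParams ℓ μ L₂ ε).radius := by
    change 0 ≤ √(L₂ * ε) / (4 * L₂)
    positivity
  choose Pr hPr using fun p : Minimax.Vec n => Minimax.exists_isProjection
    (Metric.nonempty_closedBall.2 hr) (Metric.isClosed_closedBall (x := p)).isComplete
    (convex_closedBall p (Minimax.stdParams ℓ μ L₂ ε).radius)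
  refine ⟨Minimax.stdSubroutines ℓ μ L₂ ε y₀ Pr, fun f hf => ?_⟩
  -- μ ≤ ℓ is not assumed; it follows once some f exists. The tolerances and subroutines above were
  -- fixed without it.
  have hμℓ := hf.mu_le hm
  have t := Minimax.stdParams_tuned hℓ hμ hμℓ hL hε h
  refine ⟨Minimax.stdSubroutines_accurate t hf ha (le_add_of_nonneg_right (by positivity)) hPr,
    fun p₀ => ?_⟩
  obtain ⟨p, N, h1, h2, h3⟩ := Minimax.stdSubroutines_returns (y₀ := y₀) (p₀ := p₀) t hf hPr ha rfl
  refine ⟨p, N, h1, h2, h3.trans_eq ?_⟩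
  rw [← Minimax.rpow_rate hℓ hL hε, ← Minimax.rpow_three_halves_div hL hε, mul_assoc (_ * _) (ℓ ^ _),
    mul_div_assoc (_ * _), div_div_eq_mul_div, mul_comm (L₂ ^ (1 / 2 : ℝ))]
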